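/- Let $F$ be a finite extension of some $\mathbb{Q}_p$ (equivalently, a non-archimedean local field of characteristic zero), with residue field of size $q$, normalized absolute value $|\cdot|_F$ and ring of integers $\mathfrak{o}$. Let $\psi$ be a non-trivial continuous additive character of $F$ and let $dy$ be the Haar measure on $F$ that is self-dual with respect to $\psi$. Let $\tau$ be a smooth complex representation of $\mathrm{GL}_2(F)$ which is generic, i.e. there is a non-zero linear functional $\Lambda$ on $\mathcal{V}_\tau$ with $\Lambda\big(\tau\begin{pmatrix}1&y\\&1\end{pmatrix}v\big)=\psi(y)^{-1}\Lambda(v)$ (a Whittaker functional). Assume that $\tau$ is irreducible or induced of Langlands' type, the latter meaning that $\tau$ is isomorphic to the normalized induced representation of $\mathrm{GL}_2(F)$ attached to characters $\chi_1,\chi_2$ of $F^\times$ with $|\chi_1\chi_2^{-1}(\varpi)|\le 1$ for a uniformizer $\varpi$; in particular $\tau$ may be reducible. Let $\mathrm{SO}_4(F)=\{g\in \mathrm{SL}_4(F): {}^tg\,\jmath_4\,g=\jmath_4\}$, where $\jmath_m$ is the $m\times m$ matrix with ones on the antidiagonal and zeros elsewhere, and put $$m_2(a)=\begin{pmatrix}a&\\&\jmath_2{}^ta^{-1}\jmath_2\end{pmatrix}\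 (a\in\mathrm{GL}_2(F)),\qquad n_2(y)=\begin{pmatrix}1&&-y&\\&1&&y\\&&1&\\&&&1\end{pmatrix}\ (y\in F),\qquad \omega_2=\begin{pmatrix}&I_2\\I_2&\end{pmatrix},\qquad d_2=\begin{pmatrix}1&\\&-1\end{pmatrix}.$$ For $s\in\mathbb{C}$ let $I(\tau,s)$ be the space of smooth functions $\xi:\mathrm{SO}_4(F)\to\mathcal{V}_\tau$ with $\xi(m_2(a)n_2(y)h)=|\det a|_F^{1/2}|\det a|_F^{s-1/2}\tau(a)\xi(h)$. A standard section is a family $\xi_s\in I(\tau,s)$, $s\in\mathbb{C}$, whose restriction to $\mathrm{SO}_4(\mathfrak{o})$ does not depend on $s$. For such a family let $M(\tau,s)\xi_s(h)=\int_F\xi_s(\omega_2^{-1}n_2(y)h)\,dy$ for $\mathrm{Re}(s)\gg0$, continued to a rational function of $q^{-s}$. Shahidi's local coefficient $\gamma(s,\tau,\bigwedge^2,\psi)\in\mathbb{C}(q^{-s})$ is defined by the identity $$\int_F\Lambda\big(\xi_s(\omega_2n_2(y))\big)\psi(y)\,dy=\gamma(2s-1,\tau,{\textstyle\bigwedge^2},\psi)\int_F\Lambda\big(\tau(d_2)\,M(\tau,s)\xi_s(\omega_2n_2(y))\big)\psi(y)\,dy$$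 of rational functions of $q^{-s}$, for all Whittaker functionals $\Lambda$ of $\tau$ and all standard sections $\xi_s$; here the integrals are understood as their common value over all sufficiently large balls of $F$. Then $\tau$ has a unique central character $\omega_\tau$, the local coefficient $\gamma(s,\tau,\bigwedge^2,\psi)$ exists and is unique, and $$\gamma(s,\tau,{\textstyle\bigwedge^2},\psi)=\gamma(s,\omega_\tau,\psi)$$ in $\mathbb{C}(q^{-s})$. Here, for a character $\chi$ of $F^\times$, $\gamma(s,\chi,\psi)\in\mathbb{C}(q^{-s})$ is the Tate $\gamma$-factor, i.e. the unique element with $\zeta(1-s,\chi^{-1},\hat\Phi)=\gamma(s,\chi,\psi)\,\zeta(s,\chi,\Phi)$ for all Bruhat–Schwartz functions $\Phi$ on $F$, where $\hat\Phi(x)=\int_F\Phi(y)\psi(xy)\,dy$ and $\zeta(s,\chi,\Phi)=\int_{F^\times}\Phi(x)\chi(x)|x|_F^s\,d^\times x$ (continued to a rational function of $q^{-s}$). -/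

import Mathlib

open MeasureTheory Matrix Filter Topology

noncomputable section

namespace LocalCoefficient

/-! ### The local field

Throughout, `F` is a non-archimedean local field of characteristic zero, i.e. a finite extension
of some `ℚ_p`, with its topology given by an ultrametric multiplicative norm. -/

/-- The size `q` of the residue field of `F`. -/
def residueCard (F : Type*) [NontriviallyNormedField F] [IsUltrametricDist F] : ℕ :=
  Nat.card (IsLocalRing.ResidueField (NormedField.valuation (K := F)).valuationSubring)

/-- The number `q^{-s}`. -/
def qs (F : Type*) [NontriviallyNormedField F] [IsUltrametricDist F] (s : ℂ) : ℂ :=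
  (residueCard F : ℂ) ^ (-s)

/-- `ϖ` is a uniformizer of `F`. -/
def IsUniformizer {F : Type*} [NontriviallyNormedField F] (ϖ : Fˣ) : Prop :=
  ‖(ϖ : F)‖ < 1 ∧ ∀ x : F, ‖x‖ < 1 → ‖x‖ ≤ ‖(ϖ : F)‖

/-- The normalized absolute value `|x|_F` (sending a uniformizer to `q⁻¹`): the factor by which
multiplication by `x` scales an additive Haar measure of `F`. -/
def absF {F : Type*} [NontriviallyNormedField F] [ProperSpace F] (x : Fˣ) : ℝ :=
  (distribHaarChar F x : ℝ)

/-- `|x|_F ^ s` for a complex exponent `s`. -/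
def absPow {F : Type*} [NontriviallyNormedField F] [ProperSpace F] (x : Fˣ) (s : ℂ) : ℂ :=
  (absF x : ℂ) ^ s

/-- Bruhat-Schwartz functions on `F`. -/
def IsSchwartzBruhat {F : Type*} [NontriviallyNormedField F] (Φ : F → ℂ) : Prop :=
  IsLocallyConstant Φ ∧ HasCompactSupport Φ

/-- The Fourier transform `Φ̂(x) = ∫ Φ(y) ψ(xy) dy`. -/
def fourier {F : Type*} [NontriviallyNormedField F] [MeasurableSpace F]
    (ψ : AddChar F Circle) (μ : Measure F) (Φ : F → ℂ) (x : F) : ℂ :=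
  ∫ y, Φ y * (ψ (x * y) : ℂ) ∂μ

/-- The Haar measure `μ` is self-dual with respect to `ψ`. -/
def IsSelfDual {F : Type*} [NontriviallyNormedField F] [MeasurableSpace F]
    (ψ : AddChar F Circle) (μ : Measure F) : Prop :=
  μ.IsAddHaarMeasure ∧
    ∀ Φ : F → ℂ, IsSchwartzBruhat Φ → ∀ x, fourier ψ μ (fourier ψ μ Φ) x = Φ (-x)

/-! ### The Tate gamma factor -/

/-- The integrand of Tate's zeta integral `∫ Φ(x) χ(x) |x|^s d^×x`, with respect to the additive
measure `dx`, where `d^×x = |x|⁻¹ dx`; the value at `x = 0` is irrelevant. -/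
def zetaIntegrand {F : Type*} [NontriviallyNormedField F] [ProperSpace F]
    (χ : Fˣ →* ℂˣ) (Φ : F → ℂ) (s : ℂ) (x : F) : ℂ :=
  open Classical in
  if h : x = 0 then 0
  else Φ x * (χ (Units.mk0 x h) : ℂ) * absPow (Units.mk0 x h) (s - 1)

/-- `Z ∈ ℂ(X)`, evaluated at `X = q^{-s}`, is the meromorphic continuation of the zeta integral
`ζ(s, χ, Φ)`, which converges absolutely for `Re s ≫ 0`. -/
def IsZeta {F : Type*} [NontriviallyNormedField F] [IsUltrametricDist F] [ProperSpace F]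
    [MeasurableSpace F] (μ : Measure F) (χ : Fˣ →* ℂˣ) (Φ : F → ℂ) (Z : RatFunc ℂ) : Prop :=
  ∃ σ : ℝ, ∀ s : ℂ, σ < s.re →
    Integrable (zetaIntegrand χ Φ s) μ ∧
      ∫ x, zetaIntegrand χ Φ s x ∂μ = Z.eval (RingHom.id ℂ) (qs F s)

/-- `γ ∈ ℂ(X)`, evaluated at `X = q^{-s}`, is the Tate gamma factor `γ(s, χ, ψ)`:
`ζ(1 - s, χ⁻¹, Φ̂) = γ(s, χ, ψ) ζ(s, χ, Φ)` for all Bruhat-Schwartz functions `Φ`, as an identity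
of meromorphic functions (so away from finitely many values of `q^{-s}`). -/
def IsTateGamma {F : Type*} [NontriviallyNormedField F] [IsUltrametricDist F] [ProperSpace F]
    [MeasurableSpace F] (ψ : AddChar F Circle) (μ : Measure F) (χ : Fˣ →* ℂˣ)
    (γ : RatFunc ℂ) : Prop :=
  ∀ Φ : F → ℂ, IsSchwartzBruhat Φ → ∃ Z Z' : RatFunc ℂ,
    IsZeta μ χ Φ Z ∧ IsZeta μ χ⁻¹ (fourier ψ μ Φ) Z' ∧
    ∃ E : Finset ℂ, ∀ s : ℂ, qs F s ∉ E →
      Z'.eval (RingHom.id ℂ) (qs F (1 - s)) =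
        γ.eval (RingHom.id ℂ) (qs F s) * Z.eval (RingHom.id ℂ) (qs F s)

/-- The Tate gamma factor `γ(s, χ, ψ)`, as an element of `ℂ(q^{-s})`. -/
def tateGamma {F : Type*} [NontriviallyNormedField F] [IsUltrametricDist F] [ProperSpace F]
    [MeasurableSpace F] (ψ : AddChar F Circle) (μ : Measure F) (χ : Fˣ →* ℂˣ) : RatFunc ℂ :=
  Classical.epsilon (IsTateGamma ψ μ χ)

/-! ### Representations of `GL₂(F)` -/

/-- A function on a topological group is smooth if it is right invariant under some open
subgroup. -/
def IsSmoothFun {G X : Type*} [Group G] [TopologicalSpace G] (f : G → X) : Prop :=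
  ∃ U : OpenSubgroup G, ∀ u ∈ U, ∀ g, f (g * u) = f g

/-- A representation is smooth if every vector is fixed by some open subgroup. -/
def IsSmoothRep {G V : Type*} [Group G] [TopologicalSpace G] [AddCommGroup V] [Module ℂ V]
    (τ : Representation ℂ G V) : Prop :=
  ∀ v, ∃ U : OpenSubgroup G, ∀ u ∈ U, τ u v = v

/-- The diagonal matrix `t(α, β)`. -/
def tMat {F : Type*} [Field F] (α β : Fˣ) : GL (Fin 2) F :=
  GeneralLinearGroup.mkOfDetNeZero !![(α : F), 0; 0, (β : F)] (by simp [det_fin_two])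

/-- The unipotent matrix `z(y)`. -/
def zMat {F : Type*} [Field F] (y : F) : GL (Fin 2) F :=
  GeneralLinearGroup.mkOfDetNeZero !![1, y; 0, 1] (by simp [det_fin_two])

/-- `Λ` is a (possibly zero) Whittaker functional: `Λ(τ(z(y)) v) = ψ(y)⁻¹ Λ(v)`. -/
def IsWhittaker {F V : Type*} [NontriviallyNormedField F] [AddCommGroup V] [Module ℂ V]
    (ψ : AddChar F Circle) (τ : Representation ℂ (GL (Fin 2) F) V) (Λ : V →ₗ[ℂ] ℂ) : Prop :=
  ∀ (y : F) (v : V), Λ (τ (zMat y) v) = (((ψ y)⁻¹ : Circle) : ℂ) * Λ v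

/-- `τ` is generic. -/
def IsGeneric {F V : Type*} [NontriviallyNormedField F] [AddCommGroup V] [Module ℂ V]
    (ψ : AddChar F Circle) (τ : Representation ℂ (GL (Fin 2) F) V) : Prop :=
  ∃ Λ : V →ₗ[ℂ] ℂ, Λ ≠ 0 ∧ IsWhittaker ψ τ Λ

/-- `ω` is the central character of `τ`. -/
def IsCentralCharacter {F V : Type*} [NontriviallyNormedField F] [AddCommGroup V] [Module ℂ V]
    (τ : Representation ℂ (GL (Fin 2) F) V) (ω : Fˣ →* ℂˣ) : Prop :=
  Continuous ω ∧
    ∀ (z : Fˣ) (v : V), τ (GeneralLinearGroup.scalar (Fin 2) z) v = (ω z : ℂ) • v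

/-- The central character `ω_τ`. -/
def centralCharacter {F V : Type*} [NontriviallyNormedField F] [AddCommGroup V] [Module ℂ V]
    (τ : Representation ℂ (GL (Fin 2) F) V) : Fˣ →* ℂˣ :=
  Classical.epsilon (IsCentralCharacter τ)

/-- The space of the normalized induced representation of `GL₂(F)` attached to `(χ₁, χ₂)`: smooth
`f` with `f(t(α, β) z(y) g) = χ₁(α) χ₂(β) |α β⁻¹|^{1/2} f(g)`. -/
def principalSeriesSpace {F : Type*} [NontriviallyNormedField F] [ProperSpace F]
    (χ₁ χ₂ : Fˣ →* ℂˣ) : Submodule ℂ (GL (Fin 2) F → ℂ) where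
  carrier := {f | IsSmoothFun f ∧ ∀ (α β : Fˣ) (y : F) (g : GL (Fin 2) F),
    f (tMat α β * zMat y * g) =
      (χ₁ α : ℂ) * (χ₂ β : ℂ) * absPow (α * β⁻¹) (1 / 2) * f g}
  zero_mem' := ⟨⟨⊤, fun _ _ _ => rfl⟩, fun _ _ _ _ => by simp⟩
  add_mem' := by
    rintro f f' ⟨⟨U, hU⟩, hf⟩ ⟨⟨U', hU'⟩, hf'⟩
    refine ⟨⟨U ⊓ U', fun u hu g => ?_⟩, fun α β y g => ?_⟩
    · simp only [Pi.add_apply]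
      rw [hU u hu.1, hU' u hu.2]
    · simp only [Pi.add_apply]
      rw [hf, hf', mul_add]
  smul_mem' := by
    rintro c f ⟨⟨U, hU⟩, hf⟩
    refine ⟨⟨U, fun u hu g => ?_⟩, fun α β y g => ?_⟩
    · simp only [Pi.smul_apply]
      rw [hU u hu]
    · simp only [Pi.smul_apply, smul_eq_mul]
      rw [hf]
      ring

theorem principalSeries_mem {F : Type*} [NontriviallyNormedField F] [ProperSpace F]
    (χ₁ χ₂ : Fˣ →* ℂˣ) (x : GL (Fin 2) F) {f : GL (Fin 2) F → ℂ}
    (hf : f ∈ principalSeriesSpace χ₁ χ₂) :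
    (fun g => f (g * x)) ∈ principalSeriesSpace χ₁ χ₂ := by
  obtain ⟨⟨U, hU⟩, hf⟩ := hf
  refine ⟨⟨U.comap (MulAut.conj x⁻¹).toMonoidHom ?_, fun u hu g => ?_⟩, fun α β y g => ?_⟩
  · change Continuous fun u : GL (Fin 2) F => x⁻¹ * u * (x⁻¹)⁻¹
    fun_prop
  · have h := hU (x⁻¹ * u * x) (by simpa using hu) (g * x)
    simpa only [mul_assoc, mul_inv_cancel_left] using h
  · simpa only [mul_assoc] using hf α β y (g * x)

/-- The normalized induced representation of `GL₂(F)` attached to `(χ₁, χ₂)`: right translation on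
`principalSeriesSpace χ₁ χ₂`. -/
def principalSeries {F : Type*} [NontriviallyNormedField F] [ProperSpace F]
    (χ₁ χ₂ : Fˣ →* ℂˣ) :
    Representation ℂ (GL (Fin 2) F) (principalSeriesSpace χ₁ χ₂) where
  toFun x :=
    { toFun := fun f => ⟨fun g => f.1 (g * x), principalSeries_mem χ₁ χ₂ x f.2⟩
      map_add' := fun _ _ => rfl
      map_smul' := fun _ _ => rfl }
  map_one' := by
    ext f g
    simp
  map_mul' x y := by
    ext f g
    simp [mul_assoc]

/-- `τ` is induced of Langlands' type: `τ` is isomorphic to the normalized induced representation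
attached to characters `χ₁, χ₂` of `Fˣ` with `|χ₁ χ₂⁻¹(ϖ)| ≤ 1`. -/
def IsInducedOfLanglandsType {F V : Type*} [NontriviallyNormedField F] [ProperSpace F]
    [AddCommGroup V] [Module ℂ V] (τ : Representation ℂ (GL (Fin 2) F) V) : Prop :=
  ∃ χ₁ χ₂ : Fˣ →* ℂˣ, Continuous χ₁ ∧ Continuous χ₂ ∧
    (∀ ϖ : Fˣ, IsUniformizer ϖ → ‖((χ₁ ϖ * (χ₂ ϖ)⁻¹ : ℂˣ) : ℂ)‖ ≤ 1) ∧
    Nonempty (τ.Equiv (principalSeries χ₁ χ₂))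

/-! ### The split group `SO₄(F)`

Matrices of size four are written in blocks of size two. -/

/-- The matrix with ones on the antidiagonal, of size two. -/
def j2 (F : Type*) [Field F] : Matrix (Fin 2) (Fin 2) F := !![0, 1; 1, 0]

/-- The matrix with ones on the antidiagonal, of size four. -/
def j4 (F : Type*) [Field F] : Matrix (Fin 2 ⊕ Fin 2) (Fin 2 ⊕ Fin 2) F :=
  fromBlocks 0 (j2 F) (j2 F) 0

/-- The split special orthogonal group `SO₄(F)`. -/
def SO4 (F : Type*) [Field F] : Subgroup (SpecialLinearGroup (Fin 2 ⊕ Fin 2) F) where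
  carrier := {g | (g.1)ᵀ * j4 F * g.1 = j4 F}
  one_mem' := by simp
  mul_mem' := by
    intro a b ha hb
    simp only [Set.mem_ofPred_eq] at ha hb ⊢
    calc ((a * b).1)ᵀ * j4 F * (a * b).1 = (b.1)ᵀ * ((a.1)ᵀ * j4 F * a.1) * b.1 := by
          rw [show (a * b).1 = a.1 * b.1 from rfl, transpose_mul]
          simp only [Matrix.mul_assoc]
      _ = j4 F := by rw [ha, hb]
  inv_mem' := by
    intro a ha
    simp only [Set.mem_ofPred_eq] at ha ⊢
    have h1 : a.1 * (a⁻¹).1 = 1 := congrArg Subtype.val (mul_inv_cancel a)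
    have h2 : ((a⁻¹).1)ᵀ * (a.1)ᵀ = 1 := by rw [← transpose_mul, h1, transpose_one]
    calc ((a⁻¹).1)ᵀ * j4 F * (a⁻¹).1
        = ((a⁻¹).1)ᵀ * ((a.1)ᵀ * j4 F * a.1) * (a⁻¹).1 := by rw [ha]
      _ = (((a⁻¹).1)ᵀ * (a.1)ᵀ) * j4 F * (a.1 * (a⁻¹).1) := by simp only [Matrix.mul_assoc]
      _ = j4 F := by rw [h1, h2, Matrix.one_mul, Matrix.mul_one]

/-- The elements of `SO₄(𝔬)`. -/
def IsIntegral {F : Type*} [NontriviallyNormedField F] (k : SO4 F) : Prop :=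
  ∀ i j, ‖k.1.1 i j‖ ≤ 1

theorem j2_mul_j2 (F : Type*) [Field F] : j2 F * j2 F = 1 := by
  simp [j2, Matrix.one_fin_two]

theorem j2_transpose (F : Type*) [Field F] : (j2 F)ᵀ = j2 F := by
  ext i j
  fin_cases i <;> fin_cases j <;> rfl

/-- The Levi element `m₂(a) = diag(a, a^*)` of `SO₄(F)`, where `a^* = j ᵗa⁻¹ j`. -/
def m2 {F : Type*} [Field F] (a : GL (Fin 2) F) : SO4 F :=
  ⟨⟨fromBlocks a.1 0 0 (j2 F * (a⁻¹).1ᵀ * j2 F), by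
      have h1 : a.1.det * (a⁻¹).1.det = 1 := by
        rw [← det_mul, ← Units.val_mul, mul_inv_cancel, Units.val_one, det_one]
      have h2 : (j2 F).det * (j2 F).det = 1 := by rw [← det_mul, j2_mul_j2, det_one]
      rw [det_fromBlocks_zero₂₁, det_mul, det_mul, det_transpose]
      linear_combination (j2 F).det * (j2 F).det * h1 + h2⟩, by
    have h1 : (a⁻¹).1 * a.1 = 1 := by rw [← Units.val_mul, inv_mul_cancel, Units.val_one]
    have h2 : (a.1)ᵀ * ((a⁻¹).1)ᵀ = 1 := by rw [← transpose_mul, h1, transpose_one]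
    change (fromBlocks _ _ _ _)ᵀ * j4 F * fromBlocks _ _ _ _ = j4 F
    simp only [j4, fromBlocks_transpose, fromBlocks_multiply, transpose_mul, transpose_transpose,
      transpose_zero, j2_transpose, Matrix.mul_zero, Matrix.zero_mul, add_zero, zero_add]
    congr 1
    · calc (a.1)ᵀ * j2 F * (j2 F * (a⁻¹).1ᵀ * j2 F)
          = (a.1)ᵀ * (j2 F * j2 F) * (a⁻¹).1ᵀ * j2 F := by simp only [Matrix.mul_assoc]
        _ = j2 F := by rw [j2_mul_j2, Matrix.mul_one, h2, Matrix.one_mul]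
    · calc j2 F * ((a⁻¹).1 * j2 F) * j2 F * a.1
          = j2 F * ((a⁻¹).1 * (j2 F * j2 F) * a.1) := by simp only [Matrix.mul_assoc]
        _ = j2 F := by rw [j2_mul_j2, Matrix.mul_one, h1, Matrix.mul_one]⟩

/-- The element `n₂(y)` of the unipotent radical `N₂(F) ≅ F` of the Siegel parabolic subgroup of
`SO₄(F)`; its entries in the upper right block are `(-y, 0; 0, y)`. -/
def n2 {F : Type*} [Field F] (y : F) : SO4 F :=
  ⟨⟨fromBlocks 1 !![-y, 0; 0, y] 0 1, by simp⟩, by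
    change (fromBlocks _ _ _ _)ᵀ * j4 F * fromBlocks _ _ _ _ = j4 F
    have h : j2 F * !![-y, 0; 0, y] + !![-y, 0; 0, y]ᵀ * j2 F = 0 := by
      ext i j
      fin_cases i <;> fin_cases j <;> simp [j2, Matrix.mul_apply, Fin.sum_univ_two]
    simpa [j4, fromBlocks_transpose, fromBlocks_multiply, add_comm] using h⟩

/-- The Weyl element `ω₂`, with identity off-diagonal blocks. -/
def w2 (F : Type*) [Field F] : SO4 F :=
  ⟨⟨fromBlocks 0 1 1 0, by
      have h1 : (fromBlocks 0 1 1 0 : Matrix (Fin 2 ⊕ Fin 2) (Fin 2 ⊕ Fin 2) F) *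
          fromBlocks 1 0 1 1 = fromBlocks 1 1 1 0 := by simp [fromBlocks_multiply]
      have h2 := congrArg det h1
      rw [det_mul, det_fromBlocks_zero₁₂, det_fromBlocks_one₁₁] at h2
      simpa [det_neg] using h2⟩, by
    change (fromBlocks _ _ _ _)ᵀ * j4 F * fromBlocks _ _ _ _ = j4 F
    simp [j4, fromBlocks_transpose, fromBlocks_multiply]⟩

/-! ### Sections, intertwining operators and the local coefficient -/

/-- `ξ` belongs to the space `I(τ, s)` of the normalized induced representation
`Ind (τ ⊗ |det|^{s - 1/2})` from the Siegel parabolic subgroup to `SO₄(F)`; the square root of the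
modulus character is `|det a|^{1/2}`. -/
def MemInd {F V : Type*} [NontriviallyNormedField F] [ProperSpace F] [AddCommGroup V] [Module ℂ V]
    (τ : Representation ℂ (GL (Fin 2) F) V) (s : ℂ) (ξ : SO4 F → V) : Prop :=
  IsSmoothFun ξ ∧ ∀ (a : GL (Fin 2) F) (y : F) (h : SO4 F),
    ξ (m2 a * n2 y * h) =
      (absPow (GeneralLinearGroup.det a) (1 / 2) *
        absPow (GeneralLinearGroup.det a) (s - 1 / 2)) • τ a (ξ h)

/-- `ξ` is a standard section: `ξ_s ∈ I(τ, s)` for every `s`, and the restriction of `ξ_s` to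
`SO₄(𝔬)` does not depend on `s`. -/
def IsStandardSection {F V : Type*} [NontriviallyNormedField F] [ProperSpace F]
    [AddCommGroup V] [Module ℂ V]
    (τ : Representation ℂ (GL (Fin 2) F) V) (ξ : ℂ → SO4 F → V) : Prop :=
  (∀ s, MemInd τ s (ξ s)) ∧ ∀ k, IsIntegral k → ∀ s s', ξ s k = ξ s' k

/-- `v = ∫ f(y) dy` for a function `f` with values in a complex vector space without topology:
for every linear functional `ℓ`, `ℓ ∘ f` is absolutely integrable with integral `ℓ(v)`. -/
def HasVectorIntegral {F V : Type*} [MeasurableSpace F] [AddCommGroup V] [Module ℂ V]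
    (μ : Measure F) (f : F → V) (v : V) : Prop :=
  ∀ ℓ : V →ₗ[ℂ] ℂ, Integrable (fun y => ℓ (f y)) μ ∧ ∫ y, ℓ (f y) ∂μ = ℓ v

/-- `η_s = M(τ, s) ξ_s` as a meromorphic family: for `Re s ≫ 0`,
`η_s(h) = ∫ ξ_s(ω₂⁻¹ n₂(y) h) dy` with an absolutely convergent integral, and `η_s(h)` is a rational
function of `q^{-s}` with values in `V` whose denominator `P` does not depend on `h`. At the zeros
of the denominator the values of `η` carry no meaning. -/
def IsIntertwined {F V : Type*} [NontriviallyNormedField F] [IsUltrametricDist F]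
    [MeasurableSpace F] [AddCommGroup V] [Module ℂ V]
    (μ : Measure F) (ξ η : ℂ → SO4 F → V) : Prop :=
  (∃ σ : ℝ, ∀ s : ℂ, σ < s.re → ∀ h : SO4 F,
    HasVectorIntegral μ (fun y => ξ s ((w2 F)⁻¹ * n2 y * h)) (η s h)) ∧
  ∃ P : Polynomial ℂ, P ≠ 0 ∧ ∀ h : SO4 F, ∃ c : ℤ →₀ V, ∀ s : ℂ, P.eval (qs F s) ≠ 0 →
    P.eval (qs F s) • η s h = c.sum fun k v => (qs F s) ^ k • v

/-- `A = ∫ f(y) dy` for an integral over `F` which is stable: the integrals of `f` over all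
sufficiently large balls exist and are equal to `A`. This is the usual meaning of a Jacquet
(Whittaker) integral outside of its domain of absolute convergence. -/
def HasStableIntegral {F : Type*} [NontriviallyNormedField F] [MeasurableSpace F]
    (μ : Measure F) (f : F → ℂ) (A : ℂ) : Prop :=
  ∀ᶠ R : ℝ in atTop, IntegrableOn f (Metric.closedBall 0 R) μ ∧
    ∫ y in Metric.closedBall 0 R, f y ∂μ = A

/-- `γ ∈ ℂ(X)`, evaluated at `X = q^{-s}`, is Shahidi's local coefficient `γ(s, τ, ∧², ψ)`: for all
Whittaker functionals `Λ` of `τ` and all standard sections `ξ`,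
`∫ Λ(ξ_s(ω₂ n₂(y))) ψ(y) dy = γ(2s - 1, τ, ∧², ψ) ∫ Λ^*(M(τ, s) ξ_s(ω₂ n₂(y))) ψ(y) dy`,
where `Λ^* = Λ ∘ τ(d₂)`, `d₂ = diag(1, -1)`, is the Whittaker functional of `τ^*` attached to `Λ`.
This is an identity of meromorphic functions, so away from finitely many values of `q^{-s}`. -/
def IsLocalCoefficient {F V : Type*} [NontriviallyNormedField F] [IsUltrametricDist F]
    [ProperSpace F] [MeasurableSpace F] [AddCommGroup V] [Module ℂ V]
    (ψ : AddChar F Circle) (μ : Measure F) (τ : Representation ℂ (GL (Fin 2) F) V)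
    (γ : RatFunc ℂ) : Prop :=
  ∀ Λ : V →ₗ[ℂ] ℂ, IsWhittaker ψ τ Λ → ∀ ξ : ℂ → SO4 F → V, IsStandardSection τ ξ →
    ∃ η : ℂ → SO4 F → V, IsIntertwined μ ξ η ∧
    ∃ E : Finset ℂ, ∀ s : ℂ, qs F s ∉ E → ∃ A B : ℂ,
      HasStableIntegral μ (fun y => Λ (ξ s (w2 F * n2 y)) * (ψ y : ℂ)) A ∧
      HasStableIntegral μ (fun y => Λ (τ (tMat 1 (-1)) (η s (w2 F * n2 y))) * (ψ y : ℂ)) B ∧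
      A = γ.eval (RingHom.id ℂ) (qs F (2 * s - 1)) * B

/-- Shahidi's local coefficient `γ(s, τ, ∧², ψ)`, as an element of `ℂ(q^{-s})`. -/
def localCoefficient {F V : Type*} [NontriviallyNormedField F] [IsUltrametricDist F]
    [ProperSpace F] [MeasurableSpace F] [AddCommGroup V] [Module ℂ V]
    (ψ : AddChar F Circle) (μ : Measure F) (τ : Representation ℂ (GL (Fin 2) F) V) : RatFunc ℂ :=
  Classical.epsilon (IsLocalCoefficient ψ μ τ)

end LocalCoefficient

end

noncomputable section

namespace LocalCoefficient

set_option linter.unusedSectionVars false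

open scoped Pointwise

/-! ### Uniformizers, Haar measure and the normalized absolute value. -/

section LocalField

variable {F : Type*} [NontriviallyNormedField F] [IsUltrametricDist F]

/-! The unipotent radical N₂ is one-dimensional, so comparing the two Jacquet integrals is a
rank-one computation. For y ≠ 0 one has ω₂n₂(y) = m₂(y⁻¹d₂) n₂(-y) n₂⁻(y⁻¹) with n₂⁻ lower unipotent
(`w2_mul_n2`). The Levi part is a scalar times d₂, so τ enters only through its central character ω:
ξ_s(ω₂⁻¹n₂(y)ω₂n₂(x)) = ω(y)⁻¹|y|^{-2s} τ(d₂) ξ_s(ω₂n₂(x + y⁻¹)) (`MemInd.apply_n2Minus_n2`). Apply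
Λ∘τ(d₂), integrate over y and against ψ(x), and substitute y ↦ y⁻¹. Translating the Jacquet integral
A of ξ_s by y multiplies it by ψ(-y), so the Jacquet integral B of M(τ,s)ξ_s is A times ∫
ω(y)|y|^{2s-2}ψ(-y) dy (`IsStandardSection.exists_jacquet`). This Gauss integral is the zeta
integral of y ↦ ψ(-y) at 2s-1, and Tate's functional equation identifies it with γ(2s-1,ω,ψ)⁻¹
(`regZeta_functional_equation`, `exists_isTateGamma`). Hence A = γ(2s-1,ω,ψ)B.

Convergence is handled by three devices. The zeta integrand is homogeneous near 0 and the
intertwining integrand near ∞; subtracting a dilate by ϖ removes the singular point at the cost of a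
factor 1 - c q^{-s} or 1 - c q^{-(2s-1)} (`regZeta`, `regIntegrand`), which also shows rationality.
Jacquet and Gauss integrals over large balls stabilize because their tails are invariant under a
translation by some t with ψ(t) ≠ 1. Finally, smoothness turns an integral over a ball into a finite
sum, so exchanging the two integrations is exchanging an integral with a finite sum.

Uniqueness of the local coefficient needs a section with A ≠ 0; one supported near ω₂ does it
(`exists_section_jacquet_ne_zero`). The central character comes from Schur's lemma for spaces of
countable dimension, or directly from the induced model. -/

theorem norm_add_le_of_le {x y : F} {r : ℝ} (hx : ‖x‖ ≤ r) (hy : ‖y‖ ≤ r) : ‖x + y‖ ≤ r :=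
  (IsUltrametricDist.norm_add_le_max x y).trans (max_le hx hy)

theorem norm_sub_le_of_le {x y : F} {r : ℝ} (hx : ‖x‖ ≤ r) (hy : ‖y‖ ≤ r) : ‖x - y‖ ≤ r := by
  rw [sub_eq_add_neg]
  exact norm_add_le_of_le hx (by rwa [norm_neg])

theorem norm_add_eq_of_lt {x y : F} (h : ‖y‖ < ‖x‖) : ‖x + y‖ = ‖x‖ := by
  rw [IsUltrametricDist.norm_add_eq_max_of_norm_ne_norm h.ne', max_eq_left h.le]

variable [ProperSpace F]

/-- For an ultrametric norm the open unit ball is closed, hence compact, so the norm attains a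
maximum on it. -/
theorem exists_isUniformizer : ∃ ϖ : Fˣ, IsUniformizer ϖ := by
  have hc : IsCompact (Metric.ball (0 : F) 1) :=
    (isCompact_closedBall 0 1).of_isClosed_subset (IsUltrametricDist.isClosed_ball 0 1)
      Metric.ball_subset_closedBall
  obtain ⟨p, hp, hmax⟩ := hc.exists_isMaxOn ⟨0, by simp⟩ continuous_norm.continuousOn
  obtain ⟨x, hx0, hx1⟩ := NormedField.exists_norm_lt_one F
  have hx := hmax (show x ∈ Metric.ball (0 : F) 1 by simpa using hx1)
  have hp0 : p ≠ 0 := norm_pos_iff.1 (hx0.trans_le hx)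
  exact ⟨Units.mk0 p hp0, by simpa using hp, fun y hy => hmax (by simpa using hy)⟩

/-- A power of ϖ scales x into the annulus ‖ϖ‖ < · ≤ 1, where maximality of ‖ϖ‖ below 1 leaves only
the norm 1. -/
theorem IsUniformizer.norm_eq_zpow {ϖ : Fˣ} (h : IsUniformizer ϖ) (x : Fˣ) :
    ∃ n : ℤ, ‖(x : F)‖ = ‖(ϖ : F)‖ ^ n := by
  have h0 : 0 < ‖(ϖ : F)‖ := norm_pos_iff.2 ϖ.ne_zero
  have hx0 : 0 < ‖(x : F)‖ := norm_pos_iff.2 x.ne_zero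
  obtain ⟨n, hn1, hn2⟩ := exists_mem_Ioc_zpow hx0 ((one_lt_inv₀ h0).2 h.1)
  refine ⟨-(n + 1), ?_⟩
  have hz : (0 : ℝ) < ‖(ϖ : F)‖ ^ (n + 1) := zpow_pos h0 _
  have e1 : ‖(x * ϖ ^ (n + 1) : F)‖ ≤ 1 := by
    rw [norm_mul, norm_zpow]
    rw [_root_.inv_zpow] at hn2
    calc _ ≤ (‖(ϖ : F)‖ ^ (n + 1))⁻¹ * ‖(ϖ : F)‖ ^ (n + 1) := by gcongr
      _ = 1 := inv_mul_cancel₀ hz.ne'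
  have e2 : ¬ ‖(x * ϖ ^ (n + 1) : F)‖ < 1 := by
    intro hlt
    have h3 := h.2 _ hlt
    rw [norm_mul, norm_zpow] at h3
    rw [_root_.inv_zpow] at hn1
    have : (‖(ϖ : F)‖ ^ n)⁻¹ * ‖(ϖ : F)‖ ^ (n + 1) < ‖(x : F)‖ * ‖(ϖ : F)‖ ^ (n + 1) := by gcongr
    rw [zpow_add_one₀ h0.ne', inv_mul_cancel_left₀ (zpow_pos h0 _).ne'] at this
    rw [zpow_add_one₀ h0.ne'] at h3
    linarith
  have e3 := le_antisymm e1 (not_lt.1 e2)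
  rw [norm_mul, norm_zpow] at e3
  rw [_root_.zpow_neg]
  exact eq_inv_of_mul_eq_one_left e3

/-! ### Additive Haar measure -/

variable [MeasurableSpace F] [BorelSpace F] (μ : Measure F) [μ.IsAddHaarMeasure]

theorem measure_closedBall_ne_top (x : F) (r : ℝ) : μ (Metric.closedBall x r) ≠ ⊤ :=
  (isCompact_closedBall x r).measure_lt_top.ne

theorem measure_closedBall_pos {r : ℝ} (hr : 0 < r) (x : F) : 0 < μ (Metric.closedBall x r) :=
  Metric.measure_closedBall_pos μ x hr


theorem absF_pos (a : Fˣ) : 0 < absF a := distribHaarChar_pos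

theorem absF_mul (a b : Fˣ) : absF (a * b) = absF a * absF b := by
  simp [absF]

theorem absF_one : absF (1 : Fˣ) = 1 := by simp [absF]

theorem absF_inv (a : Fˣ) : absF a⁻¹ = (absF a)⁻¹ := by
  refine eq_inv_of_mul_eq_one_left ?_
  rw [← absF_mul, inv_mul_cancel, absF_one]

theorem measure_smul_set (a : Fˣ) (s : Set F) : μ (a • s) = ENNReal.ofReal (absF a) * μ s := by
  rw [← distribHaarChar_mul μ a s, absF, ENNReal.ofReal_coe_nnreal]

theorem map_mul_measure (a : Fˣ) :
    μ.map (fun x => (a : F) * x) = ENNReal.ofReal (absF a)⁻¹ • μ := by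
  ext s hs
  rw [Measure.map_apply (measurable_const_mul _) hs, Measure.smul_apply, smul_eq_mul,
    ← absF_inv, ← measure_smul_set]
  congr 1
  exact Set.preimage_smul a s

theorem integral_comp_mul {E : Type*} [NormedAddCommGroup E] [NormedSpace ℝ E]
    (a : Fˣ) (f : F → E) : ∫ x, f (a * x) ∂μ = (absF a)⁻¹ • ∫ x, f x ∂μ := by
  have h := (MeasurableEquiv.mulLeft₀ (a : F) a.ne_zero).measurableEmbedding.integral_map (μ := μ) f
  simp only [MeasurableEquiv.coe_mulLeft₀] at h
  rw [← h, map_mul_measure, integral_smul_measure, ENNReal.toReal_ofReal]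
  exact inv_nonneg.2 (absF_pos a).le

theorem integrable_comp_mul {E : Type*} [NormedAddCommGroup E] [NormedSpace ℝ E]
    (a : Fˣ) {f : F → E} (hf : Integrable f μ) : Integrable (fun x => f (a * x)) μ := by
  have h := (MeasurableEquiv.mulLeft₀ (a : F) a.ne_zero).measurableEmbedding.integrable_map_iff
    (μ := μ) (g := f)
  simp only [MeasurableEquiv.coe_mulLeft₀] at h
  refine h.1 ?_
  rw [map_mul_measure]
  exact hf.smul_measure ENNReal.ofReal_ne_top

/-! ### Integrals of functions that are invariant under a ball -/

/-- A finite set of representatives of the ball of radius `R` modulo the ball of radius `δ`. -/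
def IsBallReps (R δ : ℝ) (T : Finset F) : Prop :=
  (∀ t ∈ T, ‖t‖ ≤ R) ∧ (∀ t ∈ T, ∀ t' ∈ T, ‖t - t'‖ ≤ δ → t = t') ∧
    ∀ x : F, ‖x‖ ≤ R → ∃ t ∈ T, ‖x - t‖ ≤ δ

theorem exists_isBallReps {R δ : ℝ} (hδ : 0 < δ) (hR : δ ≤ R) :
    ∃ T : Finset F, IsBallReps R δ T := by
  classical
  obtain ⟨T₀, hT₀, hcov⟩ := (isCompact_closedBall (0 : F) R).elim_nhds_subcover
    (fun x => Metric.closedBall x δ) (fun x _ => Metric.closedBall_mem_nhds x hδ)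
  -- The chosen point depends only on the ball as a set, so points at distance at most δ receive the
  -- same representative.
  let c : F → F := fun x => Classical.epsilon (· ∈ Metric.closedBall x δ)
  have hc : ∀ x, ‖c x - x‖ ≤ δ := fun x => by
    have : c x ∈ Metric.closedBall x δ :=
      Classical.epsilon_spec (p := (· ∈ Metric.closedBall x δ)) ⟨x, Metric.mem_closedBall_self hδ.le⟩
    rwa [mem_closedBall_iff_norm] at this
  have hcc : ∀ x y, ‖x - y‖ ≤ δ → c x = c y := fun x y h => by
    have e : Metric.closedBall x δ = Metric.closedBall y δ :=
      (IsUltrametricDist.closedBall_eq_of_mem (by rwa [mem_closedBall_iff_norm])).symm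
    simp only [c, e]
  refine ⟨T₀.image c, ?_, ?_, ?_⟩
  · intro t ht
    obtain ⟨x, hx, rfl⟩ := Finset.mem_image.1 ht
    have := norm_add_le_of_le ((hc x).trans hR) (mem_closedBall_zero_iff.1 (hT₀ x hx))
    simpa using this
  · intro t ht t' ht' h
    obtain ⟨x, hx, rfl⟩ := Finset.mem_image.1 ht
    obtain ⟨y, hy, rfl⟩ := Finset.mem_image.1 ht'
    apply hcc
    have h1 : ‖x - c x‖ ≤ δ := by rw [norm_sub_rev]; exact hc x
    have := norm_add_le_of_le (norm_add_le_of_le h1 h) (hc y)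
    simpa using this
  · intro x hx
    have := hcov (mem_closedBall_zero_iff.2 hx)
    simp only [Set.mem_iUnion] at this
    obtain ⟨y, hy, hxy⟩ := this
    refine ⟨c y, Finset.mem_image_of_mem c hy, ?_⟩
    have h1 : ‖y - c y‖ ≤ δ := by rw [norm_sub_rev]; exact hc y
    have := norm_add_le_of_le (mem_closedBall_iff_norm.1 hxy) h1
    simpa using this

theorem IsBallReps.closedBall_eq {R δ : ℝ} (hR : δ ≤ R) {T : Finset F} (hT : IsBallReps R δ T) :
    Metric.closedBall (0 : F) R = ⋃ t ∈ T, Metric.closedBall t δ := by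
  ext x
  simp only [Set.mem_iUnion, mem_closedBall_iff_norm, sub_zero, exists_prop]
  refine ⟨hT.2.2 x, ?_⟩
  rintro ⟨t, ht, h⟩
  have := norm_add_le_of_le (h.trans hR) (hT.1 t ht)
  simpa using this

theorem IsBallReps.pairwiseDisjoint {R δ : ℝ} {T : Finset F} (hT : IsBallReps R δ T) :
    (T : Set F).Pairwise (Function.onFun Disjoint fun t => Metric.closedBall t δ) := by
  intro t ht t' ht' hne
  rw [Function.onFun, Set.disjoint_left]
  intro x hx hx'
  apply hne
  apply hT.2.1 t ht t' ht'
  rw [mem_closedBall_iff_norm] at hx hx'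
  have := norm_sub_le_of_le hx' hx
  simpa using this

theorem measure_closedBall_eq (x : F) (r : ℝ) :
    μ (Metric.closedBall x r) = μ (Metric.closedBall 0 r) := by
  have := measure_preimage_add μ (-x) (Metric.closedBall 0 r)
  rw [← this]
  congr 1
  ext y
  simp [add_comm, sub_eq_add_neg]

/-- The integral over a ball of a function that is invariant under a smaller ball is a finite
sum. -/
theorem IsBallReps.integral {R δ : ℝ} (hR : δ ≤ R) {T : Finset F}
    (hT : IsBallReps R δ T) {f : F → ℂ}
    (hf : ∀ x y, ‖x‖ ≤ R → ‖y‖ ≤ δ → f (x + y) = f x) :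
    IntegrableOn f (Metric.closedBall 0 R) μ ∧
      ∫ x in Metric.closedBall 0 R, f x ∂μ =
        ∑ t ∈ T, (μ.real (Metric.closedBall 0 δ) : ℂ) * f t := by
  have hb : ∀ t ∈ T, ∀ x ∈ Metric.closedBall t δ, f x = f t := by
    intro t ht x hx
    have := hf t (x - t) (hT.1 t ht) (mem_closedBall_iff_norm.1 hx)
    simpa using this
  have hm : ∀ t ∈ T, MeasurableSet (Metric.closedBall t δ) := fun t _ =>
    Metric.isClosed_closedBall.measurableSet
  have hi : ∀ t ∈ T, IntegrableOn f (Metric.closedBall t δ) μ := by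
    intro t ht
    refine (integrableOn_congr_fun (hb t ht) (hm t ht)).2 ?_
    exact integrableOn_const (measure_closedBall_ne_top μ t δ)
  rw [hT.closedBall_eq hR]
  refine ⟨(integrableOn_finset_iUnion).2 hi, ?_⟩
  rw [integral_biUnion_finset T hm hT.pairwiseDisjoint hi]
  refine Finset.sum_congr rfl fun t ht => ?_
  rw [setIntegral_congr_fun (hm t ht) (hb t ht), setIntegral_const, Complex.real_smul]
  simp only [measureReal_def, measure_closedBall_eq μ t δ]

/-- Translation invariance forces the vanishing of the integral of an eigenfunction. -/
theorem setIntegral_eq_zero_of_translate {S : Set F} (hS : MeasurableSet S) {t : F} {z : ℂ}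
    (hz : z ≠ 1) (hSt : ∀ x, x + t ∈ S ↔ x ∈ S) {f : F → ℂ}
    (hf : ∀ x ∈ S, f (x + t) = z * f x) : ∫ x in S, f x ∂μ = 0 := by
  rw [← integral_indicator hS]
  have h1 := integral_add_right_eq_self (μ := μ) (S.indicator f) t
  have h2 : ∀ x, S.indicator f (x + t) = z * S.indicator f x := by
    intro x
    by_cases hx : x ∈ S
    · rw [Set.indicator_of_mem hx, Set.indicator_of_mem ((hSt x).2 hx), hf x hx]
    · rw [Set.indicator_of_notMem hx, Set.indicator_of_notMem (fun h => hx ((hSt x).1 h)), mul_zero]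
  simp only [h2] at h1
  rw [integral_const_mul] at h1
  have : (z - 1) * ∫ x, S.indicator f x ∂μ = 0 := by rw [sub_mul, h1]; ring
  exact (mul_eq_zero.1 this).resolve_left (sub_ne_zero.2 hz)

/-! ### The residue field and the normalized absolute value -/

theorem smul_closedBall (a : Fˣ) (r : ℝ) :
    a • Metric.closedBall (0 : F) r = Metric.closedBall 0 (‖(a : F)‖ * r) := by
  have := smul_closedBall' (𝕜 := F) (E := F) a.ne_zero 0 r
  rw [smul_zero] at this
  exact this

/-- Both units carry the unit ball to the same ball, of positive finite measure. This allows |·|_F,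
defined through Haar measure, to be computed from the given norm, whose normalization is arbitrary.
-/
theorem absF_eq_of_norm_eq {a b : Fˣ} (h : ‖(a : F)‖ = ‖(b : F)‖) : absF a = absF b := by
  have e : a • Metric.closedBall (0 : F) 1 = b • Metric.closedBall (0 : F) 1 := by
    rw [smul_closedBall, smul_closedBall, h]
  have h0 := measure_closedBall_pos Measure.addHaar one_pos (0 : F)
  have h1 := measure_closedBall_ne_top Measure.addHaar (0 : F) 1
  have h2 := congrArg Measure.addHaar e
  rw [measure_smul_set, measure_smul_set, ENNReal.mul_left_inj h0.ne' h1] at h2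
  exact (ENNReal.ofReal_eq_ofReal_iff (absF_pos a).le (absF_pos b).le).1 h2

theorem IsUniformizer.le_iff {ϖ : Fˣ} (h : IsUniformizer ϖ) (x : F) :
    ‖x‖ ≤ ‖(ϖ : F)‖ ↔ ‖x‖ < 1 :=
  ⟨fun hx => hx.trans_lt h.1, h.2 x⟩

theorem IsUniformizer.card_reps {ϖ : Fˣ} (h : IsUniformizer ϖ) {T : Finset F}
    (hT : IsBallReps 1 ‖(ϖ : F)‖ T) : residueCard F = T.card := by
  have hmem : ∀ x : F, ‖x‖ ≤ 1 ↔ x ∈ (NormedField.valuation (K := F)).valuationSubring := by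
    intro x
    rw [Valuation.mem_valuationSubring_iff, NormedField.valuation_apply, ← NNReal.coe_le_coe]
    simp
  have hres : ∀ x y : (NormedField.valuation (K := F)).valuationSubring,
      IsLocalRing.residue _ x = IsLocalRing.residue _ y ↔ ‖(x : F) - y‖ < 1 := by
    intro x y
    rw [← sub_eq_zero, ← map_sub, IsLocalRing.residue_eq_zero_iff,
      Valuation.mem_maximalIdeal_iff, NormedField.valuation_apply, ← NNReal.coe_lt_coe]
    simp
  let f : T → IsLocalRing.ResidueField (NormedField.valuation (K := F)).valuationSubring :=
    fun t => IsLocalRing.residue _ ⟨t, (hmem _).1 (hT.1 t t.2)⟩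
  have hf : Function.Bijective f := by
    constructor
    · intro t t' htt
      exact Subtype.ext (hT.2.1 t t.2 t' t'.2 ((h.le_iff _).2 ((hres _ _).1 htt)))
    · intro y
      obtain ⟨x, rfl⟩ := IsLocalRing.residue_surjective y
      obtain ⟨t, ht, hxt⟩ := hT.2.2 x ((hmem _).2 x.2)
      refine ⟨⟨t, ht⟩, (hres _ _).2 ?_⟩
      rw [norm_sub_rev]
      exact (h.le_iff _).1 hxt
  rw [residueCard, ← Nat.card_eq_of_bijective f hf, Nat.card_eq_fintype_card, Fintype.card_coe]

/-- The unit ball is a disjoint union of q translates of its dilate by ϖ, q being the number of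
residue classes. -/
theorem IsUniformizer.absF_eq {ϖ : Fˣ} (h : IsUniformizer ϖ) :
    1 < residueCard F ∧ absF ϖ = (residueCard F : ℝ)⁻¹ := by
  have hpos : 0 < ‖(ϖ : F)‖ := norm_pos_iff.2 ϖ.ne_zero
  obtain ⟨T, hT⟩ := exists_isBallReps (F := F) hpos h.1.le
  have hq := h.card_reps hT
  constructor
  · rw [hq, Finset.one_lt_card]
    obtain ⟨t, ht, ht'⟩ := hT.2.2 0 (by simp)
    obtain ⟨u, hu, hu'⟩ := hT.2.2 1 (by simp)
    refine ⟨t, ht, u, hu, ?_⟩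
    rintro rfl
    have := norm_sub_le_of_le hu' ht'
    rw [h.le_iff] at this
    simp at this
  · have h1 := (hT.integral Measure.addHaar h.1.le (f := fun _ => 1) (fun _ _ _ _ => rfl)).2
    rw [Finset.sum_const, ← hq, setIntegral_const, Complex.real_smul, mul_one, mul_one,
      nsmul_eq_mul] at h1
    have h2 := measure_smul_set Measure.addHaar ϖ (Metric.closedBall (0 : F) 1)
    rw [smul_closedBall, mul_one] at h2
    have h3 : (Measure.addHaar : Measure F).real (Metric.closedBall 0 ‖(ϖ : F)‖) =
        absF ϖ * (Measure.addHaar : Measure F).real (Metric.closedBall 0 1) := by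
      rw [measureReal_def, h2, ENNReal.toReal_mul, ENNReal.toReal_ofReal (absF_pos ϖ).le,
        measureReal_def]
    have h4 : 0 < (Measure.addHaar : Measure F).real (Metric.closedBall 0 1) :=
      ENNReal.toReal_pos (measure_closedBall_pos _ one_pos _).ne' (measure_closedBall_ne_top _ _ _)
    rw [h3] at h1
    norm_cast at h1
    have h5 : (residueCard F : ℝ) * absF ϖ = 1 := by
      have := mul_right_cancel₀ h4.ne' (show 1 * _ = (residueCard F * absF ϖ) * _ by
        rw [one_mul, mul_assoc]; exact h1)
      exact this.symm
    exact eq_inv_of_mul_eq_one_right h5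

theorem one_lt_residueCard : 1 < residueCard F := by
  obtain ⟨ϖ, h⟩ := exists_isUniformizer (F := F)
  exact h.absF_eq.1

theorem qs_ne_zero (s : ℂ) : qs F s ≠ 0 := by
  have := one_lt_residueCard (F := F)
  rw [qs, Ne, Complex.cpow_eq_zero_iff]
  rintro ⟨h, -⟩
  norm_cast at h
  omega

theorem absPow_mul (a b : Fˣ) (s : ℂ) : absPow (a * b) s = absPow a s * absPow b s := by
  rw [absPow, absF_mul, Complex.ofReal_mul,
    Complex.mul_cpow_ofReal_nonneg (absF_pos a).le (absF_pos b).le]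
  rfl

theorem absPow_one (s : ℂ) : absPow (1 : Fˣ) s = 1 := by simp [absPow, absF_one]

theorem absPow_ne_zero (a : Fˣ) (s : ℂ) : absPow a s ≠ 0 := by
  rw [absPow, Ne, Complex.cpow_eq_zero_iff]
  simp [(absF_pos a).ne']

theorem absPow_inv (a : Fˣ) (s : ℂ) : absPow a⁻¹ s = (absPow a s)⁻¹ := by
  refine eq_inv_of_mul_eq_one_left ?_
  rw [← absPow_mul, inv_mul_cancel, absPow_one]

theorem absPow_add (a : Fˣ) (s s' : ℂ) : absPow a (s + s') = absPow a s * absPow a s' := by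
  rw [absPow, Complex.cpow_add _ _ (by exact_mod_cast (absF_pos a).ne')]
  rfl

theorem absPow_neg (a : Fˣ) (s : ℂ) : absPow a (-s) = (absPow a s)⁻¹ := by
  rw [absPow, Complex.cpow_neg]
  rfl

theorem absPow_exponent_one (a : Fˣ) : absPow a 1 = absF a := by simp [absPow]

theorem absPow_sub_one (a : Fˣ) (s : ℂ) : absPow a (s - 1) = absPow a s * (absF a : ℂ)⁻¹ := by
  rw [sub_eq_add_neg, absPow_add, absPow_neg, absPow_exponent_one]

theorem absPow_eq_of_norm_eq {a b : Fˣ} (h : ‖(a : F)‖ = ‖(b : F)‖) (s : ℂ) :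
    absPow a s = absPow b s := by
  rw [absPow, absPow, absF_eq_of_norm_eq h]

theorem absPow_eq_one_of_norm_eq_one {a : Fˣ} (h : ‖(a : F)‖ = 1) (s : ℂ) : absPow a s = 1 := by
  rw [absPow_eq_of_norm_eq (b := 1) (by simpa using h), absPow_one]

theorem IsUniformizer.absPow_eq {ϖ : Fˣ} (h : IsUniformizer ϖ) (s : ℂ) :
    absPow ϖ s = qs F s := by
  rw [absPow, qs, h.absF_eq.2, Complex.ofReal_inv, Complex.ofReal_natCast, Complex.cpow_neg,
    Complex.inv_cpow]
  rw [Complex.natCast_arg]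
  exact Real.pi_pos.ne

theorem absPow_zpow (a : Fˣ) (n : ℤ) (s : ℂ) : absPow (a ^ n) s = absPow a s ^ n := by
  let f : Fˣ →* ℂˣ :=
    { toFun := fun a => Units.mk0 (absPow a s) (absPow_ne_zero a s)
      map_one' := by ext; simp [absPow_one]
      map_mul' := fun a b => by ext; simp [absPow_mul] }
  have := congrArg Units.val (map_zpow f a n)
  simpa [f] using this

/-- `|x|^s` is an integral power of `q^{-s}`. -/
theorem exists_absPow_eq_qs_zpow (x : Fˣ) : ∃ n : ℤ, ∀ s, absPow x s = qs F s ^ n := by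
  obtain ⟨ϖ, h⟩ := exists_isUniformizer (F := F)
  obtain ⟨n, hn⟩ := h.norm_eq_zpow x
  refine ⟨n, fun s => ?_⟩
  rw [absPow_eq_of_norm_eq (b := ϖ ^ n) (by simp [hn]), absPow_zpow, h.absPow_eq]

theorem norm_qs (s : ℂ) : ‖qs F s‖ = (residueCard F : ℝ) ^ (-s.re) := by
  have := one_lt_residueCard (F := F)
  rw [qs, Complex.norm_natCast_cpow_of_pos (by omega), Complex.neg_re]

end LocalField

/-! ### Rational functions and their values -/

section RatFunc

theorem denom_eval_ne_zero {R : RatFunc ℂ} {x : ℂ} (h : x ∉ R.denom.roots.toFinset) :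
    Polynomial.eval₂ (RingHom.id ℂ) x R.denom ≠ 0 := by
  rw [Polynomial.eval₂_id]
  intro h0
  exact h (by simp [R.denom_ne_zero, h0])

theorem ratFunc_eq_of_eval_eq {R S : RatFunc ℂ} {A : Set ℂ} (hA : A.Infinite)
    (h : ∀ x ∈ A, R.eval (RingHom.id ℂ) x = S.eval (RingHom.id ℂ) x) : R = S := by
  let E : Finset ℂ := R.denom.roots.toFinset ∪ S.denom.roots.toFinset
  have hA' : (A \ E).Infinite := hA.sdiff E.finite_toSet
  have hp : R.num * S.denom = S.num * R.denom := by
    refine Polynomial.eq_of_infinite_eval_eq _ _ (hA'.mono ?_)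
    rintro x ⟨hx, hxE⟩
    simp only [E, Finset.coe_union, Set.mem_union, Finset.mem_coe, not_or] at hxE
    have h1 := denom_eval_ne_zero hxE.1
    have h2 := denom_eval_ne_zero hxE.2
    have h3 := h x hx
    rw [RatFunc.eval, RatFunc.eval, div_eq_div_iff h1 h2] at h3
    simpa [Polynomial.eval₂_id] using h3
  rw [← RatFunc.num_div_denom R, ← RatFunc.num_div_denom S, div_eq_div_iff]
  · rw [← map_mul, ← map_mul, hp]
  · exact RatFunc.algebraMap_ne_zero R.denom_ne_zero
  · exact RatFunc.algebraMap_ne_zero S.denom_ne_zero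

/-- `f` agrees with a rational function outside of a finite set. -/
def IsRational (f : ℂ → ℂ) : Prop :=
  ∃ R : RatFunc ℂ, ∃ E : Finset ℂ, ∀ x ∉ E, R.eval (RingHom.id ℂ) x = f x

theorem IsRational.const (c : ℂ) : IsRational fun _ => c :=
  ⟨RatFunc.C c, ∅, fun x _ => by simp⟩

theorem IsRational.id : IsRational fun x => x :=
  ⟨RatFunc.X, ∅, fun x _ => by simp⟩

theorem IsRational.add {f g : ℂ → ℂ} (hf : IsRational f) (hg : IsRational g) :
    IsRational fun x => f x + g x := by
  obtain ⟨R, E, hR⟩ := hf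
  obtain ⟨S, E', hS⟩ := hg
  refine ⟨R + S, (E ∪ E') ∪ (R.denom.roots.toFinset ∪ S.denom.roots.toFinset), fun x hx => ?_⟩
  simp only [Finset.mem_union, not_or] at hx
  rw [RatFunc.eval_add _ _ (denom_eval_ne_zero hx.2.1) (denom_eval_ne_zero hx.2.2),
    hR x hx.1.1, hS x hx.1.2]

theorem IsRational.mul {f g : ℂ → ℂ} (hf : IsRational f) (hg : IsRational g) :
    IsRational fun x => f x * g x := by
  obtain ⟨R, E, hR⟩ := hf
  obtain ⟨S, E', hS⟩ := hg
  refine ⟨R * S, (E ∪ E') ∪ (R.denom.roots.toFinset ∪ S.denom.roots.toFinset), fun x hx => ?_⟩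
  simp only [Finset.mem_union, not_or] at hx
  rw [RatFunc.eval_mul _ _ (denom_eval_ne_zero hx.2.1) (denom_eval_ne_zero hx.2.2),
    hR x hx.1.1, hS x hx.1.2]

theorem IsRational.inv {f : ℂ → ℂ} (hf : IsRational f) : IsRational fun x => (f x)⁻¹ := by
  obtain ⟨R, E, hR⟩ := hf
  -- The zero function is its own inverse under the convention 0⁻¹ = 0.
  by_cases h0 : R = 0
  · refine ⟨0, E, fun x hx => ?_⟩
    simp only [← hR x hx, h0]
    simp
  · refine ⟨R⁻¹, E ∪ (R.denom.roots.toFinset ∪ R⁻¹.denom.roots.toFinset), fun x hx => ?_⟩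
    simp only [Finset.mem_union, not_or] at hx
    have := RatFunc.eval_mul (RingHom.id ℂ) x (denom_eval_ne_zero hx.2.1)
      (denom_eval_ne_zero hx.2.2)
    rw [mul_inv_cancel₀ h0, RatFunc.eval_one, hR x hx.1] at this
    exact eq_inv_of_mul_eq_one_right this.symm

theorem IsRational.pow {f : ℂ → ℂ} (hf : IsRational f) (n : ℕ) :
    IsRational fun x => f x ^ n := by
  induction n with
  | zero => simpa using IsRational.const 1
  | succ n ih => simpa only [pow_succ] using ih.mul hf

theorem IsRational.zpow {f : ℂ → ℂ} (hf : IsRational f) (n : ℤ) :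
    IsRational fun x => f x ^ n := by
  obtain ⟨m, rfl | rfl⟩ := n.eq_nat_or_neg
  · simpa only [zpow_natCast] using hf.pow m
  · simpa only [_root_.zpow_neg, zpow_natCast] using (hf.pow m).inv

theorem IsRational.sum {ι : Type*} (T : Finset ι) {f : ι → ℂ → ℂ}
    (hf : ∀ i ∈ T, IsRational (f i)) : IsRational fun x => ∑ i ∈ T, f i x := by
  classical
  induction T using Finset.induction_on with
  | empty => simpa using IsRational.const 0
  | insert a T ha ih =>
    simp only [Finset.sum_insert ha]
    exact (hf a (Finset.mem_insert_self a T)).add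
      (ih fun i hi => hf i (Finset.mem_insert_of_mem hi))

end RatFunc

/-! ### Values at q^{-s}; additive and multiplicative characters. -/

section LocalField

variable {F : Type*} [NontriviallyNormedField F] [IsUltrametricDist F] [ProperSpace F]
  [MeasurableSpace F] [BorelSpace F]

/-- q^{-s} is never 0 and tends to 0 as Re s → ∞, so some half-plane avoids any finite set of
values. -/
theorem exists_qs_notMem (E : Finset ℂ) : ∃ σ : ℝ, ∀ s : ℂ, σ < s.re → qs F s ∉ E := by
  have hq : (1 : ℝ) < residueCard F := by exact_mod_cast one_lt_residueCard (F := F)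
  obtain ⟨ε, hε, hE⟩ : ∃ ε : ℝ, 0 < ε ∧ ∀ e ∈ E, e ≠ 0 → ε ≤ ‖e‖ := by
    induction E using Finset.induction_on with
    | empty => exact ⟨1, one_pos, by simp⟩
    | insert a E _ ih =>
      obtain ⟨ε, hε, h⟩ := ih
      by_cases ha : a = 0
      · refine ⟨ε, hε, fun e he h0 => ?_⟩
        rcases Finset.mem_insert.1 he with rfl | he
        · exact absurd ha h0
        · exact h e he h0
      · refine ⟨min ε ‖a‖, lt_min hε (norm_pos_iff.2 ha), fun e he h0 => ?_⟩
        rcases Finset.mem_insert.1 he with rfl | he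
        · exact min_le_right _ _
        · exact (min_le_left _ _).trans (h e he h0)
  refine ⟨-Real.logb (residueCard F) ε, fun s hs hmem => ?_⟩
  have h1 := hE _ hmem (qs_ne_zero s)
  rw [norm_qs] at h1
  have h2 : (residueCard F : ℝ) ^ (-s.re) < (residueCard F : ℝ) ^ (Real.logb (residueCard F) ε) :=
    Real.rpow_lt_rpow_of_exponent_lt hq (by linarith)
  rw [Real.rpow_logb (by linarith) hq.ne' hε] at h2
  linarith

theorem qs_add (s s' : ℂ) : qs F (s + s') = qs F s * qs F s' := by
  have := one_lt_residueCard (F := F)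
  rw [qs, neg_add, Complex.cpow_add _ _ (by norm_cast; omega)]
  rfl

theorem qs_zero : qs F 0 = 1 := by simp [qs]

theorem qs_neg (s : ℂ) : qs F (-s) = (qs F s)⁻¹ := by
  refine eq_inv_of_mul_eq_one_left ?_
  rw [← qs_add, neg_add_cancel, qs_zero]

theorem qs_injOn_real {s s' : ℝ} (h : qs F s = qs F s') : s = s' := by
  have hq : (1 : ℝ) < residueCard F := by exact_mod_cast one_lt_residueCard (F := F)
  have h1 := congrArg norm h
  rw [norm_qs, norm_qs] at h1
  have := (Real.rpow_right_inj (by linarith) hq.ne').1 h1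
  simpa using this

/-- Rational functions of `q^{-(2s-1)}` or `q^{-s}` are determined by the values for `Re s ≫ 0`. -/
theorem ratFunc_eq_of_eval_qs_eq {R S : RatFunc ℂ} {σ a b : ℝ} (ha : a ≠ 0)
    (h : ∀ s : ℝ, σ < s → R.eval (RingHom.id ℂ) (qs F (a * s - b : ℝ)) =
      S.eval (RingHom.id ℂ) (qs F (a * s - b : ℝ))) : R = S := by
  refine ratFunc_eq_of_eval_eq (A := (fun s : ℝ => qs F (a * s - b : ℝ)) '' Set.Ioi σ) ?_ ?_
  · refine (Set.Ioi_infinite σ).image fun s _ s' _ hs => ?_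
    have := qs_injOn_real hs
    simpa [ha] using this
  · rintro _ ⟨s, hs, rfl⟩
    exact h s hs

/-! ### Additive characters -/

/-- The circle has no small subgroups: if w is within 1/2 of 1, then |w² - 1| = |w - 1||w + 1| ≥
(3/2)|w - 1|, so repeated squaring would drive z ≠ 1 away from 1. -/
theorem circle_eq_one_of_pow {z : Circle} (h : ∀ n : ℕ, ‖((z ^ n : Circle) : ℂ) - 1‖ ≤ 1 / 2) :
    z = 1 := by
  by_contra hz
  have h0 : 0 < ‖(z : ℂ) - 1‖ := norm_pos_iff.2 (sub_ne_zero.2 fun h => hz (Circle.ext h))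
  have key : ∀ k : ℕ, (3 / 2 : ℝ) ^ k * ‖(z : ℂ) - 1‖ ≤ ‖((z ^ (2 ^ k) : Circle) : ℂ) - 1‖ := by
    intro k
    induction k with
    | zero => simp
    | succ k ih =>
      set w : ℂ := ((z ^ (2 ^ k) : Circle) : ℂ) with hw
      have e : ((z ^ (2 ^ (k + 1)) : Circle) : ℂ) - 1 = (w - 1) * (w + 1) := by
        rw [pow_succ 2 k, pow_mul, Circle.coe_pow, ← hw]
        ring
      have h2 : 3 / 2 ≤ ‖w + 1‖ := by
        have h3 := h (2 ^ k)
        have h4 : ‖(2 : ℂ)‖ ≤ ‖w + 1‖ + ‖w - 1‖ := by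
          have := norm_sub_le (w + 1) (w - 1)
          rwa [show w + 1 - (w - 1) = 2 by ring] at this
        rw [Complex.norm_ofNat] at h4
        linarith
      rw [e, norm_mul, pow_succ]
      calc (3 / 2 : ℝ) ^ k * (3 / 2) * ‖(z : ℂ) - 1‖
          = ((3 / 2 : ℝ) ^ k * ‖(z : ℂ) - 1‖) * (3 / 2) := by ring
        _ ≤ ‖w - 1‖ * ‖w + 1‖ := by gcongr
  obtain ⟨k, hk⟩ := pow_unbounded_of_one_lt (1 / ‖(z : ℂ) - 1‖) (show (1 : ℝ) < 3 / 2 by norm_num)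
  have h1 := (key k).trans (h _)
  rw [div_lt_iff₀ h0] at hk
  linarith

theorem norm_nsmul_le (n : ℕ) (x : F) : ‖n • x‖ ≤ ‖x‖ := by
  induction n with
  | zero => simp
  | succ n ih => rw [succ_nsmul]; exact norm_add_le_of_le ih le_rfl

/-- All multiples n•x stay in the ball of radius ‖x‖, so all powers of ψ(x) are close to 1. -/
theorem exists_addChar_eq_one {ψ : AddChar F Circle} (hψ : Continuous ψ) :
    ∃ δ : ℝ, 0 < δ ∧ ∀ x : F, ‖x‖ ≤ δ → ψ x = 1 := by
  have hc : Continuous fun x => (ψ x : ℂ) := continuous_subtype_val.comp hψ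
  obtain ⟨ε, hε, h⟩ := Metric.continuousAt_iff.1 (hc.continuousAt (x := 0)) (1 / 2) (by norm_num)
  refine ⟨ε / 2, by positivity, fun x hx => circle_eq_one_of_pow fun n => ?_⟩
  rw [← AddChar.map_nsmul_eq_pow]
  have := h (x := n • x) (by
    rw [dist_zero_right]
    exact ((norm_nsmul_le n x).trans hx).trans_lt (by linarith))
  rw [AddChar.map_zero_eq_one, dist_eq_norm] at this
  exact this.le

/-- The additive character `ψ` has conductor `{x | ‖x‖ ≤ C}`. -/
def HasConductor (ψ : AddChar F Circle) (C : ℝ) : Prop :=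
  0 < C ∧ ∀ x : F, (∀ y, ‖y‖ ≤ ‖x‖ → ψ y = 1) ↔ ‖x‖ ≤ C

/-- The set of x whose ball is killed by ψ is closed, bounded because ψ ≠ 1, and contains non-zero
elements by continuity of ψ; C is the maximal norm on it. -/
theorem exists_hasConductor {ψ : AddChar F Circle} (hψ : Continuous ψ) (hψ' : ψ ≠ 1) :
    ∃ C : ℝ, HasConductor ψ C := by
  obtain ⟨δ, hδ, hδψ⟩ := exists_addChar_eq_one hψ
  obtain ⟨z, hz⟩ : ∃ z, ψ z ≠ 1 := by
    by_contra! h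
    exact hψ' (by ext x; simp [h x])
  let S : Set F := {x | ∀ y, ‖y‖ ≤ ‖x‖ → ψ y = 1}
  have hS : IsClosed S := by
    rw [← isOpen_compl_iff, isOpen_iff_mem_nhds]
    intro x hx
    have hx0 : x ≠ 0 := by
      rintro rfl
      refine hx fun y hy => ?_
      rw [norm_zero, norm_le_zero_iff] at hy
      rw [hy, AddChar.map_zero_eq_one]
    filter_upwards [Metric.ball_mem_nhds x (norm_pos_iff.2 hx0)] with y hy
    rw [mem_ball_iff_norm] at hy
    have := norm_add_eq_of_lt hy
    rw [add_sub_cancel] at this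
    intro h
    exact hx fun u hu => h u (by rwa [this])
  have hSz : S ⊆ Metric.closedBall 0 ‖z‖ := by
    intro x hx
    rw [mem_closedBall_zero_iff]
    by_contra! h
    exact hz (hx z h.le)
  obtain ⟨d, hd, hmax⟩ := ((isCompact_closedBall (0 : F) ‖z‖).of_isClosed_subset hS
    hSz).exists_isMaxOn ⟨0, fun y hy => by
      rw [norm_zero, norm_le_zero_iff] at hy
      rw [hy, AddChar.map_zero_eq_one]⟩ continuous_norm.continuousOn
  obtain ⟨x, hx0, hx⟩ := NormedField.exists_norm_lt F hδ
  have hxS : x ∈ S := fun y hy => hδψ y (hy.trans hx.le)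
  exact ⟨‖d‖, hx0.trans_le (hmax hxS), fun x =>
    ⟨fun h => hmax h, fun h y hy => hd y (hy.trans h)⟩⟩

theorem HasConductor.eq_one {ψ : AddChar F Circle} {C : ℝ} (h : HasConductor ψ C) {x : F}
    (hx : ‖x‖ ≤ C) : ψ x = 1 :=
  (h.2 x).2 hx x le_rfl

theorem HasConductor.exists_ne_one {ψ : AddChar F Circle} {C : ℝ} (h : HasConductor ψ C) {x : F}
    (hx : C < ‖x‖) : ∃ y, ‖y‖ ≤ ‖x‖ ∧ ψ y ≠ 1 := by
  by_contra! h'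
  exact absurd ((h.2 x).1 h') (not_le.2 hx)

/-! ### Multiplicative characters -/

/-- The multiplicative character `χ` is trivial on the ball `1 + {x | ‖x‖ ≤ r}`, where `r < 1`. -/
def IsTrivialNearOne (χ : Fˣ →* ℂˣ) (r : ℝ) : Prop :=
  0 < r ∧ r < 1 ∧ ∀ x : Fˣ, ‖(x : F) - 1‖ ≤ r → χ x = 1

theorem IsTrivialNearOne.inv {χ : Fˣ →* ℂˣ} {r : ℝ} (h : IsTrivialNearOne χ r) :
    IsTrivialNearOne χ⁻¹ r :=
  ⟨h.1, h.2.1, fun x hx => by simp [h.2.2 x hx]⟩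

/-- The quasi-character `χ |·|^{s-1}`, extended by zero. -/
def quasiChar (χ : Fˣ →* ℂˣ) (s : ℂ) (x : F) : ℂ :=
  open Classical in
  if h : x = 0 then 0 else (χ (Units.mk0 x h) : ℂ) * absPow (Units.mk0 x h) (s - 1)

theorem zetaIntegrand_eq (χ : Fˣ →* ℂˣ) (Φ : F → ℂ) (s : ℂ) (x : F) :
    zetaIntegrand χ Φ s x = quasiChar χ s x * Φ x := by
  rw [zetaIntegrand, quasiChar]
  split_ifs
  · simp
  · ring

theorem quasiChar_zero (χ : Fˣ →* ℂˣ) (s : ℂ) : quasiChar χ s (0 : F) = 0 := by simp [quasiChar]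

theorem quasiChar_unit (χ : Fˣ →* ℂˣ) (s : ℂ) (x : Fˣ) :
    quasiChar χ s (x : F) = χ x * absPow x (s - 1) := by
  simp [quasiChar]

theorem quasiChar_mul (χ : Fˣ →* ℂˣ) (s : ℂ) (a : Fˣ) (x : F) :
    quasiChar χ s (a * x) = χ a * absPow a (s - 1) * quasiChar χ s x := by
  rcases eq_or_ne x 0 with rfl | hx
  · simp [quasiChar_zero]
  · lift x to Fˣ using hx.isUnit
    rw [← Units.val_mul, quasiChar_unit, quasiChar_unit, map_mul, absPow_mul]
    push_cast
    ring

theorem IsTrivialNearOne.map_eq {χ : Fˣ →* ℂˣ} {r : ℝ} (h : IsTrivialNearOne χ r) {x y : Fˣ}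
    (hxy : ‖(y : F) - x‖ ≤ r * ‖(x : F)‖) : ‖(y : F)‖ = ‖(x : F)‖ ∧ χ y = χ x := by
  have hx := norm_pos_iff.2 x.ne_zero
  constructor
  · have := norm_add_eq_of_lt (x := (x : F)) (y := y - x) (hxy.trans_lt (by nlinarith [h.2.1]))
    rwa [add_sub_cancel] at this
  · have h1 : χ (y * x⁻¹) = 1 := by
      apply h.2.2
      have : ((y * x⁻¹ : Fˣ) : F) - 1 = (y - x) * (x : F)⁻¹ := by
        push_cast
        rw [sub_mul, mul_inv_cancel₀ x.ne_zero]
      rw [this, norm_mul, norm_inv]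
      calc _ ≤ r * ‖(x : F)‖ * ‖(x : F)‖⁻¹ := by gcongr
        _ = r := mul_inv_cancel_right₀ hx.ne' r
    rw [map_mul, map_inv] at h1
    exact mul_inv_eq_one.1 h1

theorem IsTrivialNearOne.quasiChar_add {χ : Fˣ →* ℂˣ} {r : ℝ} (h : IsTrivialNearOne χ r) (s : ℂ)
    {x t : F} (ht : ‖t‖ ≤ r * ‖x‖) : quasiChar χ s (x + t) = quasiChar χ s x := by
  rcases eq_or_ne x 0 with rfl | hx
  · rw [norm_zero, mul_zero, norm_le_zero_iff] at ht
    simp [ht]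
  · have hlt : ‖t‖ < ‖x‖ := ht.trans_lt (by nlinarith [h.2.1, norm_pos_iff.2 hx])
    have hxt : x + t ≠ 0 := by
      rw [← norm_pos_iff, norm_add_eq_of_lt hlt]
      exact norm_pos_iff.2 hx
    obtain ⟨h1, h2⟩ := h.map_eq (x := Units.mk0 x hx) (y := Units.mk0 (x + t) hxt) (by simpa)
    have e1 := quasiChar_unit χ s (Units.mk0 x hx)
    have e2 := quasiChar_unit χ s (Units.mk0 (x + t) hxt)
    rw [Units.val_mk0] at e1 e2
    rw [e1, e2, h2, absPow_eq_of_norm_eq h1]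

theorem IsTrivialNearOne.quasiChar_one_add {χ : Fˣ →* ℂˣ} {r : ℝ} (h : IsTrivialNearOne χ r)
    (s : ℂ) {t : F} (ht : ‖t‖ ≤ r) : quasiChar χ s (1 + t) = 1 := by
  rw [h.quasiChar_add s (by simpa using ht)]
  have := quasiChar_unit χ s (1 : Fˣ)
  simpa [absPow_one] using this

theorem exists_quasiChar_eq (χ : Fˣ →* ℂˣ) (x : F) :
    ∃ (c : ℂ) (n : ℤ), ∀ s, quasiChar χ s x = c * qs F s ^ n := by
  rcases eq_or_ne x 0 with rfl | hx
  · exact ⟨0, 0, fun s => by simp [quasiChar_zero]⟩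
  · lift x to Fˣ using hx.isUnit
    obtain ⟨n, hn⟩ := exists_absPow_eq_qs_zpow x
    refine ⟨χ x * (absF x : ℂ)⁻¹, n, fun s => ?_⟩
    rw [quasiChar_unit, absPow_sub_one, hn]
    ring

end LocalField

/-! ### Regularized zeta integrals and Gauss integrals. -/

section Tate

variable {F : Type*} [NontriviallyNormedField F] [IsUltrametricDist F] [ProperSpace F]
  [MeasurableSpace F] [BorelSpace F]

/-! ### Step functions -/

/-- `Φ` is invariant under the ball of radius `δ` and supported in the ball of radius `R`. -/
structure IsStep (Φ : F → ℂ) (δ R : ℝ) : Prop where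
  pos : 0 < δ
  le : δ ≤ R
  add : ∀ x y, ‖y‖ ≤ δ → Φ (x + y) = Φ x
  zero : ∀ x, R < ‖x‖ → Φ x = 0

theorem IsStep.mono {Φ : F → ℂ} {δ R δ' R' : ℝ} (h : IsStep Φ δ R) (h0 : 0 < δ') (hδ : δ' ≤ δ)
    (hR : R ≤ R') : IsStep Φ δ' R' :=
  ⟨h0, hδ.trans (h.le.trans hR), fun x y hy => h.add x y (hy.trans hδ),
    fun x hx => h.zero x (hR.trans_lt hx)⟩

theorem IsStep.isSchwartzBruhat {Φ : F → ℂ} {δ R : ℝ} (h : IsStep Φ δ R) :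
    IsSchwartzBruhat Φ := by
  constructor
  · rw [IsLocallyConstant.iff_eventually_eq]
    intro x
    filter_upwards [Metric.closedBall_mem_nhds x h.pos] with y hy
    have := h.add x (y - x) (mem_closedBall_iff_norm.1 hy)
    simpa using this
  · refine HasCompactSupport.of_support_subset_isCompact (isCompact_closedBall (0 : F) R) ?_
    intro x hx
    rw [mem_closedBall_zero_iff]
    by_contra! hlt
    exact hx (h.zero x hlt)

/-- A Lebesgue number for the cover of a ball by the fibres of Φ gives the invariance there; outside
the ball, small translations preserve the norm and hence the value 0. -/
theorem IsSchwartzBruhat.exists_isStep {Φ : F → ℂ} (h : IsSchwartzBruhat Φ) :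
    ∃ δ R, IsStep Φ δ R := by
  obtain ⟨R₀, hR₀⟩ := h.2.isCompact.isBounded.subset_closedBall 0
  set R := max R₀ 1
  have hR : ∀ x, R < ‖x‖ → Φ x = 0 := by
    intro x hx
    by_contra hne
    have := hR₀ (subset_tsupport _ hne)
    rw [mem_closedBall_zero_iff] at this
    exact absurd (this.trans (le_max_left R₀ 1)) (not_le.2 hx)
  obtain ⟨δ, hδ, hL⟩ := lebesgue_number_lemma_of_metric (isCompact_closedBall (0 : F) R)
    (c := fun c : ℂ => Φ ⁻¹' {c}) (fun c => h.1.isOpen_fiber c) (fun x _ => by simp)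
  refine ⟨min (δ / 2) R, R, lt_min (by positivity) (lt_max_of_lt_right one_pos), min_le_right _ _,
    fun x y hy => ?_, hR⟩
  by_cases hx : ‖x‖ ≤ R
  · obtain ⟨c, hc⟩ := hL x (mem_closedBall_zero_iff.2 hx)
    have h1 : Φ x = c := hc (Metric.mem_ball_self hδ)
    have h2 : Φ (x + y) = c := hc (by
      rw [mem_ball_iff_norm, add_sub_cancel_left]
      exact (hy.trans (min_le_left _ _)).trans_lt (by linarith))
    rw [h1, h2]
  · have hx' := not_le.1 hx
    rw [hR x hx', hR]
    rwa [norm_add_eq_of_lt ((hy.trans (min_le_right _ _)).trans_lt hx')]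

variable {μ : Measure F} [μ.IsAddHaarMeasure]

theorem IsStep.integral {Φ : F → ℂ} {δ R : ℝ} (h : IsStep Φ δ R) {T : Finset F}
    (hT : IsBallReps R δ T) : Integrable Φ μ ∧
      ∫ x, Φ x ∂μ = ∑ t ∈ T, (μ.real (Metric.closedBall 0 δ) : ℂ) * Φ t := by
  have h1 := hT.integral μ h.le (f := Φ) fun x y _ hy => h.add x y hy
  have hs : Function.support Φ ⊆ Metric.closedBall 0 R := by
    intro x hx
    rw [mem_closedBall_zero_iff]
    by_contra! hlt
    exact hx (h.zero x hlt)
  refine ⟨(integrableOn_iff_integrable_of_support_subset hs).1 h1.1, ?_⟩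
  rw [← h1.2, setIntegral_eq_integral_of_forall_compl_eq_zero]
  intro x hx
  by_contra hne
  exact hx (hs hne)

theorem IsStep.integrable {Φ : F → ℂ} {δ R : ℝ} (h : IsStep Φ δ R) : Integrable Φ μ := by
  obtain ⟨T, hT⟩ := exists_isBallReps (F := F) h.pos h.le
  exact (h.integral hT).1

theorem IsStep.comp_mul {Φ : F → ℂ} {δ R : ℝ} (h : IsStep Φ δ R) (a : Fˣ) :
    IsStep (fun x => Φ (a * x)) (δ / ‖(a : F)‖) (R / ‖(a : F)‖) := by
  have ha : 0 < ‖(a : F)‖ := norm_pos_iff.2 a.ne_zero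
  refine ⟨div_pos h.pos ha, by gcongr; exact h.le, fun x y hy => ?_, fun x hx => ?_⟩
  · rw [le_div_iff₀ ha] at hy
    rw [mul_add]
    exact h.add _ _ (by rwa [norm_mul, mul_comm])
  · rw [div_lt_iff₀ ha] at hx
    exact h.zero _ (by rwa [norm_mul, mul_comm])

theorem IsStep.sub {Φ Φ' : F → ℂ} {δ R δ' R' : ℝ} (h : IsStep Φ δ R) (h' : IsStep Φ' δ' R') :
    IsStep (fun x => Φ x - Φ' x) (min δ δ') (max R R') := by
  have h1 := h.mono (lt_min h.pos h'.pos) (min_le_left _ _) (le_max_left R R')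
  have h2 := h'.mono (lt_min h.pos h'.pos) (min_le_right _ _) (le_max_right R R')
  exact ⟨h1.pos, h1.le, fun x y hy => by rw [h1.add x y hy, h2.add x y hy],
    fun x hx => by rw [h1.zero x hx, h2.zero x hx, sub_zero]⟩

theorem IsStep.const_mul {Φ : F → ℂ} {δ R : ℝ} (h : IsStep Φ δ R) (c : ℂ) :
    IsStep (fun x => c * Φ x) δ R :=
  ⟨h.pos, h.le, fun x y hy => by rw [h.add x y hy], fun x hx => by rw [h.zero x hx, mul_zero]⟩

/-- χ|·|^{s-1} is invariant near x under translations of size r‖x‖, thus of size rρ on the support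
of Φ. The radius does not involve s, which is what makes the integrals rational in q^{-s}. -/
theorem IsStep.mul_quasiChar {Φ : F → ℂ} {δ R ρ r : ℝ} (h : IsStep Φ δ R) {χ : Fˣ →* ℂˣ}
    (hχ : IsTrivialNearOne χ r) (hρ : 0 < ρ) (h0 : ∀ x, ‖x‖ ≤ ρ → Φ x = 0) (s : ℂ) :
    IsStep (fun x => quasiChar χ s x * Φ x) (min δ (r * ρ)) R := by
  have hr := hχ.1
  refine ⟨lt_min h.pos (by positivity), (min_le_left _ _).trans h.le, fun x y hy => ?_,
    fun x hx => by rw [h.zero x hx, mul_zero]⟩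
  rw [h.add x y (hy.trans (min_le_left _ _))]
  by_cases hx : ‖x‖ ≤ ρ
  · rw [h0 x hx, mul_zero, mul_zero]
  · rw [hχ.quasiChar_add s ((hy.trans (min_le_right _ _)).trans ?_)]
    have := not_le.1 hx
    gcongr

/-! ### Regularized zeta integrals -/

/-- The zeta integral `ζ(s, χ, Φ)`, regularized by `(1 - χ(ϖ) q^{-s}) ζ(s, χ, Φ) =
ζ(s, χ, Φ - Φ(ϖ⁻¹ ·))`. -/
def regZeta (μ : Measure F) (ϖ : Fˣ) (χ : Fˣ →* ℂˣ) (s : ℂ) (Φ : F → ℂ) : ℂ :=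
  (1 - χ ϖ * qs F s)⁻¹ *
    ∫ x, quasiChar χ s x * (Φ x - Φ ((ϖ⁻¹ : Fˣ) * x)) ∂μ

theorem integral_quasiChar_comp_mul (χ : Fˣ →* ℂˣ) (s : ℂ) (a : Fˣ) (Φ : F → ℂ) :
    ∫ x, quasiChar χ s x * Φ (a * x) ∂μ =
      (χ a * absPow a s : ℂ)⁻¹ * ∫ x, quasiChar χ s x * Φ x ∂μ := by
  have h := integral_comp_mul μ a fun x => quasiChar χ s x * Φ x
  simp only [quasiChar_mul, mul_assoc] at h
  rw [integral_const_mul, integral_const_mul, absPow_sub_one, Complex.real_smul] at h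
  have h1 := absPow_ne_zero a s
  have h2 : (absF a : ℂ) ≠ 0 := by exact_mod_cast (absF_pos a).ne'
  have h3 := (χ a).ne_zero
  rw [Complex.ofReal_inv] at h
  field_simp at h ⊢
  linear_combination h

theorem IsStep.integrable_quasiChar {χ : Fˣ →* ℂˣ} {r : ℝ} (hχ : IsTrivialNearOne χ r) (s : ℂ)
    {Φ : F → ℂ} {δ R : ℝ} (h : IsStep Φ δ R) (h0 : Φ 0 = 0) :
    Integrable (fun x => quasiChar χ s x * Φ x) μ := by
  refine (h.mul_quasiChar hχ h.pos (fun x hx => ?_) s).integrable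
  rw [← zero_add x, h.add 0 x hx, h0]

theorem IsStep.integrable_reg {χ : Fˣ →* ℂˣ} {r : ℝ} (hχ : IsTrivialNearOne χ r) (s : ℂ)
    {Φ : F → ℂ} {δ R : ℝ} (h : IsStep Φ δ R) (a : Fˣ) :
    Integrable (fun x => quasiChar χ s x * (Φ x - Φ (a * x))) μ :=
  (h.sub (h.comp_mul a)).integrable_quasiChar hχ s (by simp)

/-- When the zeta integral converges, dilating Φ by ϖ⁻¹ multiplies it by χ(ϖ)q^{-s}, so the
regularizing factor cancels. -/
theorem regZeta_eq_integral {ϖ : Fˣ} (hϖ : IsUniformizer ϖ) {χ : Fˣ →* ℂˣ} {s : ℂ}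
    (h1 : χ ϖ * qs F s ≠ 1) {Φ : F → ℂ} (hi : Integrable (fun x => quasiChar χ s x * Φ x) μ) :
    regZeta μ ϖ χ s Φ = ∫ x, quasiChar χ s x * Φ x ∂μ := by
  have e := integral_quasiChar_comp_mul (μ := μ) χ s ϖ⁻¹ Φ
  have hi' : Integrable (fun x => quasiChar χ s x * Φ ((ϖ⁻¹ : Fˣ) * x)) μ := by
    have := (integrable_comp_mul μ ϖ⁻¹ hi).const_mul (χ ϖ * absPow ϖ (s - 1))
    refine this.congr (ae_of_all _ fun x => ?_)
    simp only
    rw [quasiChar_mul, map_inv, absPow_inv, Units.val_inv_eq_inv_val]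
    have h1 := absPow_ne_zero ϖ (s - 1)
    have h3 := (χ ϖ).ne_zero
    field_simp
  rw [map_inv, absPow_inv, Units.val_inv_eq_inv_val (χ ϖ), ← mul_inv, inv_inv,
    hϖ.absPow_eq] at e
  rw [regZeta]
  simp only [mul_sub]
  rw [integral_sub hi hi', e, ← one_sub_mul]
  exact inv_mul_cancel_left₀ (sub_ne_zero.2 h1.symm) _

theorem regZeta_comp_mul (ϖ : Fˣ) (χ : Fˣ →* ℂˣ) (s : ℂ) (a : Fˣ) (Φ : F → ℂ) :
    regZeta μ ϖ χ s (fun x => Φ (a * x)) = (χ a * absPow a s : ℂ)⁻¹ * regZeta μ ϖ χ s Φ := by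
  have h := integral_quasiChar_comp_mul (μ := μ) χ s a fun x => Φ x - Φ ((ϖ⁻¹ : Fˣ) * x)
  rw [regZeta, regZeta, mul_left_comm, ← h]
  simp only [mul_left_comm]

theorem regZeta_const_mul (ϖ : Fˣ) (χ : Fˣ →* ℂˣ) (s : ℂ) (c : ℂ) (Φ : F → ℂ) :
    regZeta μ ϖ χ s (fun x => c * Φ x) = c * regZeta μ ϖ χ s Φ := by
  rw [regZeta, regZeta, mul_left_comm, ← integral_const_mul c]
  congr 2
  refine funext fun x => ?_
  ring

theorem regZeta_sub (ϖ : Fˣ) {χ : Fˣ →* ℂˣ} {r : ℝ} (hχ : IsTrivialNearOne χ r) (s : ℂ)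
    {Φ Φ' : F → ℂ} {δ R δ' R' : ℝ} (h : IsStep Φ δ R) (h' : IsStep Φ' δ' R') :
    regZeta μ ϖ χ s (fun x => Φ x - Φ' x) = regZeta μ ϖ χ s Φ - regZeta μ ϖ χ s Φ' := by
  rw [regZeta, regZeta, regZeta, ← mul_sub,
    ← integral_sub (h.integrable_reg hχ s _) (h'.integrable_reg hχ s _)]
  congr 2
  ext x
  ring

theorem regZeta_sum (ϖ : Fˣ) {χ : Fˣ →* ℂˣ} {r : ℝ} (hχ : IsTrivialNearOne χ r) (s : ℂ)
    {ι : Type*} (T : Finset ι) {Φ : ι → F → ℂ} (h : ∀ i ∈ T, ∃ δ R, IsStep (Φ i) δ R) :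
    regZeta μ ϖ χ s (fun x => ∑ i ∈ T, Φ i x) = ∑ i ∈ T, regZeta μ ϖ χ s (Φ i) := by
  simp only [regZeta]
  rw [← Finset.mul_sum, ← integral_finsetSum]
  · simp only [← Finset.sum_sub_distrib, Finset.mul_sum]
  · intro i hi
    obtain ⟨δ, R, hs⟩ := h i hi
    exact hs.integrable_reg hχ s _

/-- Because Φ vanishes near 0, the integral is a finite sum over representatives independent of s,
and each term is a monomial in q^{-s}. -/
theorem IsStep.isRational_integral {χ : Fˣ →* ℂˣ} {r : ℝ} (hχ : IsTrivialNearOne χ r)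
    {Φ : F → ℂ} {δ R : ℝ} (h : IsStep Φ δ R) (h0 : Φ 0 = 0) :
    ∃ f, IsRational f ∧ ∀ s, ∫ x, quasiChar χ s x * Φ x ∂μ = f (qs F s) := by
  have h0' : ∀ x, ‖x‖ ≤ δ → Φ x = 0 := fun x hx => by rw [← zero_add x, h.add 0 x hx, h0]
  have hr := hχ.1
  have hδ := h.pos
  obtain ⟨T, hT⟩ := exists_isBallReps (F := F) (δ := min δ (r * δ)) (R := R)
    (lt_min hδ (by positivity)) ((min_le_left _ _).trans h.le)
  choose c n hcn using fun x : F => exists_quasiChar_eq χ x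
  refine ⟨fun z => ∑ t ∈ T, (μ.real (Metric.closedBall 0 (min δ (r * δ))) * (c t * Φ t) : ℂ) *
    z ^ (n t), IsRational.sum T fun t _ => (IsRational.const _).mul (IsRational.id.zpow _),
    fun s => ?_⟩
  rw [((h.mul_quasiChar hχ hδ h0' s).integral hT).2]
  refine Finset.sum_congr rfl fun t _ => ?_
  rw [hcn]
  ring

theorem IsStep.isRational_regZeta {χ : Fˣ →* ℂˣ} {r : ℝ} (hχ : IsTrivialNearOne χ r) (ϖ : Fˣ)
    {Φ : F → ℂ} {δ R : ℝ} (h : IsStep Φ δ R) :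
    ∃ f, IsRational f ∧ ∀ s, regZeta μ ϖ χ s Φ = f (qs F s) := by
  obtain ⟨f, hf, hfs⟩ := (h.sub (h.comp_mul ϖ⁻¹)).isRational_integral (μ := μ) hχ (by simp)
  refine ⟨fun z => (1 + (-χ ϖ : ℂ) * z)⁻¹ * f z, (IsRational.add (.const _)
    ((IsRational.const _).mul .id)).inv.mul hf, fun s => ?_⟩
  rw [regZeta, hfs]
  simp only [sub_eq_add_neg, neg_mul]

/-! ### Absolute convergence -/

/-- The L¹ norm on the n-th dilate of A is (‖c‖|a|)ⁿ times that on A: a convergent geometric series.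
-/
theorem integrableOn_iUnion_smul {f : F → ℂ} {a : Fˣ} {A : Set F} (hA : MeasurableSet A) {c : ℂ}
    (hf : IntegrableOn f A μ) (hfc : ∀ n : ℕ, ∀ x ∈ A, f ((a ^ n : Fˣ) * x) = c ^ n * f x)
    (hc : ‖c‖ * absF a < 1) : IntegrableOn f (⋃ n : ℕ, (a ^ n) • A) μ := by
  have hind : ∀ n : ℕ, ∀ x, ((a ^ n) • A).indicator f ((a ^ n : Fˣ) * x) =
      c ^ n * A.indicator f x := by
    intro n x
    have hmem : ((a ^ n : Fˣ) * x : F) ∈ (a ^ n) • A ↔ x ∈ A :=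
      Set.smul_mem_smul_set_iff (a := a ^ n) (s := A) (x := x)
    by_cases hx : x ∈ A
    · rw [Set.indicator_of_mem hx, Set.indicator_of_mem (hmem.2 hx), hfc n x hx]
    · rw [Set.indicator_of_notMem hx, Set.indicator_of_notMem (mt hmem.1 hx), mul_zero]
  have hm : ∀ n : ℕ, MeasurableSet ((a ^ n) • A) := fun n => hA.const_smul _
  have hi : ∀ n : ℕ, IntegrableOn f ((a ^ n) • A) μ := by
    intro n
    rw [← integrable_indicator_iff (hm n)]
    have := integrable_comp_mul μ (a ^ n)⁻¹ (((integrable_indicator_iff hA).2 hf).const_mul (c ^ n))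
    refine this.congr (ae_of_all _ fun x => ?_)
    simp only
    rw [← hind n, Units.mul_inv_cancel_left]
  refine integrableOn_iUnion_of_summable_integral_norm hi ?_
  have e : ∀ n : ℕ, ∫ x in (a ^ n) • A, ‖f x‖ ∂μ = (‖c‖ * absF a) ^ n * ∫ x in A, ‖f x‖ ∂μ := by
    intro n
    have h := integral_comp_mul μ (a ^ n) fun x => ‖((a ^ n) • A).indicator f x‖
    simp only [hind, norm_mul, norm_pow] at h
    rw [integral_const_mul] at h
    simp only [norm_indicator_eq_indicator_norm] at h
    rw [integral_indicator hA, integral_indicator (hm n)] at h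
    have hp : absF (a ^ n) = absF a ^ n := by simp [absF]
    have h0 := (absF_pos a).ne'
    rw [hp, smul_eq_mul, eq_inv_mul_iff_mul_eq₀ (pow_ne_zero n h0)] at h
    rw [← h, mul_pow]
    ring
  simp only [e]
  exact (summable_geometric_of_lt_one (mul_nonneg (norm_nonneg _) (absF_pos a).le) hc).mul_right _

theorem IsUniformizer.iUnion_smul {ϖ : Fˣ} (hϖ : IsUniformizer ϖ) {ρ : ℝ} (hρ : 0 < ρ) :
    Metric.closedBall (0 : F) ρ \ {0} ⊆
      ⋃ n : ℕ, ϖ ^ n • (Metric.closedBall (0 : F) ρ \ Metric.closedBall 0 (‖(ϖ : F)‖ * ρ)) := by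
  rintro x ⟨hx, hx0⟩
  have hp : 0 < ‖(ϖ : F)‖ := norm_pos_iff.2 ϖ.ne_zero
  rw [mem_closedBall_zero_iff] at hx
  obtain ⟨n, hn1, hn2⟩ := exists_nat_pow_near_of_lt_one (x := ‖x‖ / ρ) (y := ‖(ϖ : F)‖)
    (div_pos (norm_pos_iff.2 hx0) hρ) ((div_le_one hρ).2 hx) hp hϖ.1
  rw [lt_div_iff₀ hρ, pow_succ] at hn1
  rw [div_le_iff₀ hρ] at hn2
  refine Set.mem_iUnion.2 ⟨n, Set.mem_smul_set_iff_inv_smul_mem.2 ⟨?_, ?_⟩⟩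
  · rw [mem_closedBall_zero_iff, Units.smul_def, smul_eq_mul, norm_mul, Units.val_inv_eq_inv_val,
      norm_inv, Units.val_pow_eq_pow_val, norm_pow, inv_mul_le_iff₀ (pow_pos hp n)]
    exact hn2
  · rw [mem_closedBall_zero_iff, not_le, Units.smul_def, smul_eq_mul, norm_mul,
      Units.val_inv_eq_inv_val, norm_inv, Units.val_pow_eq_pow_val, norm_pow,
      lt_inv_mul_iff₀ (pow_pos hp n), ← mul_assoc]
    exact hn1

/-- Integrability near infinity of a function that is homogeneous there. -/
theorem integrableOn_compl_closedBall {ϖ : Fˣ} (hϖ : IsUniformizer ϖ) {f : F → ℂ} {R : ℝ}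
    (hR : 0 < R) {c : ℂ}
    (hf : IntegrableOn f (Metric.closedBall 0 (‖(ϖ : F)‖⁻¹ * R)) μ)
    (hfc : ∀ x, R ≤ ‖x‖ → f ((ϖ⁻¹ : Fˣ) * x) = c * f x)
    (hc : ‖c‖ * absF ϖ⁻¹ < 1) : IntegrableOn f (Metric.closedBall 0 R)ᶜ μ := by
  have hp : 0 < ‖(ϖ : F)‖ := norm_pos_iff.2 ϖ.ne_zero
  -- A shell whose dilates by ϖ^{-n}, n ≥ 0, cover everything outside the ball of radius R.
  set A := Metric.closedBall (0 : F) (‖(ϖ : F)‖⁻¹ * R) \ Metric.ball 0 R with hA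
  have hAm : MeasurableSet A :=
    Metric.isClosed_closedBall.measurableSet.diff Metric.isOpen_ball.measurableSet
  have key := integrableOn_iUnion_smul (μ := μ) (f := f) (a := ϖ⁻¹) hAm (c := c)
    (hf.mono_set Set.sdiff_subset) (fun n => ?_) hc
  · refine key.mono_set ?_
    intro x hx
    rw [Set.mem_compl_iff, mem_closedBall_zero_iff, not_le] at hx
    have hx0 : 0 < ‖x‖ := hR.trans hx
    obtain ⟨n, hn1, hn2⟩ := exists_nat_pow_near_of_lt_one (x := R / ‖x‖) (y := ‖(ϖ : F)‖)
      (div_pos hR hx0) ((div_le_one hx0).2 hx.le) hp hϖ.1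
    rw [lt_div_iff₀ hx0, _root_.pow_succ', mul_assoc] at hn1
    rw [div_le_iff₀ hx0] at hn2
    have e : ‖((ϖ⁻¹ ^ n)⁻¹ : Fˣ) • x‖ = ‖(ϖ : F)‖ ^ n * ‖x‖ := by
      rw [← inv_pow, inv_inv, Units.smul_def, smul_eq_mul, norm_mul, Units.val_pow_eq_pow_val,
        norm_pow]
    refine Set.mem_iUnion.2 ⟨n, Set.mem_smul_set_iff_inv_smul_mem.2 ⟨?_, ?_⟩⟩
    · rw [mem_closedBall_zero_iff, e, le_inv_mul_iff₀ hp]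
      exact hn1.le
    · rw [mem_ball_zero_iff, not_lt, e]
      exact hn2
  · induction n with
    | zero => simp
    | succ n ih =>
      intro x hx
      have h1 : R ≤ ‖((ϖ⁻¹ ^ n : Fˣ) : F) * x‖ := by
        have h2 : R ≤ ‖x‖ := by simpa [hA] using hx.2
        rw [norm_mul]
        have h3 : 1 ≤ ‖((ϖ⁻¹ ^ n : Fˣ) : F)‖ := by
          rw [Units.val_pow_eq_pow_val, norm_pow, Units.val_inv_eq_inv_val, norm_inv]
          exact one_le_pow₀ ((one_le_inv₀ hp).2 hϖ.1.le)
        nlinarith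
      rw [_root_.pow_succ', Units.val_mul, mul_assoc, hfc _ h1, ih x hx]
      ring

/-- The indicator function of the ball of radius `ρ`. -/
def ballFun (ρ : ℝ) (x : F) : ℂ := if ‖x‖ ≤ ρ then 1 else 0

theorem ballFun_of_le {ρ : ℝ} {x : F} (h : ‖x‖ ≤ ρ) : ballFun ρ x = 1 := by
  simp [ballFun, h]

theorem ballFun_of_lt {ρ : ℝ} {x : F} (h : ρ < ‖x‖) : ballFun ρ x = 0 := by
  simp [ballFun, not_le.2 h]

theorem norm_add_le_iff {x y : F} {ρ : ℝ} (hy : ‖y‖ ≤ ρ) : ‖x + y‖ ≤ ρ ↔ ‖x‖ ≤ ρ :=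
  ⟨fun h => by simpa using norm_sub_le_of_le h hy, fun h => norm_add_le_of_le h hy⟩

theorem isStep_ballFun {ρ : ℝ} (hρ : 0 < ρ) : IsStep (ballFun ρ : F → ℂ) ρ ρ :=
  ⟨hρ, le_rfl, fun x y hy => by simp [ballFun, norm_add_le_iff hy],
    fun x hx => ballFun_of_lt hx⟩

/-- Subtracting Φ(0) times the indicator of a ball leaves a function vanishing near 0. The ball
itself is cut into shells, giving a geometric series of ratio |χ(ϖ)q^{-s}|. -/
theorem IsStep.integrable_quasiChar_of_norm_lt {ϖ : Fˣ} (hϖ : IsUniformizer ϖ) {χ : Fˣ →* ℂˣ}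
    {r : ℝ} (hχ : IsTrivialNearOne χ r) {s : ℂ} (hs : ‖χ ϖ * qs F s‖ < 1) {Φ : F → ℂ} {δ R : ℝ}
    (h : IsStep Φ δ R) : Integrable (fun x => quasiChar χ s x * Φ x) μ := by
  have hp : 0 < ‖(ϖ : F)‖ := norm_pos_iff.2 ϖ.ne_zero
  have hδ := h.pos
  set A := Metric.closedBall (0 : F) δ \ Metric.closedBall 0 (‖(ϖ : F)‖ * δ)
  have hAm : MeasurableSet A :=
    Metric.isClosed_closedBall.measurableSet.diff Metric.isClosed_closedBall.measurableSet
  have hA : IntegrableOn (quasiChar χ s) A μ := by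
    have h1 := ((isStep_ballFun (F := F) hδ).sub (isStep_ballFun (ρ := ‖(ϖ : F)‖ * δ)
      (by positivity))).integrable_quasiChar (μ := μ) hχ s (by simp [ballFun, hδ.le])
    refine (h1.integrableOn (s := A)).congr_fun (fun x hx => ?_) hAm
    have e1 : ‖x‖ ≤ δ := by simpa [A] using hx.1
    have e2 : ‖(ϖ : F)‖ * δ < ‖x‖ := by simpa [A] using hx.2
    simp only
    rw [ballFun_of_le e1, ballFun_of_lt e2]
    ring
  have h2 : IntegrableOn (quasiChar χ s) (Metric.closedBall (0 : F) δ \ {0}) μ := by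
    refine (integrableOn_iUnion_smul (c := χ ϖ * absPow ϖ (s - 1)) (a := ϖ) hAm hA ?_ ?_).mono_set
      (hϖ.iUnion_smul hδ)
    · intro n x _
      have e : absPow (ϖ ^ n) (s - 1) = absPow ϖ (s - 1) ^ n := by
        simpa using absPow_zpow ϖ n (s - 1)
      rw [quasiChar_mul, map_pow, Units.val_pow_eq_pow_val, mul_pow, e]
    · rw [← hϖ.absPow_eq] at hs
      convert hs using 1
      rw [absPow_sub_one, ← mul_assoc, norm_mul _ (absF ϖ : ℂ)⁻¹, norm_inv, Complex.norm_real,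
        Real.norm_of_nonneg (absF_pos ϖ).le, inv_mul_cancel_right₀ (absF_pos ϖ).ne']
  have h3 : Integrable (fun x => quasiChar χ s x * ballFun δ x) μ := by
    rw [← integrable_indicator_iff
      (Metric.isClosed_closedBall.measurableSet.diff (MeasurableSet.singleton 0))] at h2
    refine h2.congr (ae_of_all _ fun x => ?_)
    by_cases hx : x ∈ Metric.closedBall (0 : F) δ
    · by_cases hx0 : x = 0
      · simp [hx0, quasiChar_zero]
      · have hx' : x ∈ Metric.closedBall (0 : F) δ \ {0} := ⟨hx, hx0⟩
        simp only
        rw [Set.indicator_of_mem hx', ballFun_of_le (mem_closedBall_zero_iff.1 hx), mul_one]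
    · simp only
      rw [Set.indicator_of_notMem fun h => hx h.1, ballFun_of_lt, mul_zero]
      simpa using hx
  have h4 := (h.sub ((isStep_ballFun hδ).const_mul (Φ 0))).integrable_quasiChar (μ := μ) hχ s
    (by simp [ballFun, hδ.le])
  refine (h4.add (h3.const_mul (Φ 0))).congr (ae_of_all _ fun x => ?_)
  simp only [Pi.add_apply]
  ring

theorem exists_norm_mul_qs_lt_one (c : ℂ) : ∃ σ : ℝ, ∀ s : ℂ, σ < s.re → ‖c * qs F s‖ < 1 := by
  have hq : (1 : ℝ) < residueCard F := by exact_mod_cast one_lt_residueCard (F := F)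
  have hc : 0 < ‖c‖ + 1 := by positivity
  refine ⟨Real.logb (residueCard F) (‖c‖ + 1), fun s hs => ?_⟩
  have h1 := Real.rpow_lt_rpow_of_exponent_lt hq hs
  rw [Real.rpow_logb (by linarith) hq.ne' hc] at h1
  rw [norm_mul, norm_qs, Real.rpow_neg (by linarith), mul_inv_lt_iff₀ (by linarith)]
  linarith

/-! ### Gauss sums -/

/-- The function `x ↦ ψ(-x)` on the ball of radius `R`. -/
def gaussFun (ψ : AddChar F Circle) (R : ℝ) (x : F) : ℂ := ballFun R x * (ψ (-x) : ℂ)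

theorem HasConductor.isStep_gaussFun {ψ : AddChar F Circle} {C : ℝ} (hC : HasConductor ψ C)
    {R : ℝ} (hR : 0 < R) : IsStep (gaussFun ψ R) (min C R) R := by
  refine ⟨lt_min hC.1 hR, min_le_right _ _, fun x y hy => ?_, fun x hx => ?_⟩
  · rw [gaussFun, gaussFun, (isStep_ballFun hR).add x y (hy.trans (min_le_right _ _)), neg_add,
      AddChar.map_add_eq_mul, hC.eq_one (x := -y), mul_one]
    rw [norm_neg]
    exact hy.trans (min_le_left _ _)
  · rw [gaussFun, ballFun_of_lt hx, zero_mul]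

/-- The radius `R` is so large that the integrals of `χ(x) |x|^{s-1} ψ(-x)` over larger balls are
independent of the ball. -/
def IsStableRadius (ψ : AddChar F Circle) (r R : ℝ) : Prop :=
  0 < R ∧ ∃ t : F, ψ t ≠ 1 ∧ ‖t‖ ≤ r * R

theorem IsStableRadius.mono {ψ : AddChar F Circle} {r R R' : ℝ} (hr : 0 < r)
    (h : IsStableRadius ψ r R) (hR : R ≤ R') : IsStableRadius ψ r R' := by
  obtain ⟨h0, t, ht, htr⟩ := h
  exact ⟨h0.trans_le hR, t, ht, htr.trans (by gcongr)⟩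

theorem exists_isStableRadius {ψ : AddChar F Circle} (hψ' : ψ ≠ 1) {r : ℝ} (hr : 0 < r) :
    ∃ R, IsStableRadius ψ r R := by
  obtain ⟨z, hz⟩ : ∃ z, ψ z ≠ 1 := by
    by_contra! h
    exact hψ' (by ext x; simp [h x])
  refine ⟨‖z‖ / r + 1, by positivity, z, hz, ?_⟩
  rw [mul_add, mul_div_cancel₀ _ hr.ne']
  linarith

/-- The difference lives on R < ‖x‖ ≤ R', where translation by t preserves χ|·|^{s-1} and multiplies
ψ(-x) by ψ(-t) ≠ 1. This gives a meaning to the Gauss integral of χ|·|^{s-1} against ψ(-x) over all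
of F. -/
theorem regZeta_gaussFun_eq {ϖ : Fˣ} (hϖ : IsUniformizer ϖ) {χ : Fˣ →* ℂˣ} {r : ℝ}
    (hχ : IsTrivialNearOne χ r) {ψ : AddChar F Circle} {C : ℝ} (hC : HasConductor ψ C) {s : ℂ}
    (h1 : χ ϖ * qs F s ≠ 1) {R R' : ℝ} (hR : IsStableRadius ψ r R) (hRR' : R ≤ R') :
    regZeta μ ϖ χ s (gaussFun ψ R') = regZeta μ ϖ χ s (gaussFun ψ R) := by
  have hstep := hC.isStep_gaussFun hR.1
  have hstep' := hC.isStep_gaussFun (hR.1.trans_le hRR')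
  rw [← sub_eq_zero, ← regZeta_sub ϖ hχ s hstep' hstep]
  have h0 : gaussFun ψ R' (0 : F) - gaussFun ψ R 0 = 0 := by
    simp [gaussFun, ballFun, hR.1.le, (hR.1.trans_le hRR').le]
  rw [regZeta_eq_integral hϖ h1 ((hstep'.sub hstep).integrable_quasiChar hχ s h0)]
  set S : Set F := Metric.closedBall 0 R' \ Metric.closedBall 0 R
  have hSm : MeasurableSet S :=
    Metric.isClosed_closedBall.measurableSet.diff Metric.isClosed_closedBall.measurableSet
  obtain ⟨hR0, t, ht, htr⟩ := hR
  have htR : ‖t‖ ≤ R := htr.trans (by nlinarith [hχ.2.1])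
  have e : (fun x => quasiChar χ s x * (gaussFun ψ R' x - gaussFun ψ R x)) =
      S.indicator fun x => quasiChar χ s x * (ψ (-x) : ℂ) := by
    ext x
    by_cases hx : ‖x‖ ≤ R
    · rw [Set.indicator_of_notMem (by simp [S, hx]), gaussFun, gaussFun, ballFun_of_le hx,
        ballFun_of_le (hx.trans hRR'), sub_self, mul_zero]
    · by_cases hx' : ‖x‖ ≤ R'
      · rw [Set.indicator_of_mem (by simpa [S, hx'] using hx), gaussFun, gaussFun,
          ballFun_of_le hx', ballFun_of_lt (not_le.1 hx)]
        ring
      · rw [Set.indicator_of_notMem (by simp [S, hx']), gaussFun, gaussFun,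
          ballFun_of_lt (not_le.1 hx), ballFun_of_lt (not_le.1 hx')]
        ring
  rw [e, integral_indicator hSm]
  refine setIntegral_eq_zero_of_translate μ hSm (t := t) (z := (ψ (-t) : ℂ)) ?_ ?_ ?_
  · rw [AddChar.map_neg_eq_inv]
    exact fun h => ht (inv_eq_one.1 (Circle.ext h))
  · intro x
    simp [S, norm_add_le_iff htR, norm_add_le_iff (htR.trans hRR')]
  · intro x hx
    have hx' : R < ‖x‖ := by simpa [S] using hx.2
    rw [hχ.quasiChar_add s (htr.trans (by have := hχ.1; gcongr)), neg_add,
      AddChar.map_add_eq_mul]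
    push_cast
    ring

end Tate

/-! ### Tate's local functional equation. -/

section TateFunctionalEquation

variable {F : Type*} [NontriviallyNormedField F] [IsUltrametricDist F] [ProperSpace F]
  [MeasurableSpace F] [BorelSpace F] {μ : Measure F} [μ.IsAddHaarMeasure]

/-! ### The Fourier transform of a step function -/

/-- For x in the dual ball, ψ(xy) is constant on cosets of the ball of radius ‖e‖; for other x, a
translation by an element of that ball changes ψ(xy) but not Φ. The radius is the norm of an element
e because the conductor is tested only on norms of elements. -/
theorem HasConductor.fourier_eq {ψ : AddChar F Circle} {C : ℝ} (hC : HasConductor ψ C)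
    {Φ : F → ℂ} {e : Fˣ} {R : ℝ} (h : IsStep Φ ‖(e : F)‖ R) {T : Finset F}
    (hT : IsBallReps R ‖(e : F)‖ T) (x : F) :
    fourier ψ μ Φ x = ballFun (C / ‖(e : F)‖) x *
      ∑ t ∈ T, (μ.real (Metric.closedBall 0 ‖(e : F)‖) : ℂ) * (Φ t * (ψ (x * t) : ℂ)) := by
  have he : 0 < ‖(e : F)‖ := norm_pos_iff.2 e.ne_zero
  by_cases hx : ‖x‖ ≤ C / ‖(e : F)‖
  · rw [ballFun_of_le hx, one_mul, fourier]
    have hs : IsStep (fun y => Φ y * (ψ (x * y) : ℂ)) ‖(e : F)‖ R := by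
      refine ⟨h.pos, h.le, fun y z hz => ?_, fun y hy => by rw [h.zero y hy, zero_mul]⟩
      rw [h.add y z hz, mul_add, AddChar.map_add_eq_mul, hC.eq_one (x := x * z), mul_one]
      rw [norm_mul]
      rw [le_div_iff₀ he] at hx
      exact le_trans (by gcongr) hx
    exact (hs.integral hT).2
  · have hx' := not_le.1 hx
    rw [ballFun_of_lt hx', zero_mul, fourier, ← setIntegral_univ]
    rw [div_lt_iff₀ he, ← norm_mul] at hx'
    obtain ⟨y, hy, hψy⟩ := hC.exists_ne_one hx'
    have hx0 : x ≠ 0 := by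
      rintro rfl
      rw [zero_mul, norm_zero] at hx'
      exact absurd hC.1 hx'.not_gt
    refine setIntegral_eq_zero_of_translate μ MeasurableSet.univ (t := x⁻¹ * y) (z := (ψ y : ℂ))
      (fun h => hψy (Circle.ext h)) (by simp) fun u _ => ?_
    rw [h.add, mul_add, mul_inv_cancel_left₀ hx0, AddChar.map_add_eq_mul]
    · push_cast
      ring
    · rw [norm_mul, norm_inv, inv_mul_le_iff₀ (norm_pos_iff.2 hx0), ← norm_mul]
      exact hy

theorem IsStep.exists_unit {Φ : F → ℂ} {δ R ε : ℝ} (h : IsStep Φ δ R) (hε : 0 < ε) :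
    ∃ e : Fˣ, ‖(e : F)‖ ≤ ε ∧ IsStep Φ ‖(e : F)‖ R := by
  obtain ⟨e, he0, he⟩ := NormedField.exists_norm_lt F (lt_min h.pos hε)
  refine ⟨Units.mk0 e (norm_pos_iff.1 he0), (he.trans_le (min_le_right _ _)).le,
    h.mono he0 (he.trans_le (min_le_left _ _)).le le_rfl⟩

theorem HasConductor.isStep_fourier {ψ : AddChar F Circle} {C : ℝ} (hC : HasConductor ψ C)
    {Φ : F → ℂ} {δ R : ℝ} (h : IsStep Φ δ R) : ∃ δ' R', IsStep (fourier ψ μ Φ) δ' R' := by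
  obtain ⟨e, -, he⟩ := h.exists_unit one_pos
  obtain ⟨T, hT⟩ := exists_isBallReps (F := F) he.pos he.le
  have hCe : 0 < C / ‖(e : F)‖ := div_pos hC.1 he.pos
  have hR : 0 < R := he.pos.trans_le he.le
  refine ⟨min (C / R) (C / ‖(e : F)‖), C / ‖(e : F)‖, lt_min (div_pos hC.1 hR) hCe,
    min_le_right _ _, fun x y hy => ?_, fun x hx => ?_⟩
  · rw [hC.fourier_eq he hT, hC.fourier_eq he hT,
      (isStep_ballFun hCe).add x y (hy.trans (min_le_right _ _))]
    congr 1
    refine Finset.sum_congr rfl fun t ht => ?_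
    rw [add_mul, AddChar.map_add_eq_mul, hC.eq_one (x := y * t), mul_one]
    rw [norm_mul]
    have h1 := hy.trans (min_le_left _ _)
    rw [le_div_iff₀ hR] at h1
    exact le_trans (by gcongr; exact hT.1 t ht) h1
  · rw [hC.fourier_eq he hT, ballFun_of_lt hx, zero_mul]

/-- The factor |a| turns the transform into a difference of Φ̂ and its dilate, which vanishes at 0.
-/
theorem fourier_sub_dilate (ψ : AddChar F Circle) (a : Fˣ) {Φ : F → ℂ} {δ R : ℝ}
    (h : IsStep Φ δ R) (hψ : Continuous ψ) (x : F) :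
    fourier ψ μ (fun y => Φ y - (absF a : ℂ) * Φ (a * y)) x =
      fourier ψ μ Φ x - fourier ψ μ Φ ((a⁻¹ : Fˣ) * x) := by
  have hc : ∀ x, Continuous fun y : F => (ψ (x * y) : ℂ) := fun x =>
    continuous_subtype_val.comp (hψ.comp (continuous_const.mul continuous_id))
  have hi : ∀ {Φ : F → ℂ} {δ R : ℝ}, IsStep Φ δ R → ∀ x,
      Integrable (fun y => Φ y * (ψ (x * y) : ℂ)) μ := by
    intro Φ δ R h x
    refine (h.integrable (μ := μ)).mul_bdd (c := 1) (hc x).aestronglyMeasurable ?_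
    exact ae_of_all _ fun y => (Circle.norm_coe _).le
  have h1 := integral_comp_mul μ a fun y => Φ y * (ψ ((a⁻¹ : Fˣ) * x * y) : ℂ)
  simp only [fourier, sub_mul]
  rw [integral_sub (hi h x) (hi ((h.comp_mul a).const_mul _) x)]
  congr 1
  have e : ∀ y : F, (a⁻¹ : Fˣ) * x * (a * y) = x * y := fun y => by
    rw [Units.val_inv_eq_inv_val]
    field_simp [a.ne_zero]
  simp only [e, mul_assoc] at h1 ⊢
  rw [integral_const_mul, h1, Complex.real_smul, Complex.ofReal_inv, mul_inv_cancel_left₀]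
  exact_mod_cast (absF_pos a).ne'

/-! ### The functional equation -/

/-- Fourier inversion writes Φ as a finite combination of truncated characters ψ(-tx) with weights
Φ̂(t). Each is a dilate by t of the Gauss function, so its zeta integral is χ(t)⁻¹|t|^{-s} times the
Gauss integral; summing over t gives the zeta integral of Φ̂ at 1 - s. The hypothesis Φ̂(0) = 0
keeps t away from 0. -/
theorem regZeta_functional_equation_of_zero {ϖ : Fˣ} (hϖ : IsUniformizer ϖ) {χ : Fˣ →* ℂˣ} {r : ℝ}
    (hχ : IsTrivialNearOne χ r) {ψ : AddChar F Circle} {C : ℝ} (hC : HasConductor ψ C)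
    (hsd : IsSelfDual ψ μ) {s : ℂ} (h1 : χ ϖ * qs F s ≠ 1) (h2 : χ⁻¹ ϖ * qs F (1 - s) ≠ 1)
    {R₀ : ℝ} (hR₀ : IsStableRadius ψ r R₀) {Φ : F → ℂ} (hΦ : IsSchwartzBruhat Φ)
    (h0 : fourier ψ μ Φ 0 = 0) :
    regZeta μ ϖ χ s Φ =
      regZeta μ ϖ χ s (gaussFun ψ R₀) * regZeta μ ϖ χ⁻¹ (1 - s) (fourier ψ μ Φ) := by
  obtain ⟨_, _, hs⟩ := hΦ.exists_isStep
  obtain ⟨δ, R, hΨ⟩ := hC.isStep_fourier (μ := μ) hs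
  set Ψ := fourier ψ μ Φ with hΨdef
  have hδ := hΨ.pos
  have hΨ0 : ∀ x, ‖x‖ ≤ δ → Ψ x = 0 := fun x hx => by rw [← zero_add x, hΨ.add 0 x hx, h0]
  have hr := hχ.1
  -- The bound rδ makes χ⁻¹|·|^{-s}Φ̂ constant on cosets of the ball of radius ‖e‖. The bound Cδ/R₀
  -- makes the truncation radius C‖t‖/‖e‖ at least R₀ whenever ‖t‖ > δ.
  obtain ⟨e, he, heΨ⟩ := hΨ.exists_unit (ε := min (r * δ) (C / R₀ * δ))
    (lt_min (by positivity) (mul_pos (div_pos hC.1 hR₀.1) hδ))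
  obtain ⟨T, hT⟩ := exists_isBallReps (F := F) heΨ.pos heΨ.le
  have hep := heΨ.pos
  set v : ℂ := (μ.real (Metric.closedBall 0 ‖(e : F)‖) : ℂ)
  have hint : ∫ x, quasiChar χ⁻¹ (1 - s) x * Ψ x ∂μ =
      ∑ t ∈ T, v * (quasiChar χ⁻¹ (1 - s) t * Ψ t) := by
    have h3 := heΨ.mul_quasiChar hχ.inv hδ hΨ0 (1 - s)
    rw [min_eq_left (he.trans (min_le_left _ _))] at h3
    exact (h3.integral hT).2
  have hexp : Φ = fun x => ∑ t ∈ T, (v * Ψ t) * gaussFun ψ (C / ‖(e : F)‖ * ‖t‖) (t * x) := by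
    ext x
    have h3 := hsd.2 Φ hΦ (-x)
    rw [neg_neg, ← hΨdef, hC.fourier_eq heΨ hT, Finset.mul_sum] at h3
    rw [← h3]
    refine Finset.sum_congr rfl fun t _ => ?_
    rcases eq_or_ne t 0 with rfl | ht0
    · simp [hΨ0 0 (by simpa using hδ.le)]
    · have : ballFun (C / ‖(e : F)‖ * ‖t‖) (t * x) = ballFun (C / ‖(e : F)‖) (-x) := by
        rw [ballFun, ballFun, norm_neg, norm_mul, mul_comm ‖t‖]
        simp only [mul_le_mul_iff_left₀ (norm_pos_iff.2 ht0)]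
      rw [gaussFun, this, show -(t * x) = -x * t by ring]
      ring
  have hterm : ∀ t ∈ T, ∃ δ R, IsStep (fun x => (v * Ψ t) *
      gaussFun ψ (C / ‖(e : F)‖ * ‖t‖) (t * x)) δ R := by
    intro t _
    rcases eq_or_ne t 0 with rfl | ht0
    · refine ⟨1, 1, one_pos, le_rfl, fun _ _ _ => by simp, fun _ _ => ?_⟩
      rw [hΨ0 0 (by simpa using hδ.le), mul_zero, zero_mul]
    · lift t to Fˣ using ht0.isUnit
      have hR : 0 < C / ‖(e : F)‖ * ‖(t : F)‖ :=
        mul_pos (div_pos hC.1 hep) (norm_pos_iff.2 t.ne_zero)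
      exact ⟨_, _, ((hC.isStep_gaussFun hR).comp_mul t).const_mul _⟩
  have hi : Integrable (fun x => quasiChar χ⁻¹ (1 - s) x * Ψ x) μ :=
    hΨ.integrable_quasiChar hχ.inv _ h0
  rw [regZeta_eq_integral hϖ h2 hi, hint, hexp, regZeta_sum ϖ hχ s T hterm, Finset.mul_sum]
  refine Finset.sum_congr rfl fun t _ => ?_
  rw [regZeta_const_mul]
  by_cases ht : ‖t‖ ≤ δ
  · rw [hΨ0 t ht]
    ring
  · have ht' := not_le.1 ht
    have ht0 : t ≠ 0 := norm_pos_iff.1 (hδ.trans ht')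
    lift t to Fˣ using ht0.isUnit
    have hge : R₀ ≤ C / ‖(e : F)‖ * ‖(t : F)‖ := by
      have h3 := he.trans (min_le_right _ _)
      have hC0 := hC.1
      have hR0 := hR₀.1
      rw [div_mul_eq_mul_div, le_div_iff₀ hep]
      calc R₀ * ‖(e : F)‖ ≤ R₀ * (C / R₀ * δ) := by gcongr
        _ = C * δ := by field_simp
        _ ≤ C * ‖(t : F)‖ := by gcongr
    rw [regZeta_comp_mul, regZeta_gaussFun_eq hϖ hχ hC h1 hR₀ hge, quasiChar_unit,
      show (1 - s - 1 : ℂ) = -s by ring, absPow_neg, MonoidHom.inv_apply,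
      Units.val_inv_eq_inv_val, mul_inv]
    ring

/-- Tate's local functional equation. -/
theorem regZeta_functional_equation {ϖ : Fˣ} (hϖ : IsUniformizer ϖ) {χ : Fˣ →* ℂˣ} {r : ℝ}
    (hχ : IsTrivialNearOne χ r) {ψ : AddChar F Circle} (hψ : Continuous ψ) {C : ℝ}
    (hC : HasConductor ψ C) (hsd : IsSelfDual ψ μ) {s : ℂ} (h1 : χ ϖ * qs F s ≠ 1)
    (h2 : χ⁻¹ ϖ * qs F (1 - s) ≠ 1) {R₀ : ℝ} (hR₀ : IsStableRadius ψ r R₀) {Φ : F → ℂ}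
    (hΦ : IsSchwartzBruhat Φ) :
    regZeta μ ϖ χ s Φ =
      regZeta μ ϖ χ s (gaussFun ψ R₀) * regZeta μ ϖ χ⁻¹ (1 - s) (fourier ψ μ Φ) := by
  obtain ⟨δ, R, hs⟩ := hΦ.exists_isStep
  obtain ⟨δ', R', hΨ⟩ := hC.isStep_fourier (μ := μ) hs
  -- Φ - |ϖ|Φ(ϖ·) has Fourier transform Φ̂ - Φ̂(ϖ⁻¹·), zero at the origin. Both sides of the
  -- identity acquire the factor 1 - χ⁻¹(ϖ)q^{-(1-s)}, which is then cancelled.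
  have hs' := hs.sub ((hs.comp_mul ϖ).const_mul (absF ϖ : ℂ))
  have hF := funext (fourier_sub_dilate (μ := μ) ψ ϖ hs hψ)
  have key := regZeta_functional_equation_of_zero hϖ hχ hC hsd h1 h2 hR₀ hs'.isSchwartzBruhat
    (by rw [hF]; simp)
  rw [hF, regZeta_sub ϖ hχ s hs ((hs.comp_mul ϖ).const_mul _), regZeta_const_mul,
    regZeta_comp_mul, regZeta_sub ϖ hχ.inv _ hΨ (hΨ.comp_mul ϖ⁻¹), regZeta_comp_mul] at key
  have e1 : (absF ϖ : ℂ) * ((χ ϖ * absPow ϖ s)⁻¹ * regZeta μ ϖ χ s Φ) =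
      χ⁻¹ ϖ * qs F (1 - s) * regZeta μ ϖ χ s Φ := by
    rw [← hϖ.absPow_eq, sub_eq_add_neg, absPow_add, absPow_neg, absPow_exponent_one,
      MonoidHom.inv_apply, Units.val_inv_eq_inv_val, mul_inv]
    ring
  have e2 : ((χ⁻¹ ϖ⁻¹ : ℂˣ) * absPow ϖ⁻¹ (1 - s) : ℂ)⁻¹ = χ⁻¹ ϖ * qs F (1 - s) := by
    rw [← hϖ.absPow_eq, absPow_inv, map_inv, Units.val_inv_eq_inv_val, mul_inv, inv_inv, inv_inv]
  rw [e1, e2] at key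
  have h3 : (1 - χ⁻¹ ϖ * qs F (1 - s) : ℂ) ≠ 0 := sub_ne_zero.2 h2.symm
  apply mul_left_cancel₀ h3
  linear_combination key

end TateFunctionalEquation

/-! ### Existence and uniqueness of the Tate gamma factor. -/

section TateGamma

variable {F : Type*} [NontriviallyNormedField F] [IsUltrametricDist F] [ProperSpace F]
  [MeasurableSpace F] [BorelSpace F] {μ : Measure F} [μ.IsAddHaarMeasure]

theorem IsZeta.unique {χ : Fˣ →* ℂˣ} {Φ : F → ℂ} {Z Z' : RatFunc ℂ} (h : IsZeta μ χ Φ Z)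
    (h' : IsZeta μ χ Φ Z') : Z = Z' := by
  obtain ⟨σ, hσ⟩ := h
  obtain ⟨σ', hσ'⟩ := h'
  refine ratFunc_eq_of_eval_qs_eq (F := F) (σ := max σ σ') (a := 1) (b := 0) one_ne_zero
    fun s hs => ?_
  rw [← (hσ _ _).2, ← (hσ' _ _).2]
  · simpa using (le_max_right σ σ').trans_lt hs
  · simpa using (le_max_left σ σ').trans_lt hs

theorem IsStep.exists_isZeta {ϖ : Fˣ} (hϖ : IsUniformizer ϖ) {χ : Fˣ →* ℂˣ} {r : ℝ}
    (hχ : IsTrivialNearOne χ r) {Φ : F → ℂ} {δ R : ℝ} (h : IsStep Φ δ R) :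
    ∃ Z, IsZeta μ χ Φ Z ∧ ∃ E : Finset ℂ, ∀ s, qs F s ∉ E →
      Z.eval (RingHom.id ℂ) (qs F s) = regZeta μ ϖ χ s Φ := by
  obtain ⟨f, ⟨Z, E, hZ⟩, hf⟩ := h.isRational_regZeta (μ := μ) hχ ϖ
  obtain ⟨σ₁, h₁⟩ := exists_qs_notMem (F := F) E
  obtain ⟨σ₂, h₂⟩ := exists_norm_mul_qs_lt_one (F := F) (χ ϖ)
  refine ⟨Z, ⟨max σ₁ σ₂, fun s hs => ?_⟩, E, fun s hs => by rw [hZ _ hs, hf]⟩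
  have hlt := h₂ s ((le_max_right _ _).trans_lt hs)
  have hi := h.integrable_quasiChar_of_norm_lt (μ := μ) hϖ hχ hlt
  have h1 : χ ϖ * qs F s ≠ 1 := fun h => by rw [h, norm_one] at hlt; exact lt_irrefl _ hlt
  rw [show zetaIntegrand χ Φ s = fun x => quasiChar χ s x * Φ x from
    funext (zetaIntegrand_eq χ Φ s)]
  exact ⟨hi, by rw [hZ _ (h₁ s ((le_max_left _ _).trans_lt hs)), ← hf,
    regZeta_eq_integral hϖ h1 hi]⟩

theorem measureReal_closedBall_pos {r : ℝ} (hr : 0 < r) :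
    0 < μ.real (Metric.closedBall (0 : F) r) :=
  ENNReal.toReal_pos (measure_closedBall_pos μ hr _).ne' (measure_closedBall_ne_top μ _ _)

theorem integral_ballFun (r : ℝ) :
    ∫ x : F, ballFun r x ∂μ = (μ.real (Metric.closedBall (0 : F) r) : ℂ) := by
  have e : (ballFun r : F → ℂ) = (Metric.closedBall (0 : F) r).indicator fun _ => 1 := by
    ext x
    by_cases hx : ‖x‖ ≤ r
    · rw [ballFun_of_le hx, Set.indicator_of_mem (by simpa using hx)]
    · rw [ballFun_of_lt (not_le.1 hx), Set.indicator_of_notMem (by simpa using hx)]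
  rw [e, integral_indicator Metric.isClosed_closedBall.measurableSet, setIntegral_const,
    Complex.real_smul, mul_one]

theorem isStep_ballFun_sub_one {r : ℝ} (h0 : 0 < r) (h1 : r < 1) :
    IsStep (fun x : F => ballFun r (x - 1)) r 1 := by
  refine ⟨h0, h1.le, fun x y hy => ?_, fun x hx => ballFun_of_lt ?_⟩
  · rw [add_sub_right_comm, (isStep_ballFun h0).add _ _ hy]
  · rw [sub_eq_add_neg, norm_add_eq_of_lt (by simpa using hx)]
    exact h1.trans hx

/-- The quasi-character is 1 on the support of this test function, so for every s the integral is
the volume of a ball. It serves as the non-vanishing zeta integral below. -/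
theorem IsTrivialNearOne.integral_ballFun_sub_one {χ : Fˣ →* ℂˣ} {r : ℝ}
    (hχ : IsTrivialNearOne χ r) (s : ℂ) :
    Integrable (fun x : F => quasiChar χ s x * ballFun r (x - 1)) μ ∧
    ∫ x : F, quasiChar χ s x * ballFun r (x - 1) ∂μ ≠ 0 := by
  constructor
  · exact (isStep_ballFun_sub_one hχ.1 hχ.2.1).integrable_quasiChar hχ s
      (ballFun_of_lt (by simpa using hχ.2.1))
  · have h := integral_add_left_eq_self (μ := μ)
      (fun x : F => quasiChar χ s x * ballFun r (x - 1)) 1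
    have e : ∀ x : F, quasiChar χ s (1 + x) * ballFun r (1 + x - 1) = ballFun r x := by
      intro x
      rw [add_sub_cancel_left]
      by_cases hx : ‖x‖ ≤ r
      · rw [hχ.quasiChar_one_add s hx, one_mul]
      · rw [ballFun_of_lt (not_le.1 hx), mul_zero]
    simp only [e] at h
    rw [← h, integral_ballFun]
    exact_mod_cast (measureReal_closedBall_pos (μ := μ) hχ.1).ne'

theorem IsTateGamma.unique {ψ : AddChar F Circle} {χ : Fˣ →* ℂˣ} {r : ℝ}
    (hχ : IsTrivialNearOne χ r) {γ γ' : RatFunc ℂ} (h : IsTateGamma ψ μ χ γ)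
    (h' : IsTateGamma ψ μ χ γ') : γ = γ' := by
  have hs := (isStep_ballFun_sub_one (F := F) hχ.1 hχ.2.1).isSchwartzBruhat
  obtain ⟨Z, Y, hZ, hY, E, hE⟩ := h _ hs
  obtain ⟨Z', Y', hZ', hY', E', hE'⟩ := h' _ hs
  obtain rfl := hZ.unique hZ'
  obtain rfl := hY.unique hY'
  obtain ⟨σ₁, h₁⟩ := exists_qs_notMem (F := F) E
  obtain ⟨σ₂, h₂⟩ := exists_qs_notMem (F := F) E'
  obtain ⟨σ₃, h₃⟩ := hZ
  refine ratFunc_eq_of_eval_qs_eq (F := F) (σ := max (max σ₁ σ₂) σ₃) (a := 1) (b := 0)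
    one_ne_zero fun s hs => ?_
  rw [max_lt_iff, max_lt_iff] at hs
  set z : ℂ := ((1 * s - 0 : ℝ) : ℂ) with hz
  have hre : z.re = s := by simp [hz]
  have h4 := hE z (h₁ z (by rw [hre]; exact hs.1.1))
  rw [hE' z (h₂ z (by rw [hre]; exact hs.1.2))] at h4
  have h5 := (h₃ z (by rw [hre]; exact hs.2)).2
  simp only [zetaIntegrand_eq] at h5
  have h6 := (hχ.integral_ballFun_sub_one (μ := μ) z).2
  rw [h5] at h6
  exact (mul_right_cancel₀ h6 h4).symm

theorem qs_one_sub (s : ℂ) : qs F (1 - s) = qs F 1 * (qs F s)⁻¹ := by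
  rw [sub_eq_add_neg, qs_add, qs_neg]

/-- γ is the inverse of the Gauss integral, which is rational in q^{-s}. It is non-zero at every s
to which the functional equation applies: a zero would force the integral over the ball around 1 to
vanish. -/
theorem exists_isTateGamma {ϖ : Fˣ} (hϖ : IsUniformizer ϖ) {χ : Fˣ →* ℂˣ} {r : ℝ}
    (hχ : IsTrivialNearOne χ r) {ψ : AddChar F Circle} (hψ : Continuous ψ) (hψ' : ψ ≠ 1)
    (hsd : IsSelfDual ψ μ) {R₀ : ℝ} (hR₀ : IsStableRadius ψ r R₀) :
    ∃ γ : RatFunc ℂ, IsTateGamma ψ μ χ γ ∧ ∃ E : Finset ℂ, ∀ s, qs F s ∉ E →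
      γ.eval (RingHom.id ℂ) (qs F s) * regZeta μ ϖ χ s (gaussFun ψ R₀) = 1 := by
  classical
  obtain ⟨C, hC⟩ := exists_hasConductor hψ hψ'
  obtain ⟨f, hf, hfG⟩ := (hC.isStep_gaussFun hR₀.1).isRational_regZeta (μ := μ) hχ ϖ
  obtain ⟨γ, E₀, hγ⟩ := hf.inv
  have hgood : ∀ s, qs F s ≠ (χ ϖ : ℂ)⁻¹ → qs F s ≠ qs F 1 * (χ⁻¹ ϖ : ℂˣ) →
      χ ϖ * qs F s ≠ 1 ∧ χ⁻¹ ϖ * qs F (1 - s) ≠ 1 := by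
    refine fun s h1 h2 => ⟨fun h => h1 (eq_inv_of_mul_eq_one_right h), fun h => h2 ?_⟩
    rw [qs_one_sub] at h
    have := qs_ne_zero (F := F) s
    field_simp at h
    rw [mul_comm]
    exact h.symm
  have hG : ∀ s, qs F s ≠ (χ ϖ : ℂ)⁻¹ → qs F s ≠ qs F 1 * (χ⁻¹ ϖ : ℂˣ) →
      regZeta μ ϖ χ s (gaussFun ψ R₀) ≠ 0 := by
    intro s h1 h2 h0
    obtain ⟨h3, h4⟩ := hgood s h1 h2
    have hFE := regZeta_functional_equation hϖ hχ hψ hC hsd h3 h4 hR₀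
      (isStep_ballFun_sub_one (F := F) hχ.1 hχ.2.1).isSchwartzBruhat
    obtain ⟨hi, hne⟩ := hχ.integral_ballFun_sub_one (μ := μ) s
    rw [h0, zero_mul, regZeta_eq_integral hϖ h3 hi] at hFE
    exact hne hFE
  set E₁ : Finset ℂ := E₀ ∪ {(χ ϖ : ℂ)⁻¹, qs F 1 * (χ⁻¹ ϖ : ℂˣ)}
  have hE₁ : ∀ s, qs F s ∉ E₁ → qs F s ∉ E₀ ∧ qs F s ≠ (χ ϖ : ℂ)⁻¹ ∧
      qs F s ≠ qs F 1 * (χ⁻¹ ϖ : ℂˣ) := by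
    intro s hs
    simpa only [E₁, Finset.mem_union, Finset.mem_insert, Finset.mem_singleton, not_or] using hs
  have hγG : ∀ s, qs F s ∉ E₁ →
      γ.eval (RingHom.id ℂ) (qs F s) * regZeta μ ϖ χ s (gaussFun ψ R₀) = 1 := by
    intro s hs
    obtain ⟨h0, h1, h2⟩ := hE₁ s hs
    simp only [hγ _ h0, ← hfG]
    exact inv_mul_cancel₀ (hG s h1 h2)
  refine ⟨γ, fun Φ hΦ => ?_, E₁, hγG⟩
  obtain ⟨_, _, hs⟩ := hΦ.exists_isStep
  obtain ⟨_, _, hΨ⟩ := hC.isStep_fourier (μ := μ) hs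
  obtain ⟨Z, hZ, E₂, hE₂⟩ := hs.exists_isZeta (μ := μ) hϖ hχ
  obtain ⟨Z', hZ', E₃, hE₃⟩ := hΨ.exists_isZeta (μ := μ) hϖ hχ.inv
  -- The passage from s to 1 - s is X ↦ q⁻¹X⁻¹ on X = q^{-s}, which transports the exceptional set
  -- of Z'.
  refine ⟨Z, Z', hZ, hZ', E₁ ∪ (E₂ ∪ E₃.image fun e => qs F 1 * e⁻¹), fun s hs => ?_⟩
  simp only [Finset.mem_union, not_or] at hs
  obtain ⟨hs1, hs2, hs3⟩ := hs
  obtain ⟨-, h1, h2⟩ := hE₁ s hs1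
  obtain ⟨h3, h4⟩ := hgood s h1 h2
  have hs4 : qs F (1 - s) ∉ E₃ := by
    intro hmem
    refine hs3 (Finset.mem_image.2 ⟨_, hmem, ?_⟩)
    rw [qs_one_sub, mul_inv, inv_inv, mul_inv_cancel_left₀ (qs_ne_zero _)]
  rw [hE₂ s hs2, hE₃ _ hs4, regZeta_functional_equation hϖ hχ hψ hC hsd h3 h4 hR₀ hΦ, ← mul_assoc,
    hγG s hs1, one_mul]

end TateGamma

/-! ### Matrix identities and cell decompositions in SO₄. -/

section Group

variable {F : Type*} [Field F]

/-- The lower unipotent elements of `SO₄(F)`. -/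
def n2Minus (z : F) : SO4 F := (w2 F)⁻¹ * n2 z * w2 F

theorem SO4.ext_blocks {g h : SO4 F} (H : g.1.1 = h.1.1) : g = h :=
  Subtype.ext (Subtype.ext H)

theorem w2_mul_w2 : w2 F * w2 F = 1 := by
  apply SO4.ext_blocks
  change fromBlocks 0 1 1 0 * fromBlocks 0 1 1 0 = (1 : Matrix _ _ F)
  simp [fromBlocks_multiply]

theorem w2_inv : (w2 F)⁻¹ = w2 F := inv_eq_of_mul_eq_one_left w2_mul_w2

theorem n2_coe (y : F) : (n2 y).1.1 = fromBlocks 1 !![-y, 0; 0, y] 0 1 := rfl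

theorem w2_coe : (w2 F).1.1 = fromBlocks 0 1 1 0 := rfl

theorem m2_coe (a : GL (Fin 2) F) :
    (m2 a).1.1 = fromBlocks a.1 0 0 (j2 F * (a⁻¹).1ᵀ * j2 F) := rfl

theorem mul_coe (g h : SO4 F) : (g * h).1.1 = g.1.1 * h.1.1 := rfl

theorem one_coe : (1 : SO4 F).1.1 = 1 := rfl

theorem n2Minus_coe (z : F) : (n2Minus z).1.1 = fromBlocks 1 0 !![-z, 0; 0, z] 1 := by
  rw [n2Minus, w2_inv, mul_coe, mul_coe, w2_coe, n2_coe]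
  simp [fromBlocks_multiply]

theorem n2_add (x y : F) : n2 (x + y) = n2 x * n2 y := by
  apply SO4.ext_blocks
  rw [mul_coe, n2_coe, n2_coe, n2_coe, fromBlocks_multiply]
  congr 1
  · simp
  · ext i j
    fin_cases i <;> fin_cases j <;> simp [add_comm]
  · simp
  · simp

theorem n2Minus_add (x y : F) : n2Minus (x + y) = n2Minus x * n2Minus y := by
  simp only [n2Minus, n2_add]
  group

theorem n2_zero : n2 (0 : F) = 1 := by
  have := n2_add (0 : F) 0
  rw [add_zero] at this
  simpa using this

theorem n2Minus_zero : n2Minus (0 : F) = 1 := by simp [n2Minus, n2_zero]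

theorem m2_mul (a b : GL (Fin 2) F) : m2 (a * b) = m2 a * m2 b := by
  apply SO4.ext_blocks
  rw [mul_coe, m2_coe, m2_coe, m2_coe, fromBlocks_multiply]
  congr 1
  · simp
  · simp
  · simp
  · rw [_root_.mul_inv_rev, Units.val_mul, transpose_mul]
    simp only [Matrix.zero_mul, zero_add]
    calc j2 F * ((a⁻¹).1ᵀ * (b⁻¹).1ᵀ) * j2 F
        = j2 F * (a⁻¹).1ᵀ * 1 * ((b⁻¹).1ᵀ * j2 F) := by simp only [Matrix.mul_assoc, Matrix.one_mul]
      _ = j2 F * (a⁻¹).1ᵀ * j2 F * (j2 F * (b⁻¹).1ᵀ * j2 F) := by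
        rw [← j2_mul_j2]; simp only [Matrix.mul_assoc]

theorem transpose_fin_two (a b c d : F) : !![a, b; c, d]ᵀ = !![a, c; b, d] := by
  ext i j
  fin_cases i <;> fin_cases j <;> rfl

theorem tMat_coe (α β : Fˣ) : (tMat α β).1 = !![(α : F), 0; 0, (β : F)] := rfl

theorem tMat_mul (α β α' β' : Fˣ) : tMat α β * tMat α' β' = tMat (α * α') (β * β') := by
  apply Units.ext
  rw [Units.val_mul, tMat_coe, tMat_coe, tMat_coe]
  simp

theorem tMat_one : tMat (1 : Fˣ) 1 = 1 := by
  apply Units.ext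
  rw [tMat_coe]
  simp [Matrix.one_fin_two]

theorem tMat_inv (α β : Fˣ) : (tMat α β)⁻¹ = tMat α⁻¹ β⁻¹ := by
  refine inv_eq_of_mul_eq_one_left ?_
  rw [tMat_mul, inv_mul_cancel, inv_mul_cancel, tMat_one]

theorem m2_tMat_coe (α β : Fˣ) : (m2 (tMat α β)).1.1 =
    fromBlocks !![(α : F), 0; 0, (β : F)] 0 0 !![(β : F)⁻¹, 0; 0, (α : F)⁻¹] := by
  rw [m2_coe, tMat_inv, tMat_coe, tMat_coe, transpose_fin_two]
  simp [j2]

/-- The Bruhat decomposition of `ω₂ n₂(y)` with respect to the opposite big cell. -/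
theorem w2_mul_n2 (y : Fˣ) :
    w2 F * n2 (y : F) = m2 (tMat y⁻¹ (-y⁻¹)) * n2 (-y : F) * n2Minus ((y⁻¹ : Fˣ) : F) := by
  apply SO4.ext_blocks
  simp only [mul_coe, w2_coe, n2_coe, n2Minus_coe, m2_tMat_coe, fromBlocks_multiply]
  congr 1 <;> ext i j <;> fin_cases i <;> fin_cases j <;> simp

/-- This expresses the integrand of M(τ,s)ξ at ω₂n₂(x) through a value of ξ at ω₂n₂ of a translate
of x: the variable of integration becomes a shift. -/
theorem n2Minus_mul_n2 (y : Fˣ) (x : F) :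
    n2Minus (y : F) * n2 x =
      m2 (tMat y⁻¹ (-y⁻¹)) * n2 (-y : F) * (w2 F * n2 (x + ((y⁻¹ : Fˣ) : F))) := by
  apply SO4.ext_blocks
  simp only [mul_coe, w2_coe, n2_coe, n2Minus_coe, m2_tMat_coe, fromBlocks_multiply]
  congr 1 <;> ext i j <;> fin_cases i <;> fin_cases j <;>
    simp [mul_add, add_comm]

/-! ### The Bruhat and Iwasawa decompositions -/

theorem SO4.eq_one (g : SO4 F) : g.1.1ᵀ * j4 F * g.1.1 = j4 F := g.2

theorem j4_mul_j4 : j4 F * j4 F = 1 := by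
  simp [j4, fromBlocks_multiply, j2_mul_j2]

theorem SO4.inv_coe (g : SO4 F) : (g⁻¹).1.1 = j4 F * g.1.1ᵀ * j4 F := by
  have h1 : g.1.1 * (g⁻¹).1.1 = 1 := by rw [← mul_coe, mul_inv_cancel, one_coe]
  have h2 : j4 F * g.1.1ᵀ * j4 F * g.1.1 = 1 := by
    rw [Matrix.mul_assoc (j4 F), Matrix.mul_assoc (j4 F), SO4.eq_one, j4_mul_j4]
  calc (g⁻¹).1.1 = (j4 F * g.1.1ᵀ * j4 F * g.1.1) * (g⁻¹).1.1 := by rw [h2, Matrix.one_mul]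
    _ = _ := by rw [Matrix.mul_assoc, h1, Matrix.mul_one]

theorem SO4.mul_j4_mul_transpose (g : SO4 F) : g.1.1 * j4 F * g.1.1ᵀ = j4 F := by
  have h1 : g.1.1 * (g⁻¹).1.1 = 1 := by rw [← mul_coe, mul_inv_cancel, one_coe]
  rw [SO4.inv_coe] at h1
  calc g.1.1 * j4 F * g.1.1ᵀ = g.1.1 * (j4 F * g.1.1ᵀ * j4 F) * j4 F := by
        simp only [Matrix.mul_assoc, j4_mul_j4, Matrix.mul_one]
    _ = j4 F := by rw [h1, Matrix.one_mul]

theorem exists_m2_lower (E : Matrix (Fin 2) (Fin 2) F) (hE : E.det ≠ 0) :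
    ∃ a : GL (Fin 2) F, (m2 a).1.1.toBlocks₂₂ = E := by
  refine ⟨(GeneralLinearGroup.mkOfDetNeZero (j2 F * Eᵀ * j2 F) ?_)⁻¹, ?_⟩
  · have : (j2 F).det ≠ 0 := by simp [j2, det_fin_two]
    rw [det_mul, det_mul, det_transpose]
    exact mul_ne_zero (mul_ne_zero this hE) this
  · rw [m2_coe, toBlocks_fromBlocks₂₂, inv_inv]
    change j2 F * (j2 F * Eᵀ * j2 F)ᵀ * j2 F = E
    rw [transpose_mul, transpose_mul, transpose_transpose, j2_transpose]
    calc j2 F * (j2 F * (E * j2 F)) * j2 F = (j2 F * j2 F) * E * (j2 F * j2 F) := by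
          simp only [Matrix.mul_assoc]
      _ = E := by rw [j2_mul_j2, Matrix.one_mul, Matrix.mul_one]

/-- B j₂ is a skew-symmetric 2×2 matrix, so one parameter remains; its diagonal vanishes because 2 ≠
0. -/
theorem n2_of_antisymm [CharZero F] {B : Matrix (Fin 2) (Fin 2) F}
    (h : B * j2 F + j2 F * Bᵀ = 0) : B = !![-B 1 1, 0; 0, B 1 1] := by
  rw [Matrix.eta_fin_two B, transpose_fin_two] at h
  have h00 := congrFun (congrFun h 0) 0
  have h01 := congrFun (congrFun h 0) 1
  have h11 := congrFun (congrFun h 1) 1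
  simp [j2] at h00 h01 h11
  ext i j
  fin_cases i <;> fin_cases j <;> simp
  · linear_combination h01
  · simpa using h00
  · simpa using h11

theorem SO4.exists_eq_of_toBlocks_eq_one [CharZero F] {g : SO4 F} (h1 : g.1.1.toBlocks₂₂ = 1) :
    ∃ x z : F, g = n2 x * n2Minus z := by
  have key : ∀ {g : SO4 F}, g.1.1.toBlocks₂₂ = 1 → ∃ z, g.1.1.toBlocks₂₁ = !![-z, 0; 0, z] := by
    intro g h1
    have h := SO4.mul_j4_mul_transpose g
    rw [← fromBlocks_toBlocks g.1.1, h1, j4, fromBlocks_transpose, fromBlocks_multiply,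
      fromBlocks_multiply] at h
    have h22 := congrArg toBlocks₂₂ h
    simp only [toBlocks_fromBlocks₂₂, Matrix.mul_zero, Matrix.one_mul, zero_add, add_zero,
      transpose_one, Matrix.mul_one] at h22
    exact ⟨_, n2_of_antisymm (by rw [← h22, add_comm])⟩
  obtain ⟨z, hz⟩ := key h1
  set h := g * n2Minus (-z) with hh
  have hC : h.1.1.toBlocks₂₁ = 0 ∧ h.1.1.toBlocks₂₂ = 1 := by
    rw [hh, mul_coe, n2Minus_coe, ← fromBlocks_toBlocks g.1.1, fromBlocks_multiply,
      toBlocks_fromBlocks₂₁, toBlocks_fromBlocks₂₂, hz, h1]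
    constructor
    · ext i j
      fin_cases i <;> fin_cases j <;> simp
    · simp
  have hg : g = h * n2Minus z := by
    rw [hh, mul_assoc, ← n2Minus_add, neg_add_cancel, n2Minus_zero, mul_one]
  have hA : h.1.1.toBlocks₁₁ = 1 := by
    have e := SO4.mul_j4_mul_transpose h
    rw [← fromBlocks_toBlocks h.1.1, hC.1, hC.2, j4, fromBlocks_transpose, fromBlocks_multiply,
      fromBlocks_multiply] at e
    have e12 := congrArg toBlocks₁₂ e
    simp only [toBlocks_fromBlocks₁₂, Matrix.mul_zero, zero_add, transpose_zero,
      transpose_one, Matrix.mul_one] at e12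
    calc _ = h.1.1.toBlocks₁₁ * j2 F * j2 F := by rw [Matrix.mul_assoc, j2_mul_j2, Matrix.mul_one]
      _ = 1 := by simpa [j2_mul_j2] using congrArg (· * j2 F) e12
  have hB : h.1.1.toBlocks₁₂ * j2 F + j2 F * h.1.1.toBlocks₁₂ᵀ = 0 := by
    have e := SO4.mul_j4_mul_transpose h
    rw [← fromBlocks_toBlocks h.1.1, hC.1, hC.2, hA, j4, fromBlocks_transpose,
      fromBlocks_multiply, fromBlocks_multiply] at e
    have e11 := congrArg toBlocks₁₁ e
    simpa using e11
  refine ⟨h.1.1.toBlocks₁₂ 1 1, z, ?_⟩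
  conv_lhs => rw [hg]
  congr 1
  apply SO4.ext_blocks
  rw [n2_coe, ← n2_of_antisymm hB, ← fromBlocks_toBlocks h.1.1, hA, hC.1, hC.2,
    toBlocks_fromBlocks₁₂]

theorem SO4.exists_eq_of_det_ne_zero [CharZero F] {g : SO4 F} (h : g.1.1.toBlocks₂₂.det ≠ 0) :
    ∃ a x z, g = m2 a * n2 x * n2Minus z := by
  obtain ⟨a, ha⟩ := exists_m2_lower _ h
  have h1 : ((m2 a)⁻¹ * g).1.1.toBlocks₂₂ = 1 := by
    have e : g = m2 a * ((m2 a)⁻¹ * g) := by group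
    have e1 : g.1.1.toBlocks₂₂ = (m2 a * ((m2 a)⁻¹ * g)).1.1.toBlocks₂₂ := by rw [← e]
    rw [mul_coe, m2_coe, ← fromBlocks_toBlocks ((m2 a)⁻¹ * g).1.1, fromBlocks_multiply,
      toBlocks_fromBlocks₂₂, Matrix.zero_mul, zero_add] at e1
    rw [m2_coe, toBlocks_fromBlocks₂₂] at ha
    rw [ha] at e1
    have hu : IsUnit g.1.1.toBlocks₂₂ := (Matrix.isUnit_iff_isUnit_det _).2 h.isUnit
    exact (hu.mul_left_cancel (by rw [Matrix.mul_one]; exact e1)).symm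
  obtain ⟨x, z, hxz⟩ := SO4.exists_eq_of_toBlocks_eq_one h1
  exact ⟨a, x, z, by rw [mul_assoc, ← hxz]; group⟩

/-- Laplace expansion, showing the determinant as a combination of the six 2×2 minors of the last
two rows. -/
theorem det_fromBlocks_fin_two (a b c d a' b' c' d' e f g h e' f' g' h' : F) :
    (fromBlocks !![a, b; a', b'] !![c, d; c', d'] !![e, f; e', f'] !![g, h; g', h']).det =
      (a * b' - b * a') * (g * h' - h * g') - (a * c' - c * a') * (f * h' - h * f')
      + (a * d' - d * a') * (f * g' - g * f') + (b * c' - c * b') * (e * h' - h * e')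
      - (b * d' - d * b') * (e * g' - g * e') + (c * d' - d * c') * (e * f' - f * e') := by
  have : (fromBlocks !![a, b; a', b'] !![c, d; c', d'] !![e, f; e', f'] !![g, h; g', h']) =
      (reindex finSumFinEquiv finSumFinEquiv).symm
        !![a, b, c, d; a', b', c', d'; e, f, g, h; e', f', g', h'] := by
    ext i j
    rcases i with i | i <;> rcases j with j | j <;> fin_cases i <;> fin_cases j <;> rfl
  rw [this, reindex_symm, det_reindex_self]
  simp [det_succ_row_zero, Fin.sum_univ_succ, Fin.succAbove]
  ring

/-- If both lower blocks were singular, isotropy of the last two rows together with det = 1 would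
kill all six of their 2×2 minors. The determinant matters: the orthogonal reflection exchanging the
two middle coordinates has both lower blocks singular. -/
theorem SO4.det_toBlocks_ne_zero [CharZero F] (g : SO4 F) :
    g.1.1.toBlocks₂₁.det ≠ 0 ∨ g.1.1.toBlocks₂₂.det ≠ 0 := by
  by_contra! hdet
  obtain ⟨h12, h34⟩ := hdet
  set A := g.1.1.toBlocks₁₁
  set B := g.1.1.toBlocks₁₂
  set C := g.1.1.toBlocks₂₁
  set D := g.1.1.toBlocks₂₂
  have hg : g.1.1 = fromBlocks A B C D := (fromBlocks_toBlocks _).symm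
  have hinv : g.1.1 * (j4 F * g.1.1ᵀ * j4 F) = 1 := by
    rw [← SO4.inv_coe, ← mul_coe, mul_inv_cancel, one_coe]
  have hdet1 : g.1.1.det = 1 := g.1.2
  rw [hg, Matrix.eta_fin_two A, Matrix.eta_fin_two B, Matrix.eta_fin_two C,
    Matrix.eta_fin_two D] at hinv hdet1
  rw [det_fin_two] at h12 h34
  have hone : (1 : Matrix (Fin 2 ⊕ Fin 2) (Fin 2 ⊕ Fin 2) F) =
      fromBlocks !![1, 0; 0, 1] !![0, 0; 0, 0] !![0, 0; 0, 0] !![1, 0; 0, 1] := by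
    rw [← fromBlocks_one, Matrix.one_fin_two]
    congr 1 <;> ext i j <;> fin_cases i <;> fin_cases j <;> rfl
  simp only [j4, fromBlocks_transpose, transpose_fin_two, fromBlocks_multiply, j2,
    Matrix.mul_zero, zero_add, add_zero, Matrix.zero_mul, cons_mul, hone] at hinv
  simp at hinv
  obtain ⟨⟨⟨e11, e12⟩, e21, e22⟩, -, ⟨⟨e31, e32⟩, e41, e42⟩, -⟩ := hinv
  -- The second factor consists of the first two columns of g⁻¹ and two basis vectors. Its
  -- determinant is the negative of this minor, while the product has the minor itself as
  -- determinant; det g = 1 then equates a minor with its negative.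
  have hp13 : C 0 0 * D 1 0 - D 0 0 * C 1 0 = 0 := by
    have hX : fromBlocks !![A 0 0, A 0 1; A 1 0, A 1 1] !![B 0 0, B 0 1; B 1 0, B 1 1]
        !![C 0 0, C 0 1; C 1 0, C 1 1] !![D 0 0, D 0 1; D 1 0, D 1 1] *
        fromBlocks !![D 1 1, D 0 1; D 1 0, D 0 0] !![1, 0; 0, 0]
          !![C 1 1, C 0 1; C 1 0, C 0 0] !![0, 1; 0, 0] =
        fromBlocks !![1, 0; 0, 1] !![A 0 0, B 0 0; A 1 0, B 1 0]
          !![0, 0; 0, 0] !![C 0 0, D 0 0; C 1 0, D 1 0] := by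
      rw [fromBlocks_multiply]
      congr 1 <;> ext i j <;> fin_cases i <;> fin_cases j <;> simp <;> assumption
    have h := congrArg det hX
    rw [det_mul, hdet1, det_fromBlocks_fin_two, det_fromBlocks_fin_two] at h
    have h2 : (2 : F) * (C 0 0 * D 1 0 - D 0 0 * C 1 0) = 0 := by linear_combination -h
    exact (mul_eq_zero.1 h2).resolve_left two_ne_zero
  have hp24 : C 0 1 * D 1 1 - D 0 1 * C 1 1 = 0 := by
    have hX : fromBlocks !![A 0 0, A 0 1; A 1 0, A 1 1] !![B 0 0, B 0 1; B 1 0, B 1 1]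
        !![C 0 0, C 0 1; C 1 0, C 1 1] !![D 0 0, D 0 1; D 1 0, D 1 1] *
        fromBlocks !![D 1 1, D 0 1; D 1 0, D 0 0] !![0, 0; 1, 0]
          !![C 1 1, C 0 1; C 1 0, C 0 0] !![0, 0; 0, 1] =
        fromBlocks !![1, 0; 0, 1] !![A 0 1, B 0 1; A 1 1, B 1 1]
          !![0, 0; 0, 0] !![C 0 1, D 0 1; C 1 1, D 1 1] := by
      rw [fromBlocks_multiply]
      congr 1 <;> ext i j <;> fin_cases i <;> fin_cases j <;> simp <;> assumption
    have h := congrArg det hX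
    rw [det_mul, hdet1, det_fromBlocks_fin_two, det_fromBlocks_fin_two] at h
    have h2 : (2 : F) * (C 0 1 * D 1 1 - D 0 1 * C 1 1) = 0 := by linear_combination -h
    exact (mul_eq_zero.1 h2).resolve_left two_ne_zero
  have hr3 : C 0 0 * D 0 1 + C 0 1 * D 0 0 = 0 := by
    have h2 : (2 : F) * (C 0 0 * D 0 1 + C 0 1 * D 0 0) = 0 := by linear_combination e32
    exact (mul_eq_zero.1 h2).resolve_left two_ne_zero
  have hr4 : C 1 0 * D 1 1 + C 1 1 * D 1 0 = 0 := by
    have h2 : (2 : F) * (C 1 0 * D 1 1 + C 1 1 * D 1 0) = 0 := by linear_combination e41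
    exact (mul_eq_zero.1 h2).resolve_left two_ne_zero
  -- The isotropy relations kill the products of this minor with C₀₀ and C₁₀. The minor is a
  -- combination of these two entries, so its square vanishes.
  have hp14 : C 0 0 * D 1 1 - D 0 1 * C 1 0 = 0 := by
    have h0 : (C 0 0 * D 1 1 - D 0 1 * C 1 0) * C 0 0 = 0 := by
      linear_combination C 0 0 * e31 - 2 * C 1 0 * hr3 - D 0 0 * h12 - C 0 1 * hp13
    have h1 : (C 0 0 * D 1 1 - D 0 1 * C 1 0) * C 1 0 = 0 := by
      linear_combination 2 * C 0 0 * hr4 - C 1 0 * e31 - D 1 0 * h12 - C 1 1 * hp13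
    exact pow_eq_zero_iff (n := 2) (by norm_num) |>.1
      (by linear_combination D 1 1 * h0 - D 0 1 * h1)
  have hp23 : C 0 1 * D 1 0 - D 0 0 * C 1 1 = 0 := by
    have h0 : (C 0 1 * D 1 0 - D 0 0 * C 1 1) * C 0 1 = 0 := by
      linear_combination C 0 1 * e31 - 2 * C 1 1 * hr3 + D 0 1 * h12 - C 0 0 * hp24
    have h1 : (C 0 1 * D 1 0 - D 0 0 * C 1 1) * C 1 1 = 0 := by
      linear_combination 2 * C 0 1 * hr4 - C 1 1 * e31 + D 1 1 * h12 - C 1 0 * hp24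
    exact pow_eq_zero_iff (n := 2) (by norm_num) |>.1
      (by linear_combination D 1 0 * h0 - D 0 0 * h1)
  rw [det_fromBlocks_fin_two] at hdet1
  rw [show C 0 0 * C 1 1 - C 0 1 * C 1 0 = 0 from h12,
    show D 0 0 * D 1 1 - D 0 1 * D 1 0 = 0 from h34, hp13, hp24, hp14, hp23] at hdet1
  simp at hdet1

theorem SO4.exists_eq_or [CharZero F] (g : SO4 F) :
    (∃ a x z, g = m2 a * n2 x * n2Minus z) ∨ ∃ a x z, g = m2 a * n2 x * n2Minus z * w2 F := by
  rcases SO4.det_toBlocks_ne_zero g with h | h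
  · right
    have h' : (g * w2 F).1.1.toBlocks₂₂.det ≠ 0 := by
      rw [mul_coe, w2_coe, ← fromBlocks_toBlocks g.1.1, fromBlocks_multiply,
        toBlocks_fromBlocks₂₂]
      simpa using h
    obtain ⟨a, x, z, e⟩ := SO4.exists_eq_of_det_ne_zero h'
    exact ⟨a, x, z, by rw [← e, mul_assoc, w2_mul_w2, mul_one]⟩
  · exact Or.inl (SO4.exists_eq_of_det_ne_zero h)

end Group

/-! ### Integral elements and the Iwasawa decomposition. -/

section Iwasawa

variable {F : Type*} [NontriviallyNormedField F] [IsUltrametricDist F]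

theorem IsIntegral.mul {k k' : SO4 F} (h : IsIntegral k) (h' : IsIntegral k') :
    IsIntegral (k * k') := by
  intro i j
  rw [show (k * k').1.1 = k.1.1 * k'.1.1 from rfl, Matrix.mul_apply]
  refine IsUltrametricDist.norm_sum_le_of_forall_le_of_nonneg zero_le_one fun l _ => ?_
  rw [norm_mul]
  exact mul_le_one₀ (h i l) (norm_nonneg _) (h' l j)

theorem isIntegral_w2 : IsIntegral (w2 F) := by
  intro i j
  rw [w2_coe]
  rcases i with i | i <;> rcases j with j | j <;> fin_cases i <;> fin_cases j <;> simp

theorem isIntegral_n2 {x : F} (hx : ‖x‖ ≤ 1) : IsIntegral (n2 x) := by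
  intro i j
  rw [n2_coe]
  rcases i with i | i <;> rcases j with j | j <;> fin_cases i <;> fin_cases j <;> simp [hx]

theorem m2_one {F : Type*} [Field F] : m2 (1 : GL (Fin 2) F) = 1 := by
  apply SO4.ext_blocks
  rw [m2_coe, one_coe]
  simp [j2_mul_j2]

/-- The Iwasawa decomposition. -/
theorem exists_iwasawa [CharZero F] (g : SO4 F) :
    ∃ (a : GL (Fin 2) F) (x : F) (b : GL (Fin 2) F) (y : F) (k : SO4 F), IsIntegral k ∧
      g = m2 a * n2 x * (m2 b * n2 y * k) := by
  -- For ‖z‖ ≤ 1 the element is integral. Otherwise the opposite big cell leaves ω₂n₂(z⁻¹), integral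
  -- since z⁻¹ is. The two parabolic factors need not be merged, because sections are equivariant
  -- under each.
  have key : ∀ z : F, ∃ (a : GL (Fin 2) F) (x : F) (k : SO4 F),
      IsIntegral k ∧ n2Minus z = m2 a * n2 x * k := by
    intro z
    by_cases hz : ‖z‖ ≤ 1
    · refine ⟨1, 0, n2Minus z, ?_, ?_⟩
      · rw [n2Minus, w2_inv]
        exact (isIntegral_w2.mul (isIntegral_n2 hz)).mul isIntegral_w2
      · rw [m2_one, n2_zero, mul_one, one_mul]
    · have hz' := not_le.1 hz
      have hz0 : z ≠ 0 := norm_pos_iff.1 (one_pos.trans hz')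
      lift z to Fˣ using hz0.isUnit
      refine ⟨tMat z⁻¹ (-z⁻¹), -z, w2 F * n2 (0 + ((z⁻¹ : Fˣ) : F)),
        isIntegral_w2.mul (isIntegral_n2 ?_), ?_⟩
      · rw [zero_add, Units.val_inv_eq_inv_val, norm_inv]
        exact inv_le_one_of_one_le₀ hz'.le
      · rw [← n2Minus_mul_n2, n2_zero, mul_one]
  rcases SO4.exists_eq_or g with ⟨a, x, z, rfl⟩ | ⟨a, x, z, rfl⟩
  all_goals obtain ⟨b, y, k, hk, e⟩ := key z
  · exact ⟨a, x, b, y, k, hk, by rw [e]⟩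
  · exact ⟨a, x, b, y, k * w2 F, hk.mul isIntegral_w2, by rw [e]; simp only [mul_assoc]⟩

end Iwasawa

/-! ### Standard sections and the intertwining integral. -/

section Sections

variable {F : Type*} [NontriviallyNormedField F] [IsUltrametricDist F] [ProperSpace F]
  [MeasurableSpace F] [BorelSpace F] {V : Type*} [AddCommGroup V] [Module ℂ V]
  {τ : Representation ℂ (GL (Fin 2) F) V}

theorem MemInd.apply {s : ℂ} {ξ : SO4 F → V} (h : MemInd τ s ξ) (a : GL (Fin 2) F) (y : F)
    (g : SO4 F) : ξ (m2 a * n2 y * g) = absPow (GeneralLinearGroup.det a) s • τ a (ξ g) := by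
  rw [h.2, ← absPow_add, add_sub_cancel]

/-- A family which is a Laurent polynomial in `q^{-s}`. -/
def IsLaurent (F : Type*) [NontriviallyNormedField F] [IsUltrametricDist F] (f : ℂ → V) : Prop :=
  ∃ c : ℤ →₀ V, ∀ s, f s = c.sum fun k v => qs F s ^ k • v

theorem isLaurent_zpow_smul (n : ℤ) (v : V) : IsLaurent F fun s => qs F s ^ n • v :=
  ⟨Finsupp.single n v, fun s => by simp⟩

theorem IsLaurent.add {f g : ℂ → V} (hf : IsLaurent F f) (hg : IsLaurent F g) :
    IsLaurent F fun s => f s + g s := by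
  obtain ⟨c, hc⟩ := hf
  obtain ⟨d, hd⟩ := hg
  refine ⟨c + d, fun s => ?_⟩
  beta_reduce
  rw [hc, hd, Finsupp.sum_add_index' (fun _ => smul_zero _) fun _ _ _ => smul_add _ _ _]

theorem IsLaurent.sum {ι : Type*} (T : Finset ι) {f : ι → ℂ → V}
    (hf : ∀ i ∈ T, IsLaurent F (f i)) : IsLaurent F fun s => ∑ i ∈ T, f i s := by
  classical
  induction T using Finset.induction_on with
  | empty => exact ⟨0, fun s => by simp⟩
  | insert a T ha ih =>
    simp only [Finset.sum_insert ha]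
    exact (hf a (Finset.mem_insert_self a T)).add
      (ih fun i hi => hf i (Finset.mem_insert_of_mem hi))

/-- In the Iwasawa decomposition the integral factor contributes a vector independent of s; only the
powers |det|^s of the Levi factors vary. -/
theorem IsStandardSection.exists_eq_zpow_smul [CharZero F] {ξ : ℂ → SO4 F → V}
    (hξ : IsStandardSection τ ξ) (g : SO4 F) :
    ∃ (n : ℤ) (v : V), ∀ s, ξ s g = qs F s ^ n • v := by
  obtain ⟨a, x, b, y, k, hk, rfl⟩ := exists_iwasawa g
  obtain ⟨n, hn⟩ := exists_absPow_eq_qs_zpow (GeneralLinearGroup.det a)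
  obtain ⟨m, hm⟩ := exists_absPow_eq_qs_zpow (GeneralLinearGroup.det b)
  refine ⟨n + m, τ a (τ b (ξ 0 k)), fun s => ?_⟩
  rw [(hξ.1 s).apply, (hξ.1 s).apply, hn, hm, hξ.2 k hk s 0, map_smul, smul_smul,
    zpow_add₀ (qs_ne_zero s)]

theorem continuous_SO4_entry (i j : Fin 2 ⊕ Fin 2) : Continuous fun g : SO4 F => g.1.1 i j :=
  Continuous.matrix_elem (A := fun g : SO4 F => g.1.1)
    (Continuous.comp (g := fun g : SpecialLinearGroup (Fin 2 ⊕ Fin 2) F => g.1)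
      continuous_subtype_val (f := fun g : SO4 F => g.1) continuous_subtype_val) i j

theorem isIntegral_mem_nhds : {g : SO4 F | IsIntegral g} ∈ 𝓝 (1 : SO4 F) := by
  have h : ∀ i j, ∀ᶠ g : SO4 F in 𝓝 1, ‖g.1.1 i j‖ ≤ 1 := by
    intro i j
    have h1 : Metric.closedBall (0 : F) 1 ∈ 𝓝 ((1 : SO4 F).1.1 i j) := by
      refine (IsUltrametricDist.isOpen_closedBall (0 : F) one_ne_zero).mem_nhds ?_
      rw [one_coe, Matrix.one_apply, mem_closedBall_zero_iff]
      split_ifs <;> simp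
    filter_upwards [(continuous_SO4_entry i j).continuousAt h1] with g hg
    simpa using hg
  simp only [IsIntegral]
  exact eventually_all.2 fun i => eventually_all.2 fun j => h i j

/-- Translation by an integral u keeps the Iwasawa factor in SO₄(𝔬), where ξ_s = ξ_0. Hence the
invariance of ξ_0 is shared by all s. -/
theorem IsStandardSection.exists_nhds [CharZero F] {ξ : ℂ → SO4 F → V}
    (hξ : IsStandardSection τ ξ) :
    ∃ U ∈ 𝓝 (1 : SO4 F), ∀ u ∈ U, ∀ s g, ξ s (g * u) = ξ s g := by
  obtain ⟨U, hU⟩ := (hξ.1 0).1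
  refine ⟨U ∩ {g | IsIntegral g}, inter_mem (U.mem_nhds_one) isIntegral_mem_nhds, ?_⟩
  rintro u ⟨hu, hui⟩ s g
  obtain ⟨a, x, b, y, k, hk, rfl⟩ := exists_iwasawa g
  rw [mul_assoc, mul_assoc (m2 b * n2 y), (hξ.1 s).apply, (hξ.1 s).apply, (hξ.1 s).apply,
    (hξ.1 s).apply, hξ.2 _ (hk.mul hui) s 0, hU u hu, hξ.2 k hk s 0]

theorem continuous_n2 : Continuous (n2 : F → SO4 F) := by
  refine Continuous.subtype_mk (Continuous.subtype_mk ?_ _) _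
  refine continuous_matrix fun i j => ?_
  rcases i with i | i <;> rcases j with j | j <;> fin_cases i <;> fin_cases j <;> simp <;> fun_prop

theorem continuous_n2Minus : Continuous (n2Minus : F → SO4 F) :=
  (continuous_const.mul continuous_n2).mul continuous_const

theorem IsStandardSection.exists_radius [CharZero F] {ξ : ℂ → SO4 F → V}
    (hξ : IsStandardSection τ ξ) (h : SO4 F) :
    ∃ ε : ℝ, 0 < ε ∧ ε ≤ 1 ∧ ∀ t : F, ‖t‖ ≤ ε → ∀ s g,
      ξ s (g * n2 t * h) = ξ s (g * h) ∧ ξ s (n2Minus t * h) = ξ s h := by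
  obtain ⟨U, hU, hξU⟩ := hξ.exists_nhds
  have h1 : ∀ᶠ t : F in 𝓝 0, h⁻¹ * n2 t * h ∈ U := by
    have hc : Continuous fun t : F => h⁻¹ * n2 t * h :=
      (continuous_const.mul continuous_n2).mul continuous_const
    exact hc.continuousAt (by simpa [n2_zero] using hU)
  have h2 : ∀ᶠ t : F in 𝓝 0, h⁻¹ * n2Minus t * h ∈ U := by
    have hc : Continuous fun t : F => h⁻¹ * n2Minus t * h :=
      (continuous_const.mul continuous_n2Minus).mul continuous_const
    exact hc.continuousAt (by simpa [n2Minus_zero] using hU)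
  obtain ⟨ε, hε, H⟩ := Metric.nhds_basis_closedBall.eventually_iff.1 (h1.and h2)
  refine ⟨min ε 1, lt_min hε one_pos, min_le_right _ _, fun t ht s g => ?_⟩
  obtain ⟨ha, hb⟩ := H (mem_closedBall_zero_iff.2 (ht.trans (min_le_left _ _)))
  have h3 := hξU _ ha s (g * h)
  have h4 := hξU _ hb s h
  constructor
  · rw [← h3]
    congr 1
    group
  · rw [← h4]
    congr 1
    group

/-! ### Restriction of sections to the unipotent radical -/

theorem quasiChar_inv (χ : Fˣ →* ℂˣ) (s : ℂ) (x : F) :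
    quasiChar χ s x⁻¹ = quasiChar χ⁻¹ (2 - s) x := by
  rcases eq_or_ne x 0 with rfl | hx
  · simp [quasiChar_zero]
  · lift x to Fˣ using hx.isUnit
    rw [← Units.val_inv_eq_inv_val, quasiChar_unit, quasiChar_unit, map_inv, absPow_inv,
      ← absPow_neg, MonoidHom.inv_apply]
    congr 2
    ring

theorem quasiChar_two_mul_add_one (χ : Fˣ →* ℂˣ) (s : ℂ) (y : Fˣ) :
    quasiChar χ (2 * s + 1) (y : F) = χ y * absPow y s ^ 2 := by
  rw [quasiChar_unit, add_sub_cancel_right, two_mul, absPow_add, sq]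

theorem det_tMat (α β : Fˣ) : GeneralLinearGroup.det (tMat α β) = α * β := by
  apply Units.ext
  rw [GeneralLinearGroup.val_det_apply, tMat_coe, det_fin_two]
  simp

theorem tMat_eq_scalar_mul (y : Fˣ) :
    tMat y (-y) = GeneralLinearGroup.scalar (Fin 2) y * tMat 1 (-1) := by
  apply Units.ext
  rw [Units.val_mul, tMat_coe, tMat_coe, GeneralLinearGroup.coe_scalar]
  ext i j
  fin_cases i <;> fin_cases j <;> simp

theorem absPow_neg_one_mul (y : Fˣ) (s : ℂ) : absPow (-y) s = absPow y s :=
  absPow_eq_of_norm_eq (by simp) s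

variable {ω : Fˣ →* ℂˣ}

/-- The Levi element is the scalar y⁻¹ times d₂, and its determinant has absolute value |y|⁻². Here
τ is reduced to its central character and d₂; the scalar is ω(y)⁻¹|y|^{-2s}. -/
theorem MemInd.apply_tMat (hω : IsCentralCharacter τ ω) {s : ℂ} {ξ : SO4 F → V}
    (h : MemInd τ s ξ) (y : Fˣ) (x : F) (g : SO4 F) :
    ξ (m2 (tMat y⁻¹ (-y⁻¹)) * n2 x * g) =
      quasiChar ω (2 * s + 1) (y : F)⁻¹ • τ (tMat 1 (-1)) (ξ g) := by
  have e : τ (tMat y⁻¹ (-y⁻¹)) (ξ g) = (ω y⁻¹ : ℂ) • τ (tMat 1 (-1)) (ξ g) := by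
    rw [tMat_eq_scalar_mul, map_mul, Module.End.mul_apply, hω.2]
  rw [h.apply, e, det_tMat, smul_smul, ← Units.val_inv_eq_inv_val, quasiChar_two_mul_add_one, absPow_mul,
    absPow_neg_one_mul]
  congr 1
  ring

theorem MemInd.apply_w2_n2 (hω : IsCentralCharacter τ ω) {s : ℂ} {ξ : SO4 F → V}
    (h : MemInd τ s ξ) (y : Fˣ) (g : SO4 F) :
    ξ ((w2 F)⁻¹ * n2 (y : F) * g) =
      quasiChar ω (2 * s + 1) (y : F)⁻¹ • τ (tMat 1 (-1)) (ξ (n2Minus (y : F)⁻¹ * g)) := by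
  rw [w2_inv, w2_mul_n2, mul_assoc, h.apply_tMat hω, Units.val_inv_eq_inv_val]

theorem MemInd.apply_n2Minus_n2 (hω : IsCentralCharacter τ ω) {s : ℂ} {ξ : SO4 F → V}
    (h : MemInd τ s ξ) {y : F} (hy : y ≠ 0) (x : F) :
    ξ ((w2 F)⁻¹ * n2 y * (w2 F * n2 x)) =
      quasiChar ω (2 * s + 1) y⁻¹ • τ (tMat 1 (-1)) (ξ (w2 F * n2 (x + y⁻¹))) := by
  lift y to Fˣ using hy.isUnit
  rw [← mul_assoc, ← n2Minus, n2Minus_mul_n2, h.apply_tMat hω, Units.val_inv_eq_inv_val]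

/-! ### The intertwining operator -/

theorem two_mul_sub_one_qs (s : ℂ) : qs F (2 * s - 1) = qs F (-1) * qs F s ^ 2 := by
  rw [sub_eq_add_neg, qs_add, two_mul, qs_add, sq, mul_comm]

/-- The behaviour of the integrand of `M(τ, s) ξ_s(h)`, uniformly in `s`. -/
theorem IsStandardSection.exists_integrand_radius [CharZero F] (hω : IsCentralCharacter τ ω)
    {ξ : ℂ → SO4 F → V} (hξ : IsStandardSection τ ξ) (h : SO4 F) :
    ∃ ε : ℝ, 0 < ε ∧ ε ≤ 1 ∧
      (∀ t : F, ‖t‖ ≤ ε → ∀ s y,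
        ξ s ((w2 F)⁻¹ * n2 (y + t) * h) = ξ s ((w2 F)⁻¹ * n2 y * h)) ∧
      ∀ y : F, ε⁻¹ ≤ ‖y‖ → ∀ s, ξ s ((w2 F)⁻¹ * n2 y * h) =
        quasiChar ω (2 * s + 1) y⁻¹ • τ (tMat 1 (-1)) (ξ s h) := by
  obtain ⟨ε, hε, hε1, H⟩ := hξ.exists_radius h
  refine ⟨ε, hε, hε1, fun t ht s y => ?_, fun y hy s => ?_⟩
  · rw [n2_add, ← mul_assoc]
    exact (H t ht s _).1
  -- For large y the factor n₂⁻(y⁻¹) is close to 1 and is absorbed by the smoothness of ξ at h.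
  · have hy0 : y ≠ 0 := norm_pos_iff.1 ((inv_pos.2 hε).trans_le hy)
    have hy' : ‖y⁻¹‖ ≤ ε := by
      rw [norm_inv]
      exact inv_le_of_inv_le₀ hε hy
    lift y to Fˣ using hy0.isUnit
    rw [(hξ.1 s).apply_w2_n2 hω, (H _ hy' s 1).2]

/-- The integrand of the regularized intertwining integral. -/
def regIntegrand (ω : Fˣ →* ℂˣ) (ϖ : Fˣ) (ξ : ℂ → SO4 F → V) (h : SO4 F) (s : ℂ) (y : F) : V :=
  ξ s ((w2 F)⁻¹ * n2 y * h) - (ω ϖ * qs F s ^ 2 : ℂ) • ξ s ((w2 F)⁻¹ * n2 (ϖ * y) * h)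

theorem quasiChar_two_mul_add_one_inv_mul {ϖ : Fˣ} (hϖ : IsUniformizer ϖ) (s : ℂ) (y : F) :
    (ω ϖ * qs F s ^ 2 : ℂ) * quasiChar ω (2 * s + 1) (ϖ * y)⁻¹ =
      quasiChar ω (2 * s + 1) y⁻¹ := by
  rw [mul_inv, ← Units.val_inv_eq_inv_val, quasiChar_mul, add_sub_cancel_right, two_mul,
    absPow_inv, absPow_add, hϖ.absPow_eq, map_inv, Units.val_inv_eq_inv_val]
  have h1 := qs_ne_zero (F := F) s
  have h2 := (ω ϖ).ne_zero
  field_simp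

/-- The regularized integrand is invariant under a ball and vanishes outside another, with radii
independent of s. Its integral is therefore a finite sum of vectors, each a Laurent polynomial in
q^{-s}. -/
theorem IsStandardSection.exists_regIntegral [CharZero F] (μ : Measure F) [μ.IsAddHaarMeasure]
    (hω : IsCentralCharacter τ ω)
    {ϖ : Fˣ} (hϖ : IsUniformizer ϖ) {ξ : ℂ → SO4 F → V} (hξ : IsStandardSection τ ξ)
    (h : SO4 F) :
    ∃ N : ℂ → V, IsLaurent F N ∧ ∀ s, HasVectorIntegral μ (regIntegrand ω ϖ ξ h s) (N s) := by
  obtain ⟨ε, hε, hε1, H1, H2⟩ := hξ.exists_integrand_radius hω h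
  have hp : 0 < ‖(ϖ : F)‖ := norm_pos_iff.2 ϖ.ne_zero
  -- Beyond this radius both y and ϖy lie in the range where the integrand is homogeneous, so the
  -- two terms cancel.
  set R : ℝ := (ε * ‖(ϖ : F)‖)⁻¹ with hR
  have hεR : ε ≤ R := by
    refine hε1.trans ((one_le_inv₀ (by positivity)).2 ?_)
    exact mul_le_one₀ hε1 hp.le hϖ.1.le
  obtain ⟨T, hT⟩ := exists_isBallReps (F := F) hε hεR
  have hstep : ∀ s (ℓ : V →ₗ[ℂ] ℂ), IsStep (fun y => ℓ (regIntegrand ω ϖ ξ h s y)) ε R := by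
    intro s ℓ
    refine ⟨hε, hεR, fun x y hy => ?_, fun x hx => ?_⟩
    · rw [regIntegrand, regIntegrand, H1 y hy, mul_add, H1 (ϖ * y)]
      rw [norm_mul]
      exact (mul_le_of_le_one_left (norm_nonneg _) hϖ.1.le).trans hy
    · have h1 : ε⁻¹ < ‖(ϖ * x : F)‖ := by
        rw [hR, mul_inv, ← div_eq_mul_inv, div_lt_iff₀ hp] at hx
        rwa [norm_mul, mul_comm]
      have h2 : ε⁻¹ ≤ ‖x‖ := by
        refine h1.le.trans ?_
        rw [norm_mul]
        exact mul_le_of_le_one_left (norm_nonneg _) hϖ.1.le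
      rw [regIntegrand, H2 _ h1.le, H2 _ h2, smul_smul, quasiChar_two_mul_add_one_inv_mul hϖ,
        sub_self, map_zero]
  refine ⟨fun s => ∑ t ∈ T, (μ.real (Metric.closedBall 0 ε) : ℂ) • regIntegrand ω ϖ ξ h s t,
    IsLaurent.sum T fun t _ => ?_, fun s ℓ => ?_⟩
  · obtain ⟨n, v, hv⟩ := hξ.exists_eq_zpow_smul ((w2 F)⁻¹ * n2 t * h)
    obtain ⟨m, w, hw⟩ := hξ.exists_eq_zpow_smul ((w2 F)⁻¹ * n2 (ϖ * t) * h)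
    have h1 := (isLaurent_zpow_smul (F := F) n ((μ.real (Metric.closedBall 0 ε) : ℂ) • v)).add
      (isLaurent_zpow_smul (F := F) (m + 2)
        ((-(μ.real (Metric.closedBall 0 ε) : ℂ) * ω ϖ : ℂ) • w))
    refine (congrArg (IsLaurent F) (funext fun s => ?_)).mp h1
    rw [regIntegrand, hv, hw, zpow_add₀ (qs_ne_zero s), zpow_two]
    module
  · have h1 := (hstep s ℓ).integral (μ := μ) hT
    refine ⟨h1.1, ?_⟩
    rw [h1.2, map_sum]
    simp only [map_smul, smul_eq_mul]

/-- Where the integral converges, replacing y by ϖy multiplies it by q, so regularization multiplies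
it by 1 - ω(ϖ)q^{-(2s-1)}. Dividing the regularized integral by this factor defines the
continuation. -/
theorem exists_isIntertwined [CharZero F] (μ : Measure F) [μ.IsAddHaarMeasure]
    (hω : IsCentralCharacter τ ω) {ϖ : Fˣ} (hϖ : IsUniformizer ϖ) {ξ : ℂ → SO4 F → V}
    (hξ : IsStandardSection τ ξ) :
    ∃ η : ℂ → SO4 F → V, IsIntertwined μ ξ η ∧ ∀ s h (ℓ : V →ₗ[ℂ] ℂ),
      Integrable (fun y => ℓ (regIntegrand ω ϖ ξ h s y)) μ ∧
      ℓ (η s h) = (1 - ω ϖ * qs F (2 * s - 1))⁻¹ * ∫ y, ℓ (regIntegrand ω ϖ ξ h s y) ∂μ := by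
  choose N hN hNi using fun h => hξ.exists_regIntegral μ hω hϖ h
  have hp : 0 < ‖(ϖ : F)‖ := norm_pos_iff.2 ϖ.ne_zero
  have hη : ∀ s h (ℓ : V →ₗ[ℂ] ℂ), ℓ ((1 - ω ϖ * qs F (2 * s - 1) : ℂ)⁻¹ • N h s) =
      (1 - ω ϖ * qs F (2 * s - 1))⁻¹ * ∫ y, ℓ (regIntegrand ω ϖ ξ h s y) ∂μ := by
    intro s h ℓ
    rw [map_smul, smul_eq_mul, (hNi h s ℓ).2]
  refine ⟨fun s h => (1 - ω ϖ * qs F (2 * s - 1) : ℂ)⁻¹ • N h s, ⟨?_, ?_⟩,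
    fun s h ℓ => ⟨(hNi h s ℓ).1, hη s h ℓ⟩⟩
  · obtain ⟨σ, hσ⟩ := exists_norm_mul_qs_lt_one (F := F) (ω ϖ)
    -- The bound σ concerns the exponent 2s - 1.
    refine ⟨(σ + 1) / 2, fun s hs h ℓ => ?_⟩
    have hlt : ‖ω ϖ * qs F (2 * s - 1)‖ < 1 := hσ _ (by simp; linarith)
    have hne : (1 - ω ϖ * qs F (2 * s - 1) : ℂ) ≠ 0 := by
      intro h0
      rw [← sub_eq_zero.1 h0, norm_one] at hlt
      exact lt_irrefl _ hlt
    obtain ⟨ε, hε, hε1, H1, H2⟩ := hξ.exists_integrand_radius hω h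
    have hε1' : 1 ≤ ε⁻¹ := (one_le_inv₀ hε).2 hε1
    have hball : ∀ R, ε ≤ R → IntegrableOn (fun y => ℓ (ξ s ((w2 F)⁻¹ * n2 y * h)))
        (Metric.closedBall 0 R) μ := by
      intro R hR
      obtain ⟨T, hT⟩ := exists_isBallReps (F := F) hε hR
      exact (hT.integral μ hR fun x y _ hy => by rw [H1 y hy]).1
    have hc := integrableOn_compl_closedBall (μ := μ) hϖ
      (f := fun y => ℓ (ξ s ((w2 F)⁻¹ * n2 y * h))) (R := ε⁻¹) (c := ω ϖ * qs F s ^ 2)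
      (inv_pos.2 hε) (hball _ ?_) ?_ ?_
    · have hi : Integrable (fun y => ℓ (ξ s ((w2 F)⁻¹ * n2 y * h))) μ := by
        have := (hball ε⁻¹ (hε1.trans hε1')).union hc
        rwa [Set.union_compl_self, integrableOn_univ] at this
      refine ⟨hi, ?_⟩
      have hi' := (integrable_comp_mul μ ϖ hi).const_mul (ω ϖ * qs F s ^ 2 : ℂ)
      have e : ∫ y, ℓ (regIntegrand ω ϖ ξ h s y) ∂μ =
          (1 - ω ϖ * qs F (2 * s - 1)) * ∫ y, ℓ (ξ s ((w2 F)⁻¹ * n2 y * h)) ∂μ := by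
        simp only [regIntegrand, map_sub, map_smul, smul_eq_mul]
        rw [integral_sub hi hi', integral_const_mul,
          integral_comp_mul μ ϖ fun y => ℓ (ξ s ((w2 F)⁻¹ * n2 y * h)), two_mul_sub_one_qs,
          qs_neg, ← hϖ.absPow_eq 1, absPow_exponent_one, Complex.real_smul]
        push_cast
        ring
      rw [hη, e, inv_mul_cancel_left₀ hne]
    · refine hε1.trans (hε1'.trans ?_)
      exact le_mul_of_one_le_left (inv_pos.2 hε).le ((one_le_inv₀ hp).2 hϖ.1.le)
    · intro x hx
      have hx' : ε⁻¹ ≤ ‖((ϖ⁻¹ : Fˣ) * x : F)‖ := by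
        refine hx.trans ?_
        rw [norm_mul, Units.val_inv_eq_inv_val, norm_inv]
        exact le_mul_of_one_le_left (norm_nonneg _) ((one_le_inv₀ hp).2 hϖ.1.le)
      rw [H2 _ hx', H2 _ hx, ← quasiChar_two_mul_add_one_inv_mul hϖ s ((ϖ⁻¹ : Fˣ) * x : F),
        Units.mul_inv_cancel_left]
      simp only [map_smul, smul_eq_mul, mul_assoc]
    · convert hlt using 1
      rw [absF_inv, ← Real.norm_of_nonneg (absF_pos ϖ).le, ← Complex.norm_real,
        ← absPow_exponent_one, hϖ.absPow_eq, ← norm_inv, ← qs_neg, ← norm_mul,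
        two_mul_sub_one_qs]
      congr 1
      ring
  -- As a polynomial in X = q^{-s} the denominator is 1 - ω(ϖ)qX².
  · refine ⟨Polynomial.C 1 - Polynomial.C (ω ϖ * qs F (-1)) * Polynomial.X ^ 2, fun h0 => ?_,
      fun h => ?_⟩
    · have := congrArg (Polynomial.eval 0) h0
      simp at this
    · obtain ⟨c, hc⟩ := hN h
      refine ⟨c, fun s hs => ?_⟩
      have e : Polynomial.eval (qs F s)
          (Polynomial.C 1 - Polynomial.C (ω ϖ * qs F (-1)) * Polynomial.X ^ 2 : Polynomial ℂ) =
          1 - ω ϖ * qs F (2 * s - 1) := by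
        rw [two_mul_sub_one_qs]
        simp only [Polynomial.eval_sub, Polynomial.eval_mul, Polynomial.eval_C,
          Polynomial.eval_pow, Polynomial.eval_X]
        ring
      rw [e] at hs ⊢
      rw [smul_smul, mul_inv_cancel₀ hs, one_smul, hc]

end Sections

/-! ### The substitution y ↦ y⁻¹ and stable Jacquet integrals. -/

section Inversion

variable {F : Type*} [NontriviallyNormedField F] [IsUltrametricDist F] [ProperSpace F]
  [MeasurableSpace F] [BorelSpace F] {μ : Measure F} [μ.IsAddHaarMeasure]

/-- Inversion exchanges the ball of radius δ around t, which avoids 0, with the ball around t⁻¹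
obtained by scaling by t⁻². The Jacobian |y|⁻², here `quasiChar 1 (-1) y`, equals |t|² there. -/
theorem quasiChar_one_mul_ballFun {δ : ℝ} (hδ : 0 < δ) (t : Fˣ) (ht : δ < ‖(t : F)‖) (y : F) :
    quasiChar 1 (-1) y * ballFun δ (y⁻¹ - t) =
      absPow t 2 * ballFun δ ((t ^ 2 : Fˣ) * (y - (t : F)⁻¹)) := by
  have ht0 : 0 < ‖(t : F)‖ := hδ.trans ht
  have e2 : ((t ^ 2 : Fˣ) * (y - (t : F)⁻¹) : F) = t * (t * y - 1) := by
    have := t.ne_zero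
    push_cast
    field_simp
  rw [e2]
  rcases eq_or_ne y 0 with rfl | hy
  · rw [quasiChar_zero, zero_mul, ballFun_of_lt, mul_zero]
    simpa using ht
  lift y to Fˣ using hy.isUnit
  have hy0 : 0 < ‖(y : F)‖ := norm_pos_iff.2 y.ne_zero
  have e1 : ((y : F)⁻¹ - t) = -((y : F)⁻¹ * (t * y - 1)) := by
    have := y.ne_zero
    field_simp
    ring
  by_cases hn : ‖(t * y : F)‖ = 1
  · have hn' : ‖(y : F)⁻¹‖ = ‖(t : F)‖ := by
      rw [norm_mul] at hn
      rw [norm_inv]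
      exact inv_eq_of_mul_eq_one_left hn
    have h1 : (ballFun δ ((y : F)⁻¹ - t) : ℂ) = ballFun δ (t * (t * y - 1) : F) := by
      rw [e1, ballFun, ballFun, norm_neg, norm_mul, norm_mul, hn']
    have h2 : absPow t 2 = absPow y⁻¹ 2 :=
      absPow_eq_of_norm_eq (by rw [Units.val_inv_eq_inv_val, hn']) 2
    rw [h1, quasiChar_unit, h2, absPow_inv, ← absPow_neg]
    norm_num
  · have h1 : 1 ≤ ‖(t * y - 1 : F)‖ ∧ ‖(t * y : F)‖ ≤ ‖(t * y - 1 : F)‖ := by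
      have := IsUltrametricDist.norm_add_eq_max_of_norm_ne_norm (x := (t * y : F)) (y := -1)
        (by rwa [norm_neg, norm_one])
      rw [← sub_eq_add_neg, norm_neg, norm_one] at this
      rw [this]
      exact ⟨le_max_right _ _, le_max_left _ _⟩
    rw [ballFun_of_lt, ballFun_of_lt, mul_zero, mul_zero]
    · rw [norm_mul]
      nlinarith
    · rw [e1, norm_neg, norm_mul, norm_inv]
      refine ht.trans_le ?_
      rw [inv_mul_eq_div, le_div_iff₀ hy0, ← norm_mul]
      exact h1.2

theorem integral_quasiChar_one_mul_ballFun {δ : ℝ} (hδ : 0 < δ) (t : Fˣ) (ht : δ < ‖(t : F)‖) :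
    Integrable (fun y : F => quasiChar 1 (-1) y * ballFun δ (y⁻¹ - t)) μ ∧
    ∫ y : F, quasiChar 1 (-1) y * ballFun δ (y⁻¹ - t) ∂μ =
      (μ.real (Metric.closedBall (0 : F) δ) : ℂ) := by
  have hi := integrable_comp_mul μ (t ^ 2) (isStep_ballFun (F := F) hδ).integrable
  simp only [quasiChar_one_mul_ballFun hδ t ht]
  refine ⟨(hi.comp_sub_right _).const_mul _, ?_⟩
  rw [integral_const_mul,
    integral_sub_right_eq_self (μ := μ) (fun y : F => (ballFun δ ((t ^ 2 : Fˣ) * y : F) : ℂ)),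
    integral_comp_mul μ (t ^ 2) (ballFun δ : F → ℂ), integral_ballFun, Complex.real_smul, ← mul_assoc]
  have h : absPow t 2 = (absF (t ^ 2) : ℂ) := by
    rw [← absPow_exponent_one, sq, absPow_mul, ← absPow_add]
    norm_num
  have h' : (absF (t ^ 2) : ℂ) ≠ 0 := by exact_mod_cast (absF_pos _).ne'
  rw [h, Complex.ofReal_inv, mul_inv_cancel₀ h', one_mul]

theorem IsStep.eq_sum_ballFun {f : F → ℂ} {δ R : ℝ} (h : IsStep f δ R) {T : Finset F}
    (hT : IsBallReps R δ T) (x : F) : f x = ∑ t ∈ T, f t * ballFun δ (x - t) := by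
  by_cases hx : ‖x‖ ≤ R
  · obtain ⟨t, ht, hxt⟩ := hT.2.2 x hx
    rw [Finset.sum_eq_single_of_mem t ht, ballFun_of_le hxt, mul_one]
    · simpa using h.add t (x - t) hxt
    · intro t' ht' hne
      rw [ballFun_of_lt, mul_zero]
      by_contra! hle
      refine hne (hT.2.1 t' ht' t ht ?_)
      simpa using norm_sub_le_of_le hxt hle
  · rw [h.zero x (not_le.1 hx), Finset.sum_eq_zero]
    intro t ht
    rw [ballFun_of_lt, mul_zero]
    by_contra! hle
    refine hx ?_
    simpa using norm_add_le_of_le (hle.trans h.le) (hT.1 t ht)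

/-- The substitution `y ↦ y⁻¹`. -/
theorem IsStep.integral_comp_inv {f : F → ℂ} {δ R : ℝ} (h : IsStep f δ R) (h0 : f 0 = 0) :
    ∫ y : F, quasiChar 1 (-1) y * f y⁻¹ ∂μ = ∫ y, f y ∂μ := by
  obtain ⟨T, hT⟩ := exists_isBallReps (F := F) h.pos h.le
  have e : ∀ y : F, quasiChar 1 (-1) y * f y⁻¹ =
      ∑ t ∈ T, f t * (quasiChar 1 (-1) y * ballFun δ (y⁻¹ - t)) := by
    intro y
    rw [h.eq_sum_ballFun hT, Finset.mul_sum]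
    exact Finset.sum_congr rfl fun t _ => by ring
  have key : ∀ t ∈ T, Integrable
      (fun y : F => f t * (quasiChar 1 (-1) y * ballFun δ (y⁻¹ - t))) μ ∧
      ∫ y : F, f t * (quasiChar 1 (-1) y * ballFun δ (y⁻¹ - t)) ∂μ =
        (μ.real (Metric.closedBall (0 : F) δ) : ℂ) * f t := by
    intro t _
    by_cases ht : ‖t‖ ≤ δ
    · have : f t = 0 := by rw [← zero_add t, h.add 0 t ht, h0]
      simp [this]
    · have ht' := not_le.1 ht
      have htne : t ≠ 0 := norm_pos_iff.1 (h.pos.trans ht')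
      lift t to Fˣ using htne.isUnit
      obtain ⟨h1, h2⟩ := integral_quasiChar_one_mul_ballFun (μ := μ) h.pos t ht'
      exact ⟨h1.const_mul _, by rw [integral_const_mul, h2, mul_comm]⟩
  simp only [e]
  rw [integral_finsetSum T fun t ht => (key t ht).1, (h.integral hT).2]
  exact Finset.sum_congr rfl fun t ht => (key t ht).2

/-- The Jacobian |y|⁻² is absorbed as |y⁻¹|², which shifts the exponent from s to s + 2. -/
theorem IsStep.integral_quasiChar_comp_inv {χ : Fˣ →* ℂˣ} {r : ℝ} (hχ : IsTrivialNearOne χ r)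
    (s : ℂ) {Φ : F → ℂ} {δ R : ℝ} (h : IsStep Φ δ R) (h0 : Φ 0 = 0) :
    ∫ y : F, quasiChar χ (s + 2) y⁻¹ * Φ y⁻¹ ∂μ = ∫ y, quasiChar χ s y * Φ y ∂μ := by
  have hs := h.mul_quasiChar hχ h.pos
    (fun x hx => by rw [← zero_add x, h.add 0 x hx, h0]) s
  rw [← hs.integral_comp_inv (by rw [h0, mul_zero])]
  refine congrArg (fun f : F → ℂ => ∫ y, f y ∂μ) (funext fun y => ?_)
  rcases eq_or_ne y 0 with rfl | hy
  · simp [quasiChar_zero]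
  lift y to Fˣ using hy.isUnit
  rw [← mul_assoc, quasiChar_unit, ← Units.val_inv_eq_inv_val, quasiChar_unit, quasiChar_unit,
    absPow_inv, absPow_inv, ← absPow_neg, ← absPow_neg, MonoidHom.one_apply, Units.val_one, one_mul,
    mul_left_comm, ← absPow_add]
  congr 3
  ring

/-! ### Jacquet integrals -/

/-- On R₁ < ‖y‖ ≤ R translation by t preserves φ and multiplies ψ by ψ(t) ≠ 1, so this region
contributes 0. -/
theorem isStable_jacquet {ψ : AddChar F Circle} {C : ℝ} (hC : HasConductor ψ C) {φ : F → ℂ}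
    {ε R₁ : ℝ} {t : F} (hε : 0 < ε) (hR₁ : 0 < R₁) (hφ : ∀ x y, ‖y‖ ≤ ε → φ (x + y) = φ x)
    (ht : ψ t ≠ 1) (htR : ‖t‖ ≤ R₁) (htail : ∀ x, R₁ < ‖x‖ → φ (x + t) = φ x) {R : ℝ}
    (hR : R₁ ≤ R) :
    IntegrableOn (fun y => φ y * (ψ y : ℂ)) (Metric.closedBall 0 R) μ ∧
    ∫ y in Metric.closedBall 0 R, φ y * (ψ y : ℂ) ∂μ =
      ∫ y in Metric.closedBall 0 R₁, φ y * (ψ y : ℂ) ∂μ := by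
  have hi : IntegrableOn (fun y => φ y * (ψ y : ℂ)) (Metric.closedBall 0 R) μ := by
    obtain ⟨T, hT⟩ := exists_isBallReps (F := F) (δ := min R (min ε C)) (R := R)
      (lt_min (hR₁.trans_le hR) (lt_min hε hC.1)) (min_le_left _ _)
    refine (hT.integral μ (min_le_left _ _) fun x y _ hy => ?_).1
    have hy' := hy.trans (min_le_right _ _)
    rw [hφ x y (hy'.trans (min_le_left _ _)), AddChar.map_add_eq_mul,
      hC.eq_one (hy'.trans (min_le_right _ _)), mul_one]
  refine ⟨hi, ?_⟩
  have hm := fun r => (Metric.isClosed_closedBall (x := (0 : F)) (ε := r)).measurableSet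
  have hz : ∫ y in Metric.closedBall 0 R \ Metric.closedBall 0 R₁, φ y * (ψ y : ℂ) ∂μ = 0 := by
    refine setIntegral_eq_zero_of_translate μ ((hm R).diff (hm R₁)) (t := t) (z := (ψ t : ℂ))
      (fun h => ht (Circle.ext h)) (fun x => ?_) fun x hx => ?_
    · simp [norm_add_le_iff htR, norm_add_le_iff (htR.trans hR)]
    · rw [htail x (by simpa using hx.2), AddChar.map_add_eq_mul]
      push_cast
      ring
  have hsub := Metric.closedBall_subset_closedBall (x := (0 : F)) hR
  rw [setIntegral_sdiff (hm R₁) hi hsub, sub_eq_zero] at hz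
  exact hz

/-- For ‖u‖ ≤ R the ball absorbs the shift, which yields ψ(-u). For ‖u‖ > R only the tail of φ is
seen and its invariance under t gives 0. The truncation of the Gauss function thus arises by itself,
with the same radius R. -/
theorem jacquet_translate {ψ : AddChar F Circle} {φ : F → ℂ}
    {R₁ : ℝ} {t : F} (ht : ψ t ≠ 1) (htR : ‖t‖ ≤ R₁)
    (htail : ∀ x, R₁ < ‖x‖ → φ (x + t) = φ x) {R : ℝ} (hR : R₁ ≤ R) (u : F) :
    ∫ y in Metric.closedBall 0 R, φ (y + u) * (ψ y : ℂ) ∂μ =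
      (∫ y in Metric.closedBall 0 R, φ y * (ψ y : ℂ) ∂μ) * gaussFun ψ R u := by
  have hm := (Metric.isClosed_closedBall (x := (0 : F)) (ε := R)).measurableSet
  by_cases hu : ‖u‖ ≤ R
  · rw [gaussFun, ballFun_of_le hu, one_mul, ← integral_indicator hm, ← integral_indicator hm,
      ← integral_mul_const, ← integral_sub_right_eq_self (μ := μ) _ u]
    refine congrArg (fun f : F → ℂ => ∫ y, f y ∂μ) (funext fun y => ?_)
    have hiff : ‖y - u‖ ≤ R ↔ ‖y‖ ≤ R := by
      rw [sub_eq_add_neg, norm_add_le_iff (by rwa [norm_neg])]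
    by_cases hy : ‖y‖ ≤ R
    · rw [Set.indicator_of_mem (by simpa using hiff.2 hy), Set.indicator_of_mem (by simpa using hy),
        sub_add_cancel, sub_eq_add_neg, AddChar.map_add_eq_mul]
      push_cast
      ring
    · rw [Set.indicator_of_notMem (by simpa using fun h => hy (hiff.1 h)),
        Set.indicator_of_notMem (by simpa using hy), zero_mul]
  · have hu' := not_le.1 hu
    rw [gaussFun, ballFun_of_lt hu', zero_mul, mul_zero]
    refine setIntegral_eq_zero_of_translate μ hm (t := t) (z := (ψ t : ℂ))
      (fun h => ht (Circle.ext h)) (fun x => ?_) fun x hx => ?_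
    · simp [norm_add_le_iff (htR.trans hR)]
    · have hx' : ‖x‖ ≤ R := by simpa using hx
      have hn : ‖u + x‖ = ‖u‖ := norm_add_eq_of_lt (hx'.trans_lt hu')
      rw [add_right_comm, htail _ (by rw [add_comm, hn]; exact hR.trans_lt hu'),
        AddChar.map_add_eq_mul]
      push_cast
      ring

end Inversion

/-! ### Proportionality of the two Jacquet integrals. -/

section Identity

variable {F : Type*} [NontriviallyNormedField F] [IsUltrametricDist F] [ProperSpace F]
  [MeasurableSpace F] [BorelSpace F] {V : Type*} [AddCommGroup V] [Module ℂ V]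
  {τ : Representation ℂ (GL (Fin 2) F) V} {μ : Measure F} [μ.IsAddHaarMeasure]
  {ω : Fˣ →* ℂˣ}

theorem tMat_neg_one_apply_apply (v : V) : τ (tMat 1 (-1)) (τ (tMat 1 (-1)) v) = v := by
  rw [← Module.End.mul_apply, ← map_mul, tMat_mul, mul_one, neg_mul_neg, mul_one, tMat_one, map_one,
    Module.End.one_apply]

/-- Since d₂² = 1, applying τ(d₂) leaves only a scalar and translates. Dilation of y by ϖ becomes
dilation of y⁻¹ by ϖ⁻¹, the shape used in `regZeta`. -/
theorem regIntegrand_w2_n2 (hω : IsCentralCharacter τ ω) {ϖ : Fˣ} (hϖ : IsUniformizer ϖ)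
    {ξ : ℂ → SO4 F → V} {s : ℂ} (hξ : MemInd τ s (ξ s)) (x : F) {y : F} (hy : y ≠ 0) :
    τ (tMat 1 (-1)) (regIntegrand ω ϖ ξ (w2 F * n2 x) s y) = quasiChar ω (2 * s + 1) y⁻¹ •
      (ξ s (w2 F * n2 (x + y⁻¹)) - ξ s (w2 F * n2 (x + (ϖ⁻¹ : Fˣ) * y⁻¹))) := by
  rw [regIntegrand, hξ.apply_n2Minus_n2 hω hy, hξ.apply_n2Minus_n2 hω (mul_ne_zero ϖ.ne_zero hy),
    smul_smul, quasiChar_two_mul_add_one_inv_mul hϖ, ← smul_sub, map_smul, map_sub,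
    tMat_neg_one_apply_apply, tMat_neg_one_apply_apply, mul_inv, Units.val_inv_eq_inv_val]

/-- The Jacquet integrals of `ξ_s` and of `M(τ, s) ξ_s`. -/
theorem IsStandardSection.exists_jacquet [CharZero F] (hω : IsCentralCharacter τ ω) {r : ℝ}
    (hω1 : IsTrivialNearOne ω r) {ϖ : Fˣ} (hϖ : IsUniformizer ϖ) {ψ : AddChar F Circle} {C : ℝ}
    (hC : HasConductor ψ C) {R₀ : ℝ} (hR₀ : IsStableRadius ψ r R₀) {ξ : ℂ → SO4 F → V}
    (hξ : IsStandardSection τ ξ) {η : ℂ → SO4 F → V}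
    (hη : ∀ s h (ℓ : V →ₗ[ℂ] ℂ), Integrable (fun y => ℓ (regIntegrand ω ϖ ξ h s y)) μ ∧
      ℓ (η s h) = (1 - ω ϖ * qs F (2 * s - 1))⁻¹ * ∫ y, ℓ (regIntegrand ω ϖ ξ h s y) ∂μ)
    (Λ : V →ₗ[ℂ] ℂ) (s : ℂ) (hs : ω ϖ * qs F (2 * s - 1) ≠ 1) :
    ∃ A : ℂ, HasStableIntegral μ (fun y => Λ (ξ s (w2 F * n2 y)) * (ψ y : ℂ)) A ∧
      HasStableIntegral μ (fun y => Λ (τ (tMat 1 (-1)) (η s (w2 F * n2 y))) * (ψ y : ℂ))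
        (A * regZeta μ ϖ ω (2 * s - 1) (gaussFun ψ R₀)) := by
  obtain ⟨ε, hε, hε1, H1, H2⟩ := hξ.exists_integrand_radius hω 1
  obtain ⟨ε', hε', -, H3⟩ := hξ.exists_radius 1
  simp only [w2_inv, mul_one] at H1 H2 H3
  set φ : F → ℂ := fun y => Λ (ξ s (w2 F * n2 y)) with hφ
  have hφε : ∀ x y, ‖y‖ ≤ ε → φ (x + y) = φ x := fun x y hy => by rw [hφ]; simp only [H1 y hy]
  -- R₀ provides a translation t with ψ(t) ≠ 1 and ‖t‖ ≤ rR₁; ε⁻¹ is where φ becomes a multiple of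
  -- ω⁻¹|·|^{-2s}, which that t preserves.
  set R₁ := max R₀ ε⁻¹
  obtain ⟨hR₁, t, ht, htr⟩ := hR₀.mono hω1.1 (le_max_left R₀ ε⁻¹)
  have htR : ‖t‖ ≤ R₁ := htr.trans (by nlinarith [hω1.2.1])
  have htail : ∀ x, R₁ < ‖x‖ → φ (x + t) = φ x := by
    intro x hx
    have h1 : ‖x + t‖ = ‖x‖ := norm_add_eq_of_lt (htR.trans_lt hx)
    have h2 : ε⁻¹ ≤ ‖x‖ := (le_max_right _ _).trans hx.le
    simp only [hφ]
    rw [H2 _ h2, H2 _ (h1 ▸ h2), quasiChar_inv, quasiChar_inv, hω1.inv.quasiChar_add]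
    exact htr.trans (by have := hω1.1; gcongr)
  refine ⟨∫ y in Metric.closedBall 0 R₁, φ y * (ψ y : ℂ) ∂μ, ?_, ?_⟩
  · filter_upwards [eventually_ge_atTop R₁] with R hR
    exact isStable_jacquet hC hε hR₁ hφε ht htR htail hR
  filter_upwards [eventually_ge_atTop R₁] with R hR
  have hR0 : 0 < R := hR₁.trans_le hR
  -- At this scale all integrands over the ball are invariant, so the outer integral is a sum over T
  -- and can be moved inside the integral over y.
  obtain ⟨T, hT⟩ := exists_isBallReps (F := F) (δ := min R (min (min ε ε') C)) (R := R)
    (lt_min hR0 (lt_min (lt_min hε hε') hC.1)) (min_le_left _ _)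
  set δ := min R (min (min ε ε') C)
  have hδε : δ ≤ ε := (min_le_right _ _).trans ((min_le_left _ _).trans (min_le_left _ _))
  have hδε' : δ ≤ ε' := (min_le_right _ _).trans ((min_le_left _ _).trans (min_le_right _ _))
  have hδC : δ ≤ C := (min_le_right _ _).trans (min_le_right _ _)
  have hδR : δ ≤ R := min_le_left _ _
  have hψδ : ∀ x y, ‖y‖ ≤ δ → ψ (x + y) = ψ x := fun x y hy => by
    rw [AddChar.map_add_eq_mul, hC.eq_one (hy.trans hδC), mul_one]
  set ℓ : V →ₗ[ℂ] ℂ := Λ ∘ₗ τ (tMat 1 (-1)) with hℓ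
  have hinv : ∀ x y, ‖y‖ ≤ δ → ℓ (η s (w2 F * n2 (x + y))) = ℓ (η s (w2 F * n2 x)) := by
    intro x y hy
    rw [(hη s _ ℓ).2, (hη s _ ℓ).2]
    simp only [regIntegrand, n2_add, ← mul_assoc, (H3 y (hy.trans hδε') _ _).1]
  obtain ⟨hi, hsum⟩ := hT.integral μ hδR (f := fun y => ℓ (η s (w2 F * n2 y)) * (ψ y : ℂ))
    fun x y _ hy => by rw [hinv x y hy, hψδ x y hy]
  refine ⟨hi, hsum.trans ?_⟩
  have hI : ∀ u, ∑ t ∈ T, (μ.real (Metric.closedBall 0 δ) : ℂ) * (φ (t + u) * (ψ t : ℂ)) =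
      (∫ y in Metric.closedBall 0 R₁, φ y * (ψ y : ℂ) ∂μ) * gaussFun ψ R u := by
    intro u
    rw [← (hT.integral μ hδR (f := fun y => φ (y + u) * (ψ y : ℂ)) fun x y _ hy => by
      rw [add_right_comm, hφε _ y (hy.trans hδε), hψδ x y hy]).2,
      jacquet_translate ht htR htail hR,
      (isStable_jacquet (μ := μ) hC hε hR₁ hφε ht htR htail hR).2]
  set A := ∫ y in Metric.closedBall 0 R₁, φ y * (ψ y : ℂ) ∂μ
  have hG := hC.isStep_gaussFun hR0
  -- After y ↦ y⁻¹ the inner sum over T is the Jacquet integral translated by y, that is A times the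
  -- Gauss function.
  have hreg : ∫ y, ∑ t ∈ T, (μ.real (Metric.closedBall 0 δ) : ℂ) * (ψ t : ℂ) *
        ℓ (regIntegrand ω ϖ ξ (w2 F * n2 t) s y) ∂μ =
      A * ∫ y, quasiChar ω (2 * s - 1) y * (gaussFun ψ R y - gaussFun ψ R ((ϖ⁻¹ : Fˣ) * y)) ∂μ := by
    have hG' := hG.sub (hG.comp_mul ϖ⁻¹)
    rw [← hG'.integral_quasiChar_comp_inv hω1 _ (by simp), ← integral_const_mul]
    refine integral_congr_ae ?_
    have h0 : ∀ᵐ y : F ∂μ, y ≠ 0 := by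
      rw [ae_iff]
      simp
    filter_upwards [h0] with y hy
    have e : ∀ t, ℓ (regIntegrand ω ϖ ξ (w2 F * n2 t) s y) = quasiChar ω (2 * s + 1) y⁻¹ *
        (φ (t + y⁻¹) - φ (t + (ϖ⁻¹ : Fˣ) * y⁻¹)) := by
      intro t
      rw [hℓ, LinearMap.comp_apply, regIntegrand_w2_n2 hω hϖ (hξ.1 s) t hy, map_smul, map_sub,
        smul_eq_mul]
    rw [show (2 * s - 1 + 2 : ℂ) = 2 * s + 1 by ring]
    calc _ = ∑ t ∈ T, quasiChar ω (2 * s + 1) y⁻¹ *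
          ((μ.real (Metric.closedBall 0 δ) : ℂ) * (φ (t + y⁻¹) * (ψ t : ℂ)) -
            (μ.real (Metric.closedBall 0 δ) : ℂ) * (φ (t + (ϖ⁻¹ : Fˣ) * y⁻¹) * (ψ t : ℂ))) :=
          Finset.sum_congr rfl fun t _ => by rw [e]; ring
      _ = _ := by
        rw [← Finset.mul_sum, Finset.sum_sub_distrib, hI, hI]
        ring
  have hreg' := hreg
  rw [integral_finsetSum T fun t _ => (hη s _ ℓ).1.const_mul _] at hreg'
  rw [← regZeta_gaussFun_eq hϖ hω1 hC hs hR₀ ((le_max_left _ _).trans hR), regZeta,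
    mul_left_comm, ← hreg', Finset.mul_sum]
  refine Finset.sum_congr rfl fun t _ => ?_
  rw [(hη s _ ℓ).2, integral_const_mul]
  ring

/-- Pulls a finite exceptional set for q^{-(2s-1)} = q·(q^{-s})² back to one for q^{-s}. -/
theorem finite_setOf_mul_sq_mem {c : ℂ} (hc : c ≠ 0) (E : Finset ℂ) :
    {x : ℂ | c * x ^ 2 ∈ E}.Finite := by
  refine Set.Finite.preimage' (f := fun x : ℂ => c * x ^ 2) E.finite_toSet fun b _ => ?_
  have hp : (Polynomial.C c * Polynomial.X ^ 2 - Polynomial.C b : Polynomial ℂ) ≠ 0 := by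
    intro h
    have := congrArg (fun p => p.coeff 2) h
    simp [hc] at this
  refine (Polynomial.C c * Polynomial.X ^ 2 - Polynomial.C b : Polynomial ℂ).roots.toFinset.finite_toSet.subset
    fun x hx => ?_
  have hx' : c * x ^ 2 = b := hx
  simp [hp, hx']

theorem isLocalCoefficient_of_gauss [CharZero F] (hω : IsCentralCharacter τ ω) {r : ℝ}
    (hω1 : IsTrivialNearOne ω r) {ϖ : Fˣ} (hϖ : IsUniformizer ϖ) {ψ : AddChar F Circle} {C : ℝ}
    (hC : HasConductor ψ C) {R₀ : ℝ} (hR₀ : IsStableRadius ψ r R₀) {γ : RatFunc ℂ} {E : Finset ℂ}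
    (hγ : ∀ s, qs F s ∉ E →
      γ.eval (RingHom.id ℂ) (qs F s) * regZeta μ ϖ ω s (gaussFun ψ R₀) = 1) :
    IsLocalCoefficient ψ μ τ γ := by
  classical
  intro Λ _ ξ hξ
  obtain ⟨η, hη, hη'⟩ := exists_isIntertwined μ hω hϖ hξ
  have hfin := finite_setOf_mul_sq_mem (qs_ne_zero (F := F) (-1)) (insert (ω ϖ : ℂ)⁻¹ E)
  refine ⟨η, hη, hfin.toFinset, fun s hs => ?_⟩
  simp only [Set.Finite.mem_toFinset, Set.mem_ofPred_eq, ← two_mul_sub_one_qs, Finset.mem_insert,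
    not_or] at hs
  obtain ⟨A, hA, hB⟩ := hξ.exists_jacquet hω hω1 hϖ hC hR₀ hη' Λ s
    fun h => hs.1 (eq_inv_of_mul_eq_one_right h)
  refine ⟨A, _, hA, hB, ?_⟩
  rw [mul_left_comm, hγ _ hs.2, mul_one]

end Identity

/-! ### Matrices congruent to the identity. -/

section Congruence

variable {F : Type*} [NontriviallyNormedField F] [IsUltrametricDist F]
  {n : Type*} [Fintype n] [DecidableEq n]

theorem norm_mul_apply_le {A B : Matrix n n F} {a b : ℝ} (ha : 0 ≤ a) (hb : 0 ≤ b)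
    (hA : ∀ i j, ‖A i j‖ ≤ a) (hB : ∀ i j, ‖B i j‖ ≤ b) (i j : n) : ‖(A * B) i j‖ ≤ a * b := by
  rw [Matrix.mul_apply]
  refine IsUltrametricDist.norm_sum_le_of_forall_le_of_nonneg (mul_nonneg ha hb) fun l _ => ?_
  rw [norm_mul]
  exact mul_le_mul (hA i l) (hB l j) (norm_nonneg _) ha

/-- The matrix `A` is congruent to the identity modulo the ball of radius `δ`. -/
def IsNearOne (δ : ℝ) (A : Matrix n n F) : Prop := ∀ i j, ‖(A - 1) i j‖ ≤ δ

theorem IsNearOne.norm_le {δ : ℝ} (h1 : δ ≤ 1) {A : Matrix n n F} (h : IsNearOne δ A) (i j : n) :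
    ‖A i j‖ ≤ 1 := by
  have e : A i j = (A - 1) i j + (1 : Matrix n n F) i j := by simp
  rw [e]
  refine norm_add_le_of_le ((h i j).trans h1) ?_
  rw [Matrix.one_apply]
  split_ifs <;> simp

theorem IsNearOne.mul {δ : ℝ} (h0 : 0 ≤ δ) (h1 : δ ≤ 1) {A B : Matrix n n F} (hA : IsNearOne δ A)
    (hB : IsNearOne δ B) : IsNearOne δ (A * B) := by
  intro i j
  have e : A * B - 1 = (A - 1) * B + (B - 1) := by noncomm_ring
  rw [e, Matrix.add_apply]
  refine norm_add_le_of_le ?_ (hB i j)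
  simpa using norm_mul_apply_le h0 zero_le_one hA (hB.norm_le h1) i j

theorem IsNearOne.of_mul_eq_one {δ : ℝ} (h0 : 0 ≤ δ) {A B : Matrix n n F} (hA : IsNearOne δ A)
    (hB : ∀ i j, ‖B i j‖ ≤ 1) (hBA : B * A = 1) : IsNearOne δ B := by
  intro i j
  have e : B - 1 = -(B * (A - 1)) := by
    rw [mul_sub, hBA]
    noncomm_ring
  rw [e, Matrix.neg_apply, norm_neg]
  simpa using norm_mul_apply_le zero_le_one h0 hB hA i j

theorem isNearOne_one {δ : ℝ} (h0 : 0 ≤ δ) : IsNearOne δ (1 : Matrix n n F) := by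
  intro i j
  simpa using h0

theorem norm_eq_one_of_norm_sub_one {δ : ℝ} (h1 : δ < 1) {x : F} (h : ‖x - 1‖ ≤ δ) : ‖x‖ = 1 := by
  have := norm_add_eq_of_lt (x := (1 : F)) (y := x - 1) (by rw [norm_one]; exact h.trans_lt h1)
  simpa using this

theorem norm_det_le_one {A : Matrix (Fin 2) (Fin 2) F} (h : ∀ i j, ‖A i j‖ ≤ 1) : ‖A.det‖ ≤ 1 := by
  rw [det_fin_two]
  refine norm_sub_le_of_le ?_ ?_ <;> rw [norm_mul] <;>
    exact mul_le_one₀ (h _ _) (norm_nonneg _) (h _ _)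

theorem IsNearOne.norm_det {δ : ℝ} (h1 : δ < 1) {A : Matrix (Fin 2) (Fin 2) F}
    (h : IsNearOne δ A) : ‖A.det‖ = 1 := by
  have hA := h.norm_le h1.le
  refine norm_eq_one_of_norm_sub_one h1 ?_
  have e : A.det - 1 = (A 0 0 - 1) * A 1 1 + (A 1 1 - 1) - A 0 1 * A 1 0 := by
    rw [det_fin_two]
    ring
  have h00 := h 0 0
  have h01 := h 0 1
  have h11 := h 1 1
  simp only [Matrix.sub_apply, Matrix.one_apply_eq] at h00 h11
  rw [Matrix.sub_apply, Matrix.one_apply_ne (by decide), sub_zero] at h01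
  rw [e]
  refine norm_sub_le_of_le (norm_add_le_of_le ?_ h11) ?_ <;> rw [norm_mul]
  · exact (mul_le_of_le_one_right (norm_nonneg _) (hA _ _)).trans h00
  · exact (mul_le_of_le_one_right (norm_nonneg _) (hA _ _)).trans h01

theorem IsNearOne.inv {δ : ℝ} (h0 : 0 ≤ δ) (h1 : δ < 1) {a : GL (Fin 2) F}
    (h : IsNearOne δ a.1) : IsNearOne δ (a⁻¹).1 := by
  refine IsNearOne.of_mul_eq_one h0 h ?_ a.inv_mul
  intro i j
  rw [Matrix.coe_units_inv, Matrix.inv_def, Ring.inverse_eq_inv', Matrix.smul_apply, smul_eq_mul,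
    norm_mul, norm_inv, h.norm_det h1, inv_one, one_mul, adjugate_fin_two]
  have := h.norm_le h1.le
  fin_cases i <;> fin_cases j <;> simp [this]

/-- A vector of a smooth representation is fixed by a congruence subgroup. -/
theorem IsSmoothRep.exists_isNearOne {V : Type*} [AddCommGroup V] [Module ℂ V]
    {τ : Representation ℂ (GL (Fin 2) F) V} (hτ : IsSmoothRep τ) (v : V) :
    ∃ δ : ℝ, 0 < δ ∧ δ < 1 ∧ ∀ a : GL (Fin 2) F, IsNearOne δ a.1 → τ a v = v := by
  obtain ⟨U, hU⟩ := hτ v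
  -- The topology of GL₂ is induced by a ↦ (a, a⁻¹), so the inverse must be controlled too;
  -- `IsNearOne.inv` does this with the same δ.
  obtain ⟨O, hO, hOU⟩ := (Units.isEmbedding_embedProduct
    (M := Matrix (Fin 2) (Fin 2) F)).isInducing.isOpen_iff.1 U.isOpen
  have h1O : Units.embedProduct (Matrix (Fin 2) (Fin 2) F) 1 ∈ O := by
    change (1 : GL (Fin 2) F) ∈ Units.embedProduct (Matrix (Fin 2) (Fin 2) F) ⁻¹' O
    rw [hOU]
    exact U.one_mem
  let f : (Fin 2 → Fin 2 → F) × (Fin 2 → Fin 2 → F) →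
      Matrix (Fin 2) (Fin 2) F × (Matrix (Fin 2) (Fin 2) F)ᵐᵒᵖ :=
    fun p => (1 + Matrix.of p.1, MulOpposite.op (1 + Matrix.of p.2))
  have hf : Continuous f := by
    have h (i : Fin 2) (j : Fin 2) : Continuous
        fun p : (Fin 2 → Fin 2 → F) × (Fin 2 → Fin 2 → F) => p.1 i j := by fun_prop
    have h' (i : Fin 2) (j : Fin 2) : Continuous
        fun p : (Fin 2 → Fin 2 → F) × (Fin 2 → Fin 2 → F) => p.2 i j := by fun_prop
    refine Continuous.prodMk ?_ (MulOpposite.continuous_op.comp ?_)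
    · exact continuous_const.add (continuous_matrix h)
    · exact continuous_const.add (continuous_matrix h')
  have h0 : f 0 = Units.embedProduct (Matrix (Fin 2) (Fin 2) F) 1 := by
    refine Prod.ext ?_ (MulOpposite.unop_injective ?_) <;> simp [f]
  obtain ⟨ε, hε, hεO⟩ := Metric.mem_nhds_iff.1
    (hf.continuousAt.preimage_mem_nhds (hO.mem_nhds (h0 ▸ h1O)))
  refine ⟨min (ε / 2) (1 / 2), by positivity, (min_le_right _ _).trans_lt (by norm_num),
    fun a ha => hU a ?_⟩
  have ha' := ha.inv (by positivity) ((min_le_right _ _).trans_lt (by norm_num))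
  have hmem : ((fun i j => (a.1 - 1) i j, fun i j => ((a⁻¹).1 - 1) i j) :
      (Fin 2 → Fin 2 → F) × (Fin 2 → Fin 2 → F)) ∈ Metric.ball 0 ε := by
    rw [mem_ball_zero_iff, Prod.norm_def, max_lt_iff, pi_norm_lt_iff hε, pi_norm_lt_iff hε]
    constructor <;> intro i <;> rw [pi_norm_lt_iff hε] <;> intro j
    · exact ((ha i j).trans (min_le_left _ _)).trans_lt (by linarith)
    · exact ((ha' i j).trans (min_le_left _ _)).trans_lt (by linarith)
  have h2 := hεO hmem
  have h3 : a ∈ Units.embedProduct (Matrix (Fin 2) (Fin 2) F) ⁻¹' O := by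
    rw [Set.mem_preimage] at h2 ⊢
    convert h2 using 1
    refine Prod.ext ?_ (MulOpposite.unop_injective ?_)
    · change a.1 = 1 + (a.1 - 1)
      abel
    · change (a⁻¹).1 = 1 + ((a⁻¹).1 - 1)
      abel
  rw [hOU] at h3
  exact h3

end Congruence

/-! ### A section supported near ω₂; uniqueness of the local coefficient. -/

section BigCell

variable {F : Type*} [NontriviallyNormedField F] [IsUltrametricDist F] [ProperSpace F]
  [MeasurableSpace F] [BorelSpace F] {V : Type*} [AddCommGroup V] [Module ℂ V]
  {τ : Representation ℂ (GL (Fin 2) F) V}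

theorem isIntegral_inv {g : SO4 F} (h : IsIntegral g) : IsIntegral g⁻¹ := by
  have hj : ∀ i j, ‖j4 F i j‖ ≤ 1 := by
    intro i j
    rcases i with i | i <;> rcases j with j | j <;> fin_cases i <;> fin_cases j <;> simp [j4, j2]
  intro i j
  rw [SO4.inv_coe]
  have h1 := norm_mul_apply_le zero_le_one zero_le_one hj (B := g.1.1ᵀ) fun i j => h j i
  simpa using norm_mul_apply_le (by simp) zero_le_one h1 hj i j

theorem isNearOne_inv {δ : ℝ} (h0 : 0 ≤ δ) (h1 : δ ≤ 1) {g : SO4 F} (h : IsNearOne δ g.1.1) :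
    IsNearOne δ (g⁻¹).1.1 :=
  IsNearOne.of_mul_eq_one h0 h (isIntegral_inv (h.norm_le h1))
    (by rw [← mul_coe, inv_mul_cancel, one_coe])

theorem isNearOne_conj_w2 {δ : ℝ} (h0 : 0 ≤ δ) {g : SO4 F} (h : IsNearOne δ g.1.1) :
    IsNearOne δ (w2 F * g * w2 F).1.1 := by
  intro i j
  have e : (w2 F * g * w2 F).1.1 - 1 = (w2 F).1.1 * (g.1.1 - 1) * (w2 F).1.1 := by
    have : (w2 F).1.1 * (w2 F).1.1 = 1 := by rw [← mul_coe, w2_mul_w2, one_coe]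
    rw [mul_coe, mul_coe, Matrix.mul_sub, Matrix.sub_mul, Matrix.mul_one, this]
  rw [e]
  simpa using norm_mul_apply_le (by simpa using h0) zero_le_one
    (norm_mul_apply_le zero_le_one h0 isIntegral_w2 h) isIntegral_w2 i j

theorem isNearOne_n2 {δ : ℝ} (h0 : 0 ≤ δ) {x : F} (hx : ‖x‖ ≤ δ) : IsNearOne δ (n2 x).1.1 := by
  intro i j
  rw [n2_coe, ← fromBlocks_one]
  rcases i with i | i <;> rcases j with j | j <;> fin_cases i <;> fin_cases j <;> simp [hx, h0]

/-- The congruence subgroup of level `δ`. -/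
def congruenceSubgroup {δ : ℝ} (h0 : 0 ≤ δ) (h1 : δ ≤ 1) :
    Subgroup (SO4 F) where
  carrier := {g | IsNearOne δ g.1.1}
  mul_mem' := fun ha hb => IsNearOne.mul h0 h1 ha hb
  one_mem' := isNearOne_one h0
  inv_mem' := fun ha => isNearOne_inv h0 h1 ha

theorem isOpen_congruenceSubgroup {δ : ℝ} (h0 : 0 < δ) (h1 : δ ≤ 1) :
    IsOpen ((congruenceSubgroup h0.le h1 : Subgroup (SO4 F)) : Set (SO4 F)) := by
  refine Subgroup.isOpen_of_mem_nhds _ (g := 1) ?_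
  have h : ∀ i j, ∀ᶠ g : SO4 F in 𝓝 1, ‖(g.1.1 - 1) i j‖ ≤ δ := by
    intro i j
    have h1 : Metric.closedBall (0 : F) δ ∈ 𝓝 (((1 : SO4 F).1.1 - 1) i j) := by
      rw [one_coe, sub_self]
      exact Metric.closedBall_mem_nhds _ h0
    have hc : Continuous fun g : SO4 F => (g.1.1 - 1) i j :=
      (continuous_SO4_entry i j).sub continuous_const
    filter_upwards [hc.continuousAt h1] with g hg
    simpa using hg
  exact eventually_all.2 fun i => eventually_all.2 fun j => h i j

theorem toBlocks₁₁_m2_n2 (x y : F) (a : GL (Fin 2) F) :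
    (n2 x * m2 a * n2 y).1.1.toBlocks₁₁ = a.1 := by
  rw [mul_coe, mul_coe, n2_coe, n2_coe, m2_coe, fromBlocks_multiply, fromBlocks_multiply,
    toBlocks_fromBlocks₁₁]
  simp

theorem n2_neg (x : F) : n2 (-x) = (n2 x)⁻¹ :=
  (inv_eq_of_mul_eq_one_left (by rw [← n2_add, neg_add_cancel, n2_zero])).symm

theorem m2_inv (a : GL (Fin 2) F) : m2 a⁻¹ = (m2 a)⁻¹ :=
  (inv_eq_of_mul_eq_one_left (by rw [← m2_mul, inv_mul_cancel, m2_one])).symm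

theorem m2_mul_n2_inv_mul (a b : GL (Fin 2) F) (x y : F) :
    (m2 a * n2 x)⁻¹ * (m2 b * n2 y) = n2 (-x) * m2 (a⁻¹ * b) * n2 y := by
  rw [n2_neg, m2_mul, m2_inv]
  group

theorem IsNearOne.toBlocks₁₁ {δ : ℝ} {A : Matrix (Fin 2 ⊕ Fin 2) (Fin 2 ⊕ Fin 2) F}
    (h : IsNearOne δ A) : IsNearOne δ A.toBlocks₁₁ := by
  intro i j
  have := h (Sum.inl i) (Sum.inl j)
  simpa [Matrix.toBlocks₁₁, Matrix.one_apply] using this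

theorem exists_m2_mul_n2_eq (a b : GL (Fin 2) F) (x y : F) :
    ∃ z, m2 a * n2 x * (m2 b * n2 y) = m2 (a * b) * n2 z := by
  have e : m2 a * n2 x * (m2 b * n2 y) = m2 (a * b) * ((m2 b)⁻¹ * n2 x * m2 b * n2 y) := by
    rw [m2_mul]
    group
  -- Conjugation by m₂(b)⁻¹ scales N₂ by det b⁻¹.
  refine ⟨((b⁻¹).1.det) * x + y, ?_⟩
  rw [e, n2_add, ← m2_inv]
  congr 2
  apply SO4.ext_blocks
  rw [mul_coe, mul_coe, n2_coe, n2_coe, m2_coe, m2_coe, inv_inv, fromBlocks_multiply,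
    fromBlocks_multiply]
  have h1 : (b⁻¹).1 * b.1 = 1 := b.inv_mul
  have h2 : b.1ᵀ * (b⁻¹).1ᵀ = 1 := by rw [← transpose_mul, h1, transpose_one]
  congr 1
  · simp
  · rw [Matrix.eta_fin_two (b⁻¹).1, transpose_fin_two]
    ext i j
    fin_cases i <;> fin_cases j <;> simp [j2, det_fin_two] <;> ring
  · simp
  · have : j2 F * b.1ᵀ * j2 F * (j2 F * (b⁻¹).1ᵀ * j2 F) = 1 := by
      calc _ = j2 F * (b.1ᵀ * (j2 F * j2 F) * (b⁻¹).1ᵀ) * j2 F := by simp only [Matrix.mul_assoc]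
        _ = 1 := by rw [j2_mul_j2, Matrix.mul_one, h2, Matrix.mul_one, j2_mul_j2]
    simpa using this

/-- Both a and a⁻¹ occur as upper left blocks of integral matrices, so both determinants have norm
at most 1, with product 1. -/
theorem norm_det_eq_one {a : GL (Fin 2) F} {x : F} (h : IsIntegral (m2 a * n2 x)) :
    ‖a.1.det‖ = 1 := by
  have h1 : ∀ i j, ‖a.1 i j‖ ≤ 1 := by
    intro i j
    rw [← toBlocks₁₁_m2_n2 0 x a, n2_zero, one_mul]
    exact h _ _
  have h2 : ∀ i j, ‖(a⁻¹).1 i j‖ ≤ 1 := by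
    intro i j
    rw [← toBlocks₁₁_m2_n2 (-x) 0 a⁻¹, n2_zero, mul_one, n2_neg, m2_inv, ← _root_.mul_inv_rev]
    exact isIntegral_inv h _ _
  have h3 : ‖a.1.det‖ * ‖(a⁻¹).1.det‖ = 1 := by
    rw [← norm_mul, ← det_mul, a.mul_inv, det_one, norm_one]
  nlinarith [norm_det_le_one h1, norm_det_le_one h2, norm_nonneg a.1.det,
    norm_nonneg (a⁻¹).1.det]

/-- The section supported on the translate `P ω₂ K` of the Siegel parabolic subgroup `P`, where `K`
is the congruence subgroup of level `δ`, with value `v` at `ω₂`. -/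
def cellSection (τ : Representation ℂ (GL (Fin 2) F) V) (δ : ℝ) (v : V) (s : ℂ) (g : SO4 F) : V :=
  open Classical in
  if h : ∃ (a : GL (Fin 2) F) (x : F) (u : SO4 F), IsNearOne δ u.1.1 ∧
      g = m2 a * n2 x * w2 F * u
  then absPow (GeneralLinearGroup.det h.choose) s • τ h.choose v else 0

theorem absPow_det_eq_one {a : GL (Fin 2) F} (h : ‖a.1.det‖ = 1) (s : ℂ) :
    absPow (GeneralLinearGroup.det a) s = 1 :=
  absPow_eq_one_of_norm_eq_one (by rwa [GeneralLinearGroup.val_det_apply]) s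

variable {δ : ℝ} {v : V}

/-- Two decompositions pω₂u = p'ω₂u' satisfy p⁻¹p' = ω₂(uu'⁻¹)ω₂, which is congruent to 1. Its Levi
part fixes v and has determinant of norm 1, so the chosen decomposition is immaterial. -/
theorem cellSection_apply (h0 : 0 < δ) (h1 : δ < 1)
    (hv : ∀ a : GL (Fin 2) F, IsNearOne δ a.1 → τ a v = v) (s : ℂ) (a : GL (Fin 2) F) (x : F)
    {u : SO4 F} (hu : IsNearOne δ u.1.1) :
    cellSection τ δ v s (m2 a * n2 x * w2 F * u) =
      absPow (GeneralLinearGroup.det a) s • τ a v := by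
  have h : ∃ (b : GL (Fin 2) F) (y : F) (u' : SO4 F), IsNearOne δ u'.1.1 ∧
      m2 a * n2 x * w2 F * u = m2 b * n2 y * w2 F * u' := ⟨a, x, u, hu, rfl⟩
  rw [cellSection, dif_pos h]
  obtain ⟨y, u', hu', e⟩ := h.choose_spec
  set b := h.choose
  have e1 : (m2 a * n2 x)⁻¹ * (m2 b * n2 y) = w2 F * (u * u'⁻¹) * w2 F := by
    rw [inv_mul_eq_iff_eq_mul]
    calc m2 b * n2 y = m2 b * n2 y * w2 F * u' * u'⁻¹ * (w2 F)⁻¹ := by group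
      _ = _ := by
        rw [← e, w2_inv]
        group
  have h2 : IsNearOne δ (w2 F * (u * u'⁻¹) * w2 F).1.1 :=
    isNearOne_conj_w2 h0.le (IsNearOne.mul h0.le h1.le hu (isNearOne_inv h0.le h1.le hu'))
  rw [← e1, m2_mul_n2_inv_mul] at h2
  have h3 := h2.toBlocks₁₁
  rw [toBlocks₁₁_m2_n2] at h3
  have e2 : b = a * (a⁻¹ * b) := by group
  generalize a⁻¹ * b = c at h3 e2
  rw [e2, map_mul, map_mul, absPow_mul, absPow_det_eq_one (h3.norm_det h1), mul_one,
    Module.End.mul_apply, hv _ h3]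

theorem isStandardSection_cellSection (h0 : 0 < δ) (h1 : δ < 1)
    (hv : ∀ a : GL (Fin 2) F, IsNearOne δ a.1 → τ a v = v) :
    IsStandardSection τ (cellSection τ δ v) := by
  refine ⟨fun s => ⟨⟨⟨_, isOpen_congruenceSubgroup h0 h1.le⟩, fun u hu g => ?_⟩, fun b y g => ?_⟩,
    fun k hk s s' => ?_⟩
  · have hu' : IsNearOne δ u.1.1 := hu
    by_cases hg : ∃ (a : GL (Fin 2) F) (x : F) (u : SO4 F), IsNearOne δ u.1.1 ∧
      g = m2 a * n2 x * w2 F * u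
    · obtain ⟨a, x, u₁, hu₁, rfl⟩ := hg
      rw [mul_assoc, cellSection_apply h0 h1 hv s a x hu₁,
        cellSection_apply h0 h1 hv s a x (hu₁.mul h0.le h1.le hu')]
    · rw [cellSection, cellSection, dif_neg hg, dif_neg]
      rintro ⟨a, x, u₁, hu₁, e⟩
      refine hg ⟨a, x, u₁ * u⁻¹, hu₁.mul h0.le h1.le (isNearOne_inv h0.le h1.le hu'), ?_⟩
      rw [← mul_assoc, ← e, mul_inv_cancel_right]
  · rw [← absPow_add, add_sub_cancel]
    by_cases hg : ∃ (a : GL (Fin 2) F) (x : F) (u : SO4 F), IsNearOne δ u.1.1 ∧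
      g = m2 a * n2 x * w2 F * u
    · obtain ⟨a, x, u, hu, rfl⟩ := hg
      obtain ⟨z, hz⟩ := exists_m2_mul_n2_eq b a y x
      have e : m2 b * n2 y * (m2 a * n2 x * w2 F * u) = m2 (b * a) * n2 z * w2 F * u := by
        rw [← hz]
        group
      rw [e, cellSection_apply h0 h1 hv s _ _ hu, cellSection_apply h0 h1 hv s _ _ hu, map_smul,
        smul_smul, map_mul, map_mul, absPow_mul, Module.End.mul_apply]
    · rw [cellSection, cellSection, dif_neg hg, dif_neg, map_zero, smul_zero]
      rintro ⟨a, x, u, hu, e⟩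
      obtain ⟨z, hz⟩ := exists_m2_mul_n2_eq 1 (b⁻¹ * a) (-y) x
      rw [m2_one, one_mul, one_mul, ← mul_assoc, ← m2_mul_n2_inv_mul] at hz
      refine hg ⟨b⁻¹ * a, z, u, hu, ?_⟩
      rw [← hz, ← inv_mul_eq_iff_eq_mul.2 e]
      group
  -- If pω₂u is integral, then so is p, and |det|^s = 1 on its Levi part for every s.
  · by_cases hg : ∃ (a : GL (Fin 2) F) (x : F) (u : SO4 F), IsNearOne δ u.1.1 ∧
      k = m2 a * n2 x * w2 F * u
    · obtain ⟨a, x, u, hu, rfl⟩ := hg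
      have e : m2 a * n2 x = m2 a * n2 x * w2 F * u * (u⁻¹ * w2 F) := by
        calc _ = m2 a * n2 x * w2 F * u * (u⁻¹ * (w2 F)⁻¹) := by group
          _ = _ := by rw [w2_inv]
      have h2 : IsIntegral (m2 a * n2 x) := by
        rw [e]
        exact hk.mul ((isIntegral_inv (hu.norm_le h1.le)).mul isIntegral_w2)
      rw [cellSection_apply h0 h1 hv s a x hu, cellSection_apply h0 h1 hv s' a x hu,
        absPow_det_eq_one (norm_det_eq_one h2), absPow_det_eq_one (norm_det_eq_one h2)]
    · rw [cellSection, cellSection, dif_neg hg, dif_neg hg]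

/-- If ω₂n₂(y) = pω₂u, then u is a block lower triangular matrix times n₂(y). The entry of u above
the diagonal is thus -y times a diagonal entry of norm 1, and it has norm at most δ. -/
theorem cellSection_w2_n2 (h0 : 0 < δ) (h1 : δ < 1)
    (hv : ∀ a : GL (Fin 2) F, IsNearOne δ a.1 → τ a v = v) (s : ℂ) (y : F) [Decidable (‖y‖ ≤ δ)] :
    cellSection τ δ v s (w2 F * n2 y) = if ‖y‖ ≤ δ then v else 0 := by
  split_ifs with hy
  · have e : w2 F * n2 y = m2 1 * n2 0 * w2 F * n2 y := by rw [m2_one, n2_zero, one_mul, one_mul]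
    rw [e, cellSection_apply h0 h1 hv s 1 0 (isNearOne_n2 h0.le hy), map_one, map_one, absPow_one,
      one_smul, Module.End.one_apply]
  · rw [cellSection, dif_neg]
    rintro ⟨a, x, u, hu, e⟩
    have e1 : u = w2 F * ((m2 a * n2 x)⁻¹ * (m2 1 * n2 0)) * w2 F * n2 y := by
      rw [m2_one, n2_zero, one_mul, mul_one]
      calc u = (w2 F)⁻¹ * (m2 a * n2 x)⁻¹ * (m2 a * n2 x * w2 F * u) := by group
        _ = _ := by rw [← e, w2_inv, ← mul_assoc]
    have e2 : u.1.1 (Sum.inl 0) (Sum.inr 0) = -(u.1.1 (Sum.inl 0) (Sum.inl 0) * y) := by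
      rw [e1, m2_mul_n2_inv_mul, n2_zero, mul_one]
      simp only [mul_coe, w2_coe, n2_coe, m2_coe, fromBlocks_multiply]
      simp [Matrix.mul_apply, Fin.sum_univ_two]
    have h2 : ‖u.1.1 (Sum.inl 0) (Sum.inl 0)‖ = 1 := by
      refine norm_eq_one_of_norm_sub_one h1 ?_
      simpa using hu (Sum.inl 0) (Sum.inl 0)
    have h3 : ‖u.1.1 (Sum.inl 0) (Sum.inr 0)‖ ≤ δ := by
      simpa using hu (Sum.inl 0) (Sum.inr 0)
    rw [e2, norm_neg, norm_mul, h2, one_mul] at h3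
    exact hy h3

variable {μ : Measure F} [μ.IsAddHaarMeasure]

/-- There is a standard section all of whose Jacquet integrals are non-zero. -/
theorem exists_section_jacquet_ne_zero (hτ : IsSmoothRep τ) {ψ : AddChar F Circle} {C : ℝ}
    (hC : HasConductor ψ C) {Λ : V →ₗ[ℂ] ℂ} (hΛ : Λ ≠ 0) :
    ∃ ξ, IsStandardSection τ ξ ∧ ∀ s A,
      HasStableIntegral μ (fun y => Λ (ξ s (w2 F * n2 y)) * (ψ y : ℂ)) A → A ≠ 0 := by
  classical
  obtain ⟨v, hv⟩ : ∃ v, Λ v ≠ 0 := by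
    by_contra! h
    exact hΛ (LinearMap.ext h)
  obtain ⟨δ', hδ0, hδ1, hδ⟩ := hτ.exists_isNearOne v
  -- With δ ≤ C the character ψ is trivial on the support, so the Jacquet integral is Λ(v) times a
  -- volume.
  set δ := min δ' C
  have h0 : 0 < δ := lt_min hδ0 hC.1
  have h1 : δ < 1 := (min_le_left _ _).trans_lt hδ1
  have hv' : ∀ a : GL (Fin 2) F, IsNearOne δ a.1 → τ a v = v := fun a ha =>
    hδ a fun i j => (ha i j).trans (min_le_left _ _)
  refine ⟨cellSection τ δ v, isStandardSection_cellSection h0 h1 hv', fun s A hA => ?_⟩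
  obtain ⟨R, ⟨-, hR⟩, hRδ⟩ := (hA.and (eventually_ge_atTop δ)).exists
  have e : (fun y => Λ (cellSection τ δ v s (w2 F * n2 y)) * (ψ y : ℂ)) =
      fun y => Λ v * ballFun δ y := by
    ext y
    rw [cellSection_w2_n2 h0 h1 hv']
    split_ifs with hy
    · rw [ballFun_of_le hy, hC.eq_one (hy.trans (min_le_right _ _)), Circle.coe_one]
    · rw [ballFun_of_lt (not_le.1 hy), map_zero, zero_mul, mul_zero]
  rw [← hR, e, setIntegral_eq_integral_of_forall_compl_eq_zero, integral_const_mul,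
    integral_ballFun]
  · exact mul_ne_zero hv (by exact_mod_cast (measureReal_closedBall_pos (μ := μ) h0).ne')
  · intro y hy
    rw [mem_closedBall_zero_iff, not_le] at hy
    rw [ballFun_of_lt (hRδ.trans_lt hy), mul_zero]

theorem HasStableIntegral.unique {f : F → ℂ} {A B : ℂ} (hA : HasStableIntegral μ f A)
    (hB : HasStableIntegral μ f B) : A = B := by
  obtain ⟨R, hR, hR'⟩ := (hA.and hB).exists
  rw [← hR.2, hR'.2]

theorem HasVectorIntegral.unique {f : F → V} {v w : V} (hv : HasVectorIntegral μ f v)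
    (hw : HasVectorIntegral μ f w) : v = w := by
  rw [← sub_eq_zero]
  refine (Module.forall_dual_apply_eq_zero_iff ℂ (v - w)).1 fun ℓ => ?_
  rw [map_sub, ← (hv ℓ).2, ← (hw ℓ).2, sub_self]

/-- For Re s ≫ 0 the intertwined family is an actual integral and hence determined. A section with A
≠ 0 then forces B ≠ 0, so that γ = A/B on infinitely many values of q^{-(2s-1)}. -/
theorem IsLocalCoefficient.unique (hτ : IsSmoothRep τ) {ψ : AddChar F Circle} {C : ℝ}
    (hC : HasConductor ψ C) (hgen : IsGeneric ψ τ) {γ γ' : RatFunc ℂ}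
    (h : IsLocalCoefficient ψ μ τ γ) (h' : IsLocalCoefficient ψ μ τ γ') : γ = γ' := by
  obtain ⟨Λ, hΛ, hW⟩ := hgen
  obtain ⟨ξ, hξ, hA0⟩ := exists_section_jacquet_ne_zero (μ := μ) hτ hC hΛ
  obtain ⟨η, ⟨⟨σ₁, h₁⟩, -⟩, E, hE⟩ := h Λ hW ξ hξ
  obtain ⟨η', ⟨⟨σ₁', h₁'⟩, -⟩, E', hE'⟩ := h' Λ hW ξ hξ
  obtain ⟨σ₂, h₂⟩ := exists_qs_notMem (F := F) E
  obtain ⟨σ₂', h₂'⟩ := exists_qs_notMem (F := F) E'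
  refine ratFunc_eq_of_eval_qs_eq (F := F) (σ := max (max σ₁ σ₁') (max σ₂ σ₂')) (a := 2) (b := 1)
    two_ne_zero fun s hs => ?_
  simp only [max_lt_iff] at hs
  obtain ⟨⟨hs1, hs1'⟩, hs2, hs2'⟩ := hs
  obtain ⟨A, B, hA, hB, e⟩ := hE (s : ℂ) (h₂ _ (by simpa using hs2))
  obtain ⟨A', B', hA', hB', e'⟩ := hE' (s : ℂ) (h₂' _ (by simpa using hs2'))
  have hη : η s = η' s := funext fun g =>
    (h₁ s (by simpa using hs1) g).unique (h₁' s (by simpa using hs1') g)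
  rw [← hη] at hB'
  rw [hA'.unique hA, hB'.unique hB] at e'
  have hB0 : B ≠ 0 := by
    rintro rfl
    exact hA0 s A hA (by rw [e, mul_zero])
  push_cast
  exact mul_right_cancel₀ hB0 (e.symm.trans e')

end BigCell

/-! ### Schur's lemma in countable dimension. -/

section Schur

variable {V : Type*} [AddCommGroup V] [Module ℂ V]

theorem isUnit_aeval_of_forall_isUnit {Z : Module.End ℂ V}
    (h : ∀ a : ℂ, IsUnit (Z - algebraMap ℂ (Module.End ℂ V) a)) {p : Polynomial ℂ} (hp : p ≠ 0) :
    IsUnit (Polynomial.aeval Z p) := by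
  have hs := (IsAlgClosed.splits p).eq_prod_roots
  rw [hs, map_mul, Polynomial.aeval_C]
  refine IsUnit.mul ?_ ?_
  · exact (IsUnit.mk0 _ (Polynomial.leadingCoeff_ne_zero.2 hp)).map _
  · by_contra hu
    obtain ⟨k, hk, -⟩ := spectrum.exists_mem_of_not_isUnit_aeval_prod hu
    rw [spectrum.mem_iff] at hk
    refine hk ?_
    rw [← neg_sub]
    exact (h k).neg

/-- Partial fractions: clearing denominators in a relation among the (Z - a)⁻¹v gives p(Z)v = 0.
Since p(Z) is invertible for p ≠ 0, p vanishes, and evaluating p at each a isolates its coefficient.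
-/
theorem linearIndependent_resolvent {Z : Module.End ℂ V}
    (h : ∀ a : ℂ, IsUnit (Z - algebraMap ℂ (Module.End ℂ V) a)) {v : V} (hv : v ≠ 0) :
    LinearIndependent ℂ fun a : ℂ => ((h a).unit⁻¹ : (Module.End ℂ V)ˣ).1 v := by
  classical
  refine linearIndependent_iff'.2 fun s m hm i hi => ?_
  let q : Finset ℂ → Polynomial ℂ := fun t => ∏ j ∈ t, (Polynomial.X - Polynomial.C j)
  have h1 : ∀ i ∈ s, Polynomial.aeval Z (q s) (((h i).unit⁻¹ : (Module.End ℂ V)ˣ).1 v) =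
      Polynomial.aeval Z (q (s.erase i)) v := by
    intro i hi
    have e : q s = q (s.erase i) * (Polynomial.X - Polynomial.C i) :=
      (Finset.prod_erase_mul s _ hi).symm
    have e' : (Z - algebraMap ℂ (Module.End ℂ V) i) * ((h i).unit⁻¹ : (Module.End ℂ V)ˣ).1 = 1 :=
      (h i).mul_val_inv
    rw [e, map_mul, map_sub, Polynomial.aeval_X, Polynomial.aeval_C, Module.End.mul_apply,
      ← Module.End.mul_apply (Z - _), e', Module.End.one_apply]
  let p : Polynomial ℂ := ∑ i ∈ s, Polynomial.C (m i) * q (s.erase i)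
  have hp : Polynomial.aeval Z p v = 0 := by
    have h2 := congrArg (Polynomial.aeval Z (q s)) hm
    rw [map_sum, map_zero] at h2
    rw [← h2, map_sum, LinearMap.sum_apply]
    refine Finset.sum_congr rfl fun i hi => ?_
    rw [map_smul, h1 i hi, map_mul, Polynomial.aeval_C, Module.End.mul_apply,
      Module.algebraMap_end_apply]
  have hp0 : p = 0 := by
    by_contra hne
    have hu := isUnit_aeval_of_forall_isUnit h hne
    exact hv (((Module.End.isUnit_iff _).1 hu).1 (by rw [hp, map_zero]))
  have h3 := congrArg (Polynomial.eval i) hp0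
  rw [Polynomial.eval_finsetSum, Polynomial.eval_zero, Finset.sum_eq_single_of_mem i hi] at h3
  · rw [Polynomial.eval_mul, Polynomial.eval_C] at h3
    refine (mul_eq_zero.1 h3).resolve_right ?_
    simp only [q, Polynomial.eval_prod, Polynomial.eval_sub, Polynomial.eval_X, Polynomial.eval_C]
    exact Finset.prod_ne_zero_iff.2 fun j hj => sub_ne_zero.2 (Finset.ne_of_mem_erase hj).symm
  · intro j _ hji
    rw [Polynomial.eval_mul]
    simp only [q, Polynomial.eval_prod, Polynomial.eval_sub, Polynomial.eval_X, Polynomial.eval_C]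
    rw [Finset.prod_eq_zero (Finset.mem_erase.2 ⟨hji.symm, hi⟩) (sub_self i), mul_zero]

/-- An operator on a space of countable dimension has a non-empty spectrum. -/
theorem exists_not_isUnit_sub_algebraMap {S : Set V} (hS : S.Countable)
    (hspan : Submodule.span ℂ S = ⊤) [Nontrivial V] (Z : Module.End ℂ V) :
    ∃ a : ℂ, ¬ IsUnit (Z - algebraMap ℂ (Module.End ℂ V) a) := by
  by_contra! h
  obtain ⟨v, hv⟩ := exists_ne (0 : V)
  -- With empty spectrum the resolvents would give continuum many independent vectors.
  have h1 := (linearIndependent_resolvent h hv).cardinal_lift_le_rank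
  have h2 : Module.rank ℂ V ≤ Cardinal.aleph0 := by
    rw [← rank_top, ← hspan]
    exact (rank_span_le S).trans (Cardinal.le_aleph0_iff_set_countable.2 hS)
  have h3 := h1.trans (Cardinal.lift_le.2 h2)
  rw [Cardinal.mk_complex, Cardinal.lift_continuum, Cardinal.lift_aleph0] at h3
  exact absurd h3 (not_le.2 Cardinal.aleph0_lt_continuum)

variable {G : Type*} [Group G] [TopologicalSpace G] [ContinuousMul G]
  [TopologicalSpace.SeparableSpace G] {τ : Representation ℂ G V}

/-- The orbit map factors through G/U with U open, and a countable dense subset of G meets every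
coset. -/
theorem IsSmoothRep.countable_range (hτ : IsSmoothRep τ) (v : V) :
    (Set.range fun g => τ g v).Countable := by
  obtain ⟨U, hU⟩ := hτ v
  obtain ⟨D, hD, hDd⟩ := TopologicalSpace.exists_countable_dense G
  refine (hD.image fun g => τ g v).mono ?_
  rintro _ ⟨g, rfl⟩
  have ho : IsOpen ((fun x => g⁻¹ * x) ⁻¹' (U : Set G)) :=
    U.isOpen.preimage (continuous_const.mul continuous_id)
  obtain ⟨d, hdD, hdU⟩ := hDd.exists_mem_open ho ⟨g, by simp⟩
  refine ⟨d, hdD, ?_⟩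
  have h1 : τ (g⁻¹ * d) v = v := hU _ hdU
  beta_reduce
  nth_rewrite 2 [← h1]
  rw [← Module.End.mul_apply, ← map_mul, mul_inv_cancel_left]

/-- Schur's lemma for smooth irreducible representations. -/
theorem IsSmoothRep.exists_eq_smul (hτ : IsSmoothRep τ) (hirr : τ.IsIrreducible) [Nontrivial V]
    (Z : Module.End ℂ V) (hZ : ∀ g, Z * τ g = τ g * Z) : ∃ a : ℂ, ∀ v, Z v = a • v := by
  obtain ⟨v, hv⟩ := exists_ne (0 : V)
  let W : Subrepresentation τ :=
    { toSubmodule := Submodule.span ℂ (Set.range fun g => τ g v)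
      apply_mem_toSubmodule := fun g w hw => by
        refine Submodule.span_induction (p := fun w _ => τ g w ∈
          Submodule.span ℂ (Set.range fun g => τ g v)) ?_ ?_ ?_ ?_ hw
        · rintro _ ⟨h, rfl⟩
          exact Submodule.subset_span ⟨g * h, by simp⟩
        · rw [map_zero]
          exact zero_mem _
        · intro x y _ _ hx hy
          rw [map_add]
          exact add_mem hx hy
        · intro a x _ hx
          rw [map_smul]
          exact Submodule.smul_mem _ a hx }
  have hvW : v ∈ W.toSubmodule := Submodule.subset_span ⟨1, by simp⟩
  have hW : W = ⊤ := by
    refine (eq_bot_or_eq_top W).resolve_left fun h => hv ?_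
    rw [h] at hvW
    exact hvW
  -- By irreducibility the countable orbit of v spans V, so Z has a spectral value a; then Z - a is
  -- an intertwiner that is not invertible, hence 0.
  have hspan : Submodule.span ℂ (Set.range fun g => τ g v) = ⊤ := by
    have : W.toSubmodule = ⊤ := by rw [hW]; rfl
    exact this
  obtain ⟨a, ha⟩ := exists_not_isUnit_sub_algebraMap (hτ.countable_range v) hspan Z
  let f : Representation.IntertwiningMap τ τ :=
    { Z - algebraMap ℂ (Module.End ℂ V) a with
      isIntertwining' := fun g => by
        change (Z - algebraMap ℂ (Module.End ℂ V) a) * τ g =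
          τ g * (Z - algebraMap ℂ (Module.End ℂ V) a)
        rw [sub_mul, mul_sub, hZ, Algebra.commutes] }
  refine ⟨a, fun w => ?_⟩
  rcases Representation.IsIrreducible.bijective_or_eq_zero f with h | h
  · exact absurd ((Module.End.isUnit_iff _).2 h) ha
  · have h1 : f w = 0 := by rw [h]; rfl
    exact sub_eq_zero.1 h1

end Schur

/-! ### Existence and uniqueness of the central character. -/

section CentralCharacter

variable {F : Type*} [NontriviallyNormedField F] [IsUltrametricDist F] [ProperSpace F]
  [MeasurableSpace F] [BorelSpace F] {V : Type*} [AddCommGroup V] [Module ℂ V] {τ : Representation ℂ (GL (Fin 2) F) V}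

theorem separableSpace_GL : TopologicalSpace.SeparableSpace (GL (Fin 2) F) := by
  have h1 : SecondCountableTopology F := inferInstance
  have h2 : SecondCountableTopology (Matrix (Fin 2) (Fin 2) F) :=
    inferInstanceAs (SecondCountableTopology (Fin 2 → Fin 2 → F))
  have h3 : SecondCountableTopology (Matrix (Fin 2) (Fin 2) F)ᵐᵒᵖ :=
    MulOpposite.opHomeomorph.symm.isEmbedding.secondCountableTopology
  have h4 : SecondCountableTopology (GL (Fin 2) F) :=
    (Units.isEmbedding_embedProduct (M := Matrix (Fin 2) (Fin 2) F)).secondCountableTopology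
  infer_instance

theorem exists_isTrivialNearOne (hτ : IsSmoothRep τ) [Nontrivial V] {ω : Fˣ →* ℂˣ}
    (hω : ∀ (z : Fˣ) (v : V), τ (GeneralLinearGroup.scalar (Fin 2) z) v = (ω z : ℂ) • v) :
    ∃ r, IsTrivialNearOne ω r := by
  obtain ⟨v, hv⟩ := exists_ne (0 : V)
  obtain ⟨r, h0, h1, hr⟩ := hτ.exists_isNearOne v
  refine ⟨r, h0, h1, fun z hz => Units.ext (smul_left_injective ℂ hv ?_)⟩
  have h2 := hr (GeneralLinearGroup.scalar (Fin 2) z) fun i j => by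
    rw [GeneralLinearGroup.coe_scalar]
    fin_cases i <;> fin_cases j <;> simp [hz, h0.le]
  simpa [hω] using h2

theorem IsTrivialNearOne.continuous {χ : Fˣ →* ℂˣ} {r : ℝ} (h : IsTrivialNearOne χ r) :
    Continuous χ := by
  refine continuous_of_continuousAt_one χ ?_
  have h1 : ∀ᶠ z : Fˣ in 𝓝 1, χ z = 1 := by
    have h2 : Metric.closedBall (1 : F) r ∈ 𝓝 (((1 : Fˣ) : F)) :=
      Metric.closedBall_mem_nhds _ h.1
    filter_upwards [Units.continuous_val.continuousAt h2] with z hz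
    exact h.2.2 z (mem_closedBall_iff_norm.1 hz)
  have h3 : χ =ᶠ[𝓝 1] fun _ => 1 := h1
  exact continuousAt_const.congr h3.symm

theorem IsIrreducible.exists_scalar (hτ : IsSmoothRep τ) (hirr : τ.IsIrreducible) [Nontrivial V] :
    ∃ ω : Fˣ →* ℂˣ, ∀ (z : Fˣ) (v : V),
      τ (GeneralLinearGroup.scalar (Fin 2) z) v = (ω z : ℂ) • v := by
  have := separableSpace_GL (F := F)
  have h : ∀ z : Fˣ, ∃ a : ℂ, ∀ v, τ (GeneralLinearGroup.scalar (Fin 2) z) v = a • v := by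
    refine fun z => hτ.exists_eq_smul hirr _ fun g => ?_
    rw [← map_mul, ← map_mul, GeneralLinearGroup.scalar_commute z g]
  choose c hc using h
  obtain ⟨v, hv⟩ := exists_ne (0 : V)
  let f : Fˣ →* ℂ :=
    { toFun := c
      map_one' := smul_left_injective ℂ hv (by simp [← hc])
      map_mul' := fun z w => smul_left_injective ℂ hv (by
        simp only
        rw [← hc, map_mul, map_mul, Module.End.mul_apply, hc, hc, smul_smul, mul_comm]) }
  exact ⟨f.toHomUnits, fun z v => hc z v⟩

/-- In the induced model, right translation by the scalar z is left translation by t(z, z), for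
which the modulus factor is 1; the character is χ₁χ₂. -/
theorem IsInducedOfLanglandsType.exists_scalar (h : IsInducedOfLanglandsType τ) :
    ∃ ω : Fˣ →* ℂˣ, ∀ (z : Fˣ) (v : V),
      τ (GeneralLinearGroup.scalar (Fin 2) z) v = (ω z : ℂ) • v := by
  obtain ⟨χ₁, χ₂, -, -, -, ⟨e⟩⟩ := h
  refine ⟨χ₁ * χ₂, fun z v => e.toLinearEquiv.injective ?_⟩
  have h1 : e.toLinearEquiv (τ (GeneralLinearGroup.scalar (Fin 2) z) v) =
      principalSeries χ₁ χ₂ (GeneralLinearGroup.scalar (Fin 2) z) (e.toLinearEquiv v) :=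
    LinearMap.congr_fun (e.isIntertwining' (GeneralLinearGroup.scalar (Fin 2) z)) v
  rw [h1, map_smul]
  generalize e.toLinearEquiv v = f
  ext g
  have h2 : g * GeneralLinearGroup.scalar (Fin 2) z = tMat z z * zMat 0 * g := by
    rw [← GeneralLinearGroup.scalar_commute z g]
    congr 1
    apply Units.ext
    rw [Units.val_mul, tMat_coe, GeneralLinearGroup.coe_scalar]
    ext i j
    fin_cases i <;> fin_cases j <;> simp [zMat, GeneralLinearGroup.mkOfDetNeZero]
  have h3 := f.2.2 z z 0 g
  rw [← h2, mul_inv_cancel, absPow_one, mul_one] at h3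
  exact h3

theorem IsCentralCharacter.unique [Nontrivial V] {ω ω' : Fˣ →* ℂˣ} (h : IsCentralCharacter τ ω)
    (h' : IsCentralCharacter τ ω') : ω = ω' := by
  obtain ⟨v, hv⟩ := exists_ne (0 : V)
  ext z
  exact smul_left_injective ℂ hv ((h.2 z v).symm.trans (h'.2 z v))

end CentralCharacter

end LocalCoefficient

end

/-! ### The main theorem. -/

theorem corollary3p7
    {F : Type*} [NontriviallyNormedField F] [IsUltrametricDist F] [ProperSpace F] [CharZero F]
    [MeasurableSpace F] [BorelSpace F]
    (ψ : AddChar F Circle) (hψ : Continuous ψ) (hψ' : ψ ≠ 1)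
    (μ : MeasureTheory.Measure F) (hμ : LocalCoefficient.IsSelfDual ψ μ)
    {V : Type*} [AddCommGroup V] [Module ℂ V]
    (τ : Representation ℂ (Matrix.GeneralLinearGroup (Fin 2) F) V)
    (hsmooth : LocalCoefficient.IsSmoothRep τ)
    (hgeneric : LocalCoefficient.IsGeneric ψ τ)
    (hτ : τ.IsIrreducible ∨ LocalCoefficient.IsInducedOfLanglandsType τ) :
    (∃! ω, LocalCoefficient.IsCentralCharacter τ ω) ∧
    (∃! γ, LocalCoefficient.IsLocalCoefficient ψ μ τ γ) ∧
    (∃! γ, LocalCoefficient.IsTateGamma ψ μ (LocalCoefficient.centralCharacter τ) γ) ∧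
    LocalCoefficient.localCoefficient ψ μ τ =
      LocalCoefficient.tateGamma ψ μ (LocalCoefficient.centralCharacter τ) := by
  have := hμ.1
  have : Nontrivial V := by
    obtain ⟨Λ, hΛ, -⟩ := hgeneric
    by_contra h
    rw [not_nontrivial_iff_subsingleton] at h
    exact hΛ (LinearMap.ext fun v => by rw [Subsingleton.elim v 0, map_zero, map_zero])
  obtain ⟨ω₀, hω₀⟩ : ∃ ω : Fˣ →* ℂˣ, ∀ (z : Fˣ) (v : V),
      τ (Matrix.GeneralLinearGroup.scalar (Fin 2) z) v = (ω z : ℂ) • v := by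
    rcases hτ with h | h
    · exact LocalCoefficient.IsIrreducible.exists_scalar hsmooth h
    · exact h.exists_scalar
  have hex : ∃ ω, LocalCoefficient.IsCentralCharacter τ ω := by
    obtain ⟨r, hr⟩ := LocalCoefficient.exists_isTrivialNearOne hsmooth hω₀
    exact ⟨ω₀, hr.continuous, hω₀⟩
  have hω : LocalCoefficient.IsCentralCharacter τ (LocalCoefficient.centralCharacter τ) :=
    Classical.epsilon_spec hex
  obtain ⟨r, hr⟩ := LocalCoefficient.exists_isTrivialNearOne hsmooth hω.2
  obtain ⟨ϖ, hϖ⟩ := LocalCoefficient.exists_isUniformizer (F := F)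
  obtain ⟨C, hC⟩ := LocalCoefficient.exists_hasConductor hψ hψ'
  obtain ⟨R₀, hR₀⟩ := LocalCoefficient.exists_isStableRadius hψ' hr.1
  -- One function serves both definitions: the inverse of the Gauss integral of the central
  -- character at radius R₀. Uniqueness on each side then identifies the two chosen values.
  obtain ⟨γ, hγ, E, hE⟩ := LocalCoefficient.exists_isTateGamma hϖ hr hψ hψ' hμ hR₀
  have hγ' : LocalCoefficient.IsLocalCoefficient ψ μ τ γ :=
    LocalCoefficient.isLocalCoefficient_of_gauss hω hr hϖ hC hR₀ hE
  have hu : ∀ γ', LocalCoefficient.IsLocalCoefficient ψ μ τ γ' → γ' = γ := fun γ' h =>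
    h.unique hsmooth hC hgeneric hγ'
  have hu' : ∀ γ', LocalCoefficient.IsTateGamma ψ μ (LocalCoefficient.centralCharacter τ) γ' →
      γ' = γ := fun γ' h => h.unique hr hγ
  refine ⟨⟨_, hω, fun ω' h => h.unique hω⟩, ⟨γ, hγ', hu⟩, ⟨γ, hγ, hu'⟩, ?_⟩
  exact (hu _ (Classical.epsilon_spec ⟨γ, hγ'⟩)).trans
    (hu' _ (Classical.epsilon_spec ⟨γ, hγ⟩)).symm
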